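/- **Setting.** A two-colored partition $p\in P^{\circ\bullet}(m,n)$ is a decomposition into blocks of $m$ upper and $n$ lower points (each row ordered from left to right), every point being white ($\circ$) or black ($\bullet$); it is noncrossing ($p\in NC^{\circ\bullet}$) if its strings can be drawn without crossings. $p\otimes q$ is horizontal concatenation, $pq$ vertical concatenation (defined if the lower row of $q$ has the same length and colors as the upper row of $p$), $p^*$ reflection at the horizontal axis. A rotated version of $p$ is obtained by finitely many moves of the leftmost (or the rightmost) point of one row to the left (respectively right) end of the other row, each move inverting the color of the moved point and keeping the blocks. A category of partitions is a collection of two-colored partitions closed under $\otimes$, composition and $*$ that contains the two pair partitions on two lower points of different colors ($\circ\bullet$ and $\bullet\circ$) and the identity partitions $\circ|\circ$ and $\bullet|\bullet$ in $P^{\circ\bullet}(1,1)$; $\langle\ldots\rangle$ is the smallest category containing the listed partitions. Let $c(p)\in\mathbb Z$ be the number of lower white and upper black points of $p$ minus the number of lower black and upper white points of $p$. On one line, let ${\uparrow}_\circ$ and ${\uparrow}_\bullet$ be the white and the black singleton; ${\uparrow}_\circ^{\otimes 0}=\emptyset$, and ${\uparrow}_\bullet^{\otimes -s}:={\uparrow}_\circ^{\otimes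 s}$. For $d\in\mathbb N_0$ let $\pi_d$ consist of ${\uparrow}_\circ^{\otimes d}$ followed by a pair block with white left leg and black right leg having ${\uparrow}_\bullet^{\otimes d}$ between its legs. For $r\in\mathbb N_0$ let $\beta_{r+1}$ consist of ${\uparrow}_\circ^{\otimes (r+1)}$ followed by a pair block with two black legs having ${\uparrow}_\bullet^{\otimes (r-1)}$ between its legs. **Parameters.** Let $k,d\in\mathbb N_0$ be such that $d$ divides $k$ if $k\neq0$, and let $r\in\{0,\frac d2\}\cap\mathbb N_0$ with $r\neq1$. Let $\mathcal C_{B'}^{loc}(k,d,r)$ be the set of all $p\in NC^{\circ\bullet}$ such that (i) all blocks of $p$ have size one or two; (ii) $c(p)\in k\mathbb Z$; (iii) whenever a rotated version of $p$ without upper points is of the form $p_1\otimes p_2$, where $p_1$ may be empty, $p_2$ has at least two points and the first and the last point of $p_2$ belong to the same block, then $c(p_1)\in d\mathbb Z$ if these two points have different colors, $c(p_1)\in d\mathbb Z+r+1$ if both are black, and $-c(p_1)\in d\mathbb Z+r+1$ if both are white. Let $\mathcal C_B^{loc}(k,d)$ be the set of all $p\in \mathcal C_{B'}^{loc}(k,d,r)$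 such that, when $p$ is rotated to one line, every block of size two consists of a white and a black point (this set does not depend on $r$). **Theorem.** (1) For all such parameters, $$\mathcal C_{B'}^{loc}(k,d,r)=\langle {\uparrow}_\circ^{\otimes k},\ \pi_d,\ \beta_{r+1},\ {\uparrow}_\circ\otimes{\uparrow}_\bullet\rangle,\qquad \mathcal C_B^{loc}(k,d)=\langle {\uparrow}_\circ^{\otimes k},\ \pi_d,\ {\uparrow}_\circ\otimes{\uparrow}_\bullet\rangle .$$ (2) If condition (iii) is imposed only for nonempty $p_1$ (that is, only for $p_1\otimes p_2$ in nest decomposed form), then the second equality still holds for all such parameters, and the first one holds for all such parameters except possibly for $(k,d,r)=(2,2,0)$. (3) These categories are pairwise different: $\mathcal C_{B'}^{loc}(k,d,r)=\mathcal C_{B'}^{loc}(k',d',r')$ only if $(k,d,r)=(k',d',r')$; $\mathcal C_B^{loc}(k,d)=\mathcal C_B^{loc}(k',d')$ only if $(k,d)=(k',d')$; and $\mathcal C_{B'}^{loc}(k,d,r)\neq\mathcal C_B^{loc}(k',d')$ always. -/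

import Mathlib

/-! Two-colored partitions, their operations, categories of partitions, and the sets of noncrossing
partitions with blocks of size one or two that are studied in the theorem. -/

namespace TwoColored

/-- The two colors of points. -/
inductive Color where
  | white : Color
  | black : Color

/-- The inverse color. -/
def Color.inv : Color → Color
  | .white => .black
  | .black => .white

/-- `1` for a white point, `-1` for a black point. -/
def Color.sign : Color → ℤ
  | .white => 1
  | .black => -1

/-- The set `P(k,l)` of two-colored partitions with `k` upper points (`Sum.inl`) and `l` lower points
(`Sum.inr`), both rows numbered from left to right. Two points are related by `rel` if and only if
they belong to the same block. -/
@[ext]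
structure ColoredPartition (k l : ℕ) where
  up : Fin k → Color
  lo : Fin l → Color
  rel : Setoid (Fin k ⊕ Fin l)

/-- A collection of subsets of the sets `P(k,l)`. -/
abbrev Family := ∀ k l : ℕ, Set (ColoredPartition k l)

namespace ColoredPartition

/-! ### Operations -/

/-- Sorting the points of a tensor product into those of the left and those of the right factor. -/
def tensorPoints (k l k' l' : ℕ) :
    Fin (k + k') ⊕ Fin (l + l') → (Fin k ⊕ Fin l) ⊕ (Fin k' ⊕ Fin l') :=
  Sum.elim
    (Fin.addCases (fun i => Sum.inl (Sum.inl i)) (fun i => Sum.inr (Sum.inl i)))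
    (Fin.addCases (fun i => Sum.inl (Sum.inr i)) (fun i => Sum.inr (Sum.inr i)))

/-- The disjoint union of two equivalence relations. -/
def sumSetoid {α β : Type} (r : Setoid α) (s : Setoid β) : Setoid (α ⊕ β) where
  r := Sum.LiftRel (fun a b => r a b) (fun a b => s a b)
  iseqv := by
    refine ⟨?_, ?_, ?_⟩
    · rintro (a | b)
      · exact Sum.LiftRel.inl (r.refl a)
      · exact Sum.LiftRel.inr (s.refl b)
    · rintro _ _ (h | h)
      · exact Sum.LiftRel.inl (r.symm h)
      · exact Sum.LiftRel.inr (s.symm h)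
    · rintro _ _ _ (h | h) (h' | h')
      · exact Sum.LiftRel.inl (r.trans h h')
      · exact Sum.LiftRel.inr (s.trans h h')

/-- The tensor product `p ⊗ q`: `p` on the left, `q` on the right. -/
def tensor {k l k' l' : ℕ} (p : ColoredPartition k l) (q : ColoredPartition k' l') :
    ColoredPartition (k + k') (l + l') where
  up := Fin.append p.up q.up
  lo := Fin.append p.lo q.lo
  rel := Setoid.comap (tensorPoints k l k' l') (sumSetoid p.rel q.rel)

/-- One step of connecting upper, middle and lower points: two upper or middle points are connected
by `q`, two middle or lower points are connected by `p`. -/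
inductive CompStep {k l m : ℕ} (p : ColoredPartition l m) (q : ColoredPartition k l) :
    Fin k ⊕ Fin l ⊕ Fin m → Fin k ⊕ Fin l ⊕ Fin m → Prop
  | above (a b : Fin k ⊕ Fin l) : q.rel a b →
      CompStep p q (Sum.map id Sum.inl a) (Sum.map id Sum.inl b)
  | below (a b : Fin l ⊕ Fin m) : p.rel a b → CompStep p q (Sum.inr a) (Sum.inr b)

/-- The composition `p q` (`q` is drawn above `p`). It is used only if the lower row of `q` has the
colors of the upper row of `p`. -/
def comp {k l m : ℕ} (p : ColoredPartition l m) (q : ColoredPartition k l) : ColoredPartition k m where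
  up := q.up
  lo := p.lo
  rel := Setoid.comap (Sum.map id Sum.inr) (Relation.EqvGen.setoid (CompStep p q))

/-- The involution `p*`: reflection at the horizontal axis. -/
def involution {k l : ℕ} (p : ColoredPartition k l) : ColoredPartition l k where
  up := p.lo
  lo := p.up
  rel := Setoid.comap Sum.swap p.rel

/-- The leftmost upper point becomes the leftmost lower point, with inverted color. -/
def rotLeftDown {k l : ℕ} (p : ColoredPartition (k + 1) l) : ColoredPartition k (l + 1) where
  up := fun i => p.up i.succ
  lo := Fin.cons (p.up 0).inv p.lo
  rel := Setoid.comap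
    (Sum.elim (fun i => Sum.inl i.succ) (Fin.cases (Sum.inl 0) (fun j => Sum.inr j))) p.rel

/-- The leftmost lower point becomes the leftmost upper point, with inverted color. -/
def rotLeftUp {k l : ℕ} (p : ColoredPartition k (l + 1)) : ColoredPartition (k + 1) l where
  up := Fin.cons (p.lo 0).inv p.up
  lo := fun j => p.lo j.succ
  rel := Setoid.comap
    (Sum.elim (Fin.cases (Sum.inr 0) (fun i => Sum.inl i)) (fun j => Sum.inr j.succ)) p.rel

/-- The rightmost upper point becomes the rightmost lower point, with inverted color. -/
def rotRightDown {k l : ℕ} (p : ColoredPartition (k + 1) l) : ColoredPartition k (l + 1) where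
  up := fun i => p.up i.castSucc
  lo := Fin.snoc (α := fun _ => Color) p.lo (p.up (Fin.last k)).inv
  rel := Setoid.comap
    (Sum.elim (fun i => Sum.inl i.castSucc)
      (Fin.lastCases (Sum.inl (Fin.last k)) (fun j => Sum.inr j))) p.rel

/-- The rightmost lower point becomes the rightmost upper point, with inverted color. -/
def rotRightUp {k l : ℕ} (p : ColoredPartition k (l + 1)) : ColoredPartition (k + 1) l where
  up := Fin.snoc (α := fun _ => Color) p.up (p.lo (Fin.last l)).inv
  lo := fun j => p.lo j.castSucc
  rel := Setoid.comap
    (Sum.elim (Fin.lastCases (Sum.inr (Fin.last l)) (fun i => Sum.inl i))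
      (fun j => Sum.inr j.castSucc)) p.rel

/-- `Rotated p q`: the partition `q` is a rotated version of `p`, that is, it is obtained from `p`
by finitely many (possibly no) rotation steps. -/
inductive Rotated {k l : ℕ} (p : ColoredPartition k l) : ∀ {k' l' : ℕ}, ColoredPartition k' l' → Prop
  | refl : Rotated p p
  | leftDown {k' l' : ℕ} {q : ColoredPartition (k' + 1) l'} : Rotated p q → Rotated p q.rotLeftDown
  | leftUp {k' l' : ℕ} {q : ColoredPartition k' (l' + 1)} : Rotated p q → Rotated p q.rotLeftUp
  | rightDown {k' l' : ℕ} {q : ColoredPartition (k' + 1) l'} : Rotated p q → Rotated p q.rotRightDown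
  | rightUp {k' l' : ℕ} {q : ColoredPartition k' (l' + 1)} : Rotated p q → Rotated p q.rotRightUp

/-! ### Noncrossing partitions, block sizes, and the number `c(p)` -/

/-- The place of a point when the whole boundary is read along one line: first the upper row from
right to left, then the lower row from left to right. -/
def place {k l : ℕ} : Fin k ⊕ Fin l → ℕ
  | Sum.inl i => k - 1 - (i : ℕ)
  | Sum.inr j => k + (j : ℕ)

/-- The strings of the partition can be drawn without crossings: there are no four points
`a, b, c, d` in this order along the boundary such that `a, c` lie in one block and `b, d` in
another one. -/
def IsNoncrossing {k l : ℕ} (p : ColoredPartition k l) : Prop :=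
  ∀ a b c d : Fin k ⊕ Fin l, place a < place b → place b < place c → place c < place d →
    p.rel a c → p.rel b d → p.rel a b

/-- All blocks have size one or two. -/
def BlocksOneOrTwo {k l : ℕ} (p : ColoredPartition k l) : Prop :=
  ∀ B ∈ p.rel.classes, B.ncard = 1 ∨ B.ncard = 2

/-- The number `c(p)`: lower white and upper black points count `1`, lower black and upper white
points count `-1`. -/
def c {k l : ℕ} (p : ColoredPartition k l) : ℤ :=
  ∑ j, (p.lo j).sign - ∑ i, (p.up i).sign

/-- The first and the last point of a partition on one line (with at least two points) belong to the
same block. -/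
def EndsConnected {n : ℕ} (p : ColoredPartition 0 (n + 2)) : Prop :=
  p.rel (Sum.inr 0) (Sum.inr (Fin.last (n + 1)))

/-- `p₁ ⊗ p₂` is in nest decomposed form: `p₁` is not empty, and `p₂` has at least two points, the
first and the last of which belong to the same block. -/
def NestDecomposed {m n : ℕ} (_p₁ : ColoredPartition 0 m) (p₂ : ColoredPartition 0 (n + 2)) : Prop :=
  m ≠ 0 ∧ EndsConnected p₂

/-- All blocks of size two consist of a white and a black point when the partition is rotated to one
line. -/
def BicoloredPairs {k l : ℕ} (p : ColoredPartition k l) : Prop :=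
  ∀ (n : ℕ) (q : ColoredPartition 0 n), Rotated p q →
    ∀ B ∈ q.rel.classes, B.ncard = 2 →
      ∀ i j : Fin n, Sum.inr i ∈ B → Sum.inr j ∈ B → i ≠ j → q.lo i ≠ q.lo j

/-! ### Special partitions -/

/-- A pair of lower points of the given colors forming one block. -/
def pair (a b : Color) : ColoredPartition 0 2 where
  up := Fin.elim0
  lo := ![a, b]
  rel := ⊤

/-- An upper and a lower point of the same color forming one block. -/
def identity (a : Color) : ColoredPartition 1 1 where
  up := fun _ => a
  lo := fun _ => a
  rel := ⊤

/-- The color white if `0 ≤ s`, and black if `s < 0`. -/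
def signColor (s : ℤ) : Color := if 0 ≤ s then .white else .black

/-- The `s`-fold tensor power of the white singleton; for negative `s` this is by convention the
`(-s)`-fold tensor power of the black singleton. -/
def singletons (s : ℤ) : ColoredPartition 0 s.natAbs where
  up := Fin.elim0
  lo := fun _ => signColor s
  rel := ⊥

/-- A pair block on points of colors `a` (left) and `b` (right) that has the partition `p` between
its two legs. -/
def around {n : ℕ} (a : Color) (p : ColoredPartition 0 n) (b : Color) : ColoredPartition 0 (n + 1 + 1) where
  up := Fin.elim0
  lo := Fin.cons a (Fin.snoc (α := fun _ => Color) p.lo b)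
  rel := Setoid.comap
    (Sum.elim (fun i : Fin 0 => Sum.inl i.elim0)
      (Fin.cases (motive := fun _ => Unit ⊕ (Fin 0 ⊕ Fin n)) (Sum.inl ())
        (Fin.lastCases (motive := fun _ => Unit ⊕ (Fin 0 ⊕ Fin n)) (Sum.inl ())
          (fun j => Sum.inr (Sum.inr j)))))
    (sumSetoid ⊤ p.rel)

/-- The positioner partition with word `a₁ ⋯ a_d x b₁ ⋯ b_d x⁻¹`: first `d` white singletons, then a
pair with a white left and a black right leg, having `d` black singletons between its legs. -/
def positioner (d : ℕ) : ColoredPartition 0 ((d : ℤ).natAbs + ((-(d : ℤ)).natAbs + 1 + 1)) :=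
  (singletons d).tensor (around .white (singletons (-d)) .black)

/-- The positioner partition with two black legs: first `r + 1` white singletons, then a pair of two
black points having `r - 1` black singletons (one white singleton, if `r = 0`) between its legs. -/
def blackPositioner (r : ℕ) :
    ColoredPartition 0 (((r : ℤ) + 1).natAbs + ((1 - (r : ℤ)).natAbs + 1 + 1)) :=
  (singletons (r + 1)).tensor (around .black (singletons (1 - r)) .black)

/-- The tensor product of a white and a black singleton. -/
def singletonWB : ColoredPartition 0 ((1 : ℤ).natAbs + (-1 : ℤ).natAbs) :=
  (singletons 1).tensor (singletons (-1))

end ColoredPartition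

open TwoColored.ColoredPartition

/-! ### Categories of partitions -/

/-- Categories of (two-colored) partitions. -/
structure IsCategory (C : Family) : Prop where
  tensor : ∀ {k l k' l' : ℕ} {p : ColoredPartition k l} {q : ColoredPartition k' l'},
    p ∈ C k l → q ∈ C k' l' → p.tensor q ∈ C (k + k') (l + l')
  comp : ∀ {k l m : ℕ} {p : ColoredPartition l m} {q : ColoredPartition k l},
    p ∈ C l m → q ∈ C k l → q.lo = p.up → p.comp q ∈ C k m
  involution : ∀ {k l : ℕ} {p : ColoredPartition k l}, p ∈ C k l → p.involution ∈ C l k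
  pair_wb : pair .white .black ∈ C 0 2
  pair_bw : pair .black .white ∈ C 0 2
  identity_w : identity .white ∈ C 1 1
  identity_b : identity .black ∈ C 1 1

/-- The smallest category of partitions containing a given set of partitions. -/
def generated (G : Set (Σ k l : ℕ, ColoredPartition k l)) : Family := fun k l =>
  {p | ∀ C : Family, IsCategory C → (∀ x ∈ G, x.2.2 ∈ C x.1 x.2.1) → p ∈ C k l}

/-- The generated category is a category. -/
theorem isCategory_generated (G : Set (Σ k l : ℕ, ColoredPartition k l)) : IsCategory (generated G) where
  tensor hp hq C hC hG := hC.tensor (hp C hC hG) (hq C hC hG)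
  comp hp hq h C hC hG := hC.comp (hp C hC hG) (hq C hC hG) h
  involution hp C hC hG := hC.involution (hp C hC hG)
  pair_wb _ hC _ := hC.pair_wb
  pair_bw _ hC _ := hC.pair_bw
  identity_w _ hC _ := hC.identity_w
  identity_b _ hC _ := hC.identity_b

/-- The generators of the category with pairs of all color patterns. -/
def gensB' (k d r : ℕ) : Set (Σ k l : ℕ, ColoredPartition k l) :=
  {⟨0, _, singletons k⟩, ⟨0, _, positioner d⟩, ⟨0, _, blackPositioner r⟩, ⟨0, _, singletonWB⟩}

/-- The generators of the category with bicolored pairs only. -/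
def gensB (k d : ℕ) : Set (Σ k l : ℕ, ColoredPartition k l) :=
  {⟨0, _, singletons k⟩, ⟨0, _, positioner d⟩, ⟨0, _, singletonWB⟩}

/-! ### The sets of partitions described by block sizes and colorings -/

/-- The condition on `s = c(p₁)` when the first and the last point of `p₂` have colors `a`, `b`. -/
def NestCondition (d r : ℕ) : Color → Color → ℤ → Prop
  | .black, .black, s => ∃ t : ℤ, s = d * t + r + 1
  | .white, .white, s => ∃ t : ℤ, -s = d * t + r + 1
  | _, _, s => ∃ t : ℤ, s = d * t

/-- The set `C_{B'}^{loc}(k,d,r)`; in the last condition `p₁` may be empty. -/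
def locB' (k d r : ℕ) : Family := fun k' l' =>
  {p : ColoredPartition k' l' | p.IsNoncrossing ∧ p.BlocksOneOrTwo ∧ (∃ t : ℤ, p.c = k * t) ∧
    ∀ (m n : ℕ) (p₁ : ColoredPartition 0 m) (p₂ : ColoredPartition 0 (n + 2)),
      Rotated p (p₁.tensor p₂) → EndsConnected p₂ →
        NestCondition d r (p₂.lo 0) (p₂.lo (Fin.last (n + 1))) p₁.c}

/-- The variant of `locB'` in which the last condition is imposed for nest decomposed forms only,
that is, only for nonempty `p₁`. -/
def locB'Nest (k d r : ℕ) : Family := fun k' l' =>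
  {p : ColoredPartition k' l' | p.IsNoncrossing ∧ p.BlocksOneOrTwo ∧ (∃ t : ℤ, p.c = k * t) ∧
    ∀ (m n : ℕ) (p₁ : ColoredPartition 0 m) (p₂ : ColoredPartition 0 (n + 2)),
      Rotated p (p₁.tensor p₂) → NestDecomposed p₁ p₂ →
        NestCondition d r (p₂.lo 0) (p₂.lo (Fin.last (n + 1))) p₁.c}

/-- The set `C_B^{loc}(k,d)`: the partitions in `locB' k d r` all of whose pairs are bicolored. (The
value of `r` does not matter, because `r` is only used for pairs of points of the same color.) -/
def locB (k d r : ℕ) : Family := fun k' l' => {p | p ∈ locB' k d r k' l' ∧ p.BicoloredPairs}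

/-- The variant of `locB` for nonempty `p₁`. -/
def locBNest (k d r : ℕ) : Family := fun k' l' =>
  {p | p ∈ locB'Nest k d r k' l' ∧ p.BicoloredPairs}

/-- The range of the parameters: `d` divides `k` if `k ≠ 0`, and `r ∈ {0, d/2}` is a natural number
with `r ≠ 1`. -/
def Admissible (k d r : ℕ) : Prop :=
  (k ≠ 0 → d ∣ k) ∧ (r = 0 ∨ 2 * r = d) ∧ r ≠ 1

end TwoColored

/-!
The inclusion of the generated categories in the sets of partitions rests on an invariant that is local.
Read the boundary of a partition along one line, count a white point as `1` and a black point as `-1`,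
and let the level of a point be the larger one of the two partial sums taken without and with this point.
Two neighboring points of different colors have the same level. A noncrossing partition with blocks of
size at most two is called well levelled if the two points of each pair have the same level modulo `d`,
up to the summand `r` for two points of one color (`WellLevelled`); because of `2 r ≡ 0` modulo `d`, it does
not matter in which order the two points are taken. Well levelled partitions whose color sum is divisible
by `k` form a category (`isCategory_levelled`): a tensor product is an insertion of one boundary into
another one, a composition is a tensor product followed by contractions of neighboring points of different
colors, and neither step changes the level differences modulo `d` (`WellLevelled.insertion`,
`WellLevelled.contraction`). The generators are well levelled, and for a rotated version `p₁ ⊗ p₂` whose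
second factor begins and ends in the same block, the level condition for this block is the condition on
`c(p₁)` (`levelled_subset_locB'`).

For the other inclusion, partitions are written as words of colored points with labels for the blocks, and
the category operations become operations on words: rotation, insertion of one word into another, and
contraction. By means of `↑∘ ⊗ ↑•`, words of singletons can be exchanged for any others of the same color
sum (`IsCategory.line_exchange`). The positioners among the generators can be combined to positioners
for all pairs allowed by the nest condition (`hasPositioner_of_nestCondition`). A word that satisfies the
nest condition is then built by induction on the number of its pairs (`NestedWord.contains`): an innermost
pair, which has only singletons between its legs, is cut into two singletons, and the pair is put back by
inserting a positioner and cancelling singletons. If all pairs are cut, then a word of singletons with a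
color sum in `k ℤ` is left, which comes from `↑∘^{⊗ k}`.

If the nest condition is known for nonempty `p₁` only, then it is recovered for empty `p₁` by rotating the
points between the two legs to the front (`nestCondition_of_nestDecomposed`). This fails only for a
single pair of points of one color; its color sum `± 2` forces `k ∣ 2`, which leaves the exceptional case.
The parameters are determined by the generators that a category contains.
-/

namespace TwoColored

/-! ### Levels of points on a line -/

theorem Color.inv_inv (a : Color) : a.inv.inv = a := by cases a <;> rfl

theorem Color.sign_inv (a : Color) : a.inv.sign = -a.sign := by cases a <;> rfl

/-- `1` for a white point, `0` for a black point. -/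
def Color.whiteness : Color → ℤ
  | .white => 1
  | .black => 0

/-- `1` if the two colors are equal, and `0` otherwise. -/
def Color.same : Color → Color → ℤ
  | .white, .white => 1
  | .black, .black => 1
  | _, _ => 0

/-- The sum of the signs of the points of `S` that lie before the point `u`. -/
def height {X : Type} (S : Finset X) (pos : X → ℕ) (col : X → Color) (u : X) : ℤ :=
  ∑ w ∈ S, if pos w < pos u then (col w).sign else 0

/-- The level of a point: the larger one of the two sums of signs taken up to the point, without it
and with it. Two adjacent points of different colors have the same level. -/
def level {X : Type} (S : Finset X) (pos : X → ℕ) (col : X → Color) (u : X) : ℤ :=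
  height S pos col u + (col u).whiteness

/-- The condition on the difference `t` of the levels of two points of colors `a`, `b` in one block. -/
def LevelCondition (d r : ℕ) (a b : Color) (t : ℤ) : Prop := (d : ℤ) ∣ t - r * Color.same a b

/-- A partition of a finite set `S` of colored points on a line (`pos` gives the order) is well levelled
if it is noncrossing with blocks of size at most two, and the levels of the two points of a pair agree
modulo `d` up to the summand `r` for pairs of one color. If `bi` holds, then all pairs are moreover
required to be bicolored. -/
structure WellLevelled {X : Type} (d r : ℕ) (bi : Prop) (S : Finset X) (pos : X → ℕ) (col : X → Color)
    (R : Setoid X) : Prop where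
  noncrossing : ∀ a ∈ S, ∀ b ∈ S, ∀ c ∈ S, ∀ e ∈ S, pos a < pos b → pos b < pos c → pos c < pos e →
    R a c → R b e → R a b
  size : ∀ a ∈ S, ∀ b ∈ S, ∀ c ∈ S, R a b → R a c → a = b ∨ a = c ∨ b = c
  levels : ∀ a ∈ S, ∀ b ∈ S, a ≠ b → R a b →
    LevelCondition d r (col a) (col b) (level S pos col a - level S pos col b)
  bicolored : bi → ∀ a ∈ S, ∀ b ∈ S, a ≠ b → R a b → col a ≠ col b

variable {X Y : Type} {d r : ℕ} {bi : Prop}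

/-- Being well levelled depends only on the order of the points, their colors and the blocks. -/
theorem WellLevelled.transfer {S : Finset X} {pos : X → ℕ} {col : X → Color} {R : Setoid X}
    (h : WellLevelled d r bi S pos col R) {T : Finset Y} {pos' : Y → ℕ} {col' : Y → Color}
    {R' : Setoid Y} (f : Y → X) (hf : Function.Injective f) (hS : ∀ z, z ∈ S ↔ ∃ y ∈ T, f y = z)
    (hpos : ∀ a ∈ T, ∀ b ∈ T, pos (f a) < pos (f b) ↔ pos' a < pos' b)
    (hcol : ∀ a ∈ T, col (f a) = col' a) (hR : ∀ a ∈ T, ∀ b ∈ T, R (f a) (f b) ↔ R' a b) :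
    WellLevelled d r bi T pos' col' R' := by
  have hm : ∀ a ∈ T, f a ∈ S := fun a ha => (hS _).2 ⟨a, ha, rfl⟩
  have hl : ∀ a ∈ T, level S pos col (f a) = level T pos' col' a := by
    intro a ha
    have hST : S = T.map ⟨f, hf⟩ := by
      ext z; rw [hS, Finset.mem_map]; rfl
    unfold level height
    rw [hcol a ha, hST, Finset.sum_map]
    congr 1
    refine Finset.sum_congr rfl fun w hw => ?_
    simp only [Function.Embedding.coeFn_mk, hpos w hw a ha, hcol w hw]
  refine ⟨?_, ?_, ?_, ?_⟩
  · intro a ha b hb c hc e he h1 h2 h3 h4 h5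
    rw [← hR a ha b hb]
    exact h.noncrossing _ (hm a ha) _ (hm b hb) _ (hm c hc) _ (hm e he) ((hpos a ha b hb).2 h1)
      ((hpos b hb c hc).2 h2) ((hpos c hc e he).2 h3) ((hR a ha c hc).2 h4) ((hR b hb e he).2 h5)
  · intro a ha b hb c hc h1 h2
    have := h.size _ (hm a ha) _ (hm b hb) _ (hm c hc) ((hR a ha b hb).2 h1) ((hR a ha c hc).2 h2)
    simpa only [hf.eq_iff] using this
  · intro a ha b hb hab h1
    have := h.levels _ (hm a ha) _ (hm b hb) (hf.ne hab) ((hR a ha b hb).2 h1)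
    rwa [hl a ha, hl b hb, hcol a ha, hcol b hb] at this
  · intro hbi a ha b hb hab h1
    have := h.bicolored hbi _ (hm a ha) _ (hm b hb) (hf.ne hab) ((hR a ha b hb).2 h1)
    rwa [hcol a ha, hcol b hb] at this

/-- The points of `S` are inserted between two neighboring points of `T`, at the front, or at the end
(`hgap`). Because the signs of `S` sum up to a multiple of `d`, the levels of the points of `T` do not
change modulo `d`. -/
theorem WellLevelled.insertion {S : Finset X} {pos : X → ℕ} {col : X → Color} {R : Setoid X}
    (h : WellLevelled d r bi S pos col R) {T : Finset Y} {pos' : Y → ℕ} {col' : Y → Color}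
    {R' : Setoid Y} (h' : WellLevelled d r bi T pos' col' R') (P : X ⊕ Y → ℕ)
    (hX : ∀ a ∈ S, ∀ b ∈ S, P (.inl a) < P (.inl b) ↔ pos a < pos b)
    (hY : ∀ a ∈ T, ∀ b ∈ T, P (.inr a) < P (.inr b) ↔ pos' a < pos' b)
    (hgap : ∀ b ∈ T, (∀ a ∈ S, P (.inr b) < P (.inl a)) ∨ (∀ a ∈ S, P (.inl a) < P (.inr b)))
    (hsum : (d : ℤ) ∣ ∑ a ∈ S, (col a).sign) :
    WellLevelled d r bi (S.disjSum T) P (Sum.elim col col') (ColoredPartition.sumSetoid R R') := by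
  have rll : ∀ a b, ColoredPartition.sumSetoid R R' (.inl a) (.inl b) ↔ R a b := fun a b => Sum.liftRel_inl_inl
  have rrr : ∀ a b, ColoredPartition.sumSetoid R R' (.inr a) (.inr b) ↔ R' a b := fun a b => Sum.liftRel_inr_inr
  have rlr : ∀ a b, ¬ ColoredPartition.sumSetoid R R' (.inl a) (.inr b) := fun a b => Sum.not_liftRel_inl_inr
  have rrl : ∀ a b, ¬ ColoredPartition.sumSetoid R R' (.inr a) (.inl b) := fun a b => Sum.not_liftRel_inr_inl
  have hl : ∀ a ∈ S, ∀ b ∈ S, level (S.disjSum T) P (Sum.elim col col') (.inl a) -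
      level (S.disjSum T) P (Sum.elim col col') (.inl b) = level S pos col a - level S pos col b := by
    intro a ha b hb
    unfold level height
    simp only [Finset.sum_disjSum, Sum.elim_inl, Sum.elim_inr]
    have e1 : ∀ a ∈ S, (∑ x ∈ S, if P (.inl x) < P (.inl a) then (col x).sign else 0) =
        ∑ x ∈ S, if pos x < pos a then (col x).sign else 0 := fun a ha =>
      Finset.sum_congr rfl fun w hw => by simp only [hX w hw a ha]
    have e2 : (∑ x ∈ T, if P (.inr x) < P (.inl a) then (col' x).sign else 0) =
        ∑ x ∈ T, if P (.inr x) < P (.inl b) then (col' x).sign else 0 :=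
      Finset.sum_congr rfl fun w hw => by
        rcases hgap w hw with h1 | h1
        · rw [if_pos (h1 a ha), if_pos (h1 b hb)]
        · rw [if_neg (h1 a ha).asymm, if_neg (h1 b hb).asymm]
    rw [e1 a ha, e1 b hb, e2]; ring
  have hl' : ∀ a ∈ T, ∃ t : ℤ, level (S.disjSum T) P (Sum.elim col col') (.inr a) =
      level T pos' col' a + d * t := by
    intro a ha
    obtain ⟨t, ht⟩ := hsum
    unfold level height
    simp only [Finset.sum_disjSum, Sum.elim_inl, Sum.elim_inr]
    have e1 : (∑ x ∈ T, if P (.inr x) < P (.inr a) then (col' x).sign else 0) =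
        ∑ x ∈ T, if pos' x < pos' a then (col' x).sign else 0 :=
      Finset.sum_congr rfl fun w hw => by simp only [hY w hw a ha]
    rw [e1]
    rcases hgap a ha with h1 | h1
    · refine ⟨0, ?_⟩
      rw [Finset.sum_eq_zero fun w hw => if_neg (h1 w hw).asymm]; ring
    · refine ⟨t, ?_⟩
      rw [Finset.sum_congr rfl fun w hw => if_pos (h1 w hw), ht]; ring
  refine ⟨?_, ?_, ?_, ?_⟩
  · rintro (a | a) ha (b | b) hb (c | c) hc (e | e) he h1 h2 h3 h4 h5 <;>
      simp only [Finset.inl_mem_disjSum, Finset.inr_mem_disjSum, rll, rrr, rlr, rrl] at *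
    · exact h.noncrossing a ha b hb c hc e he ((hX a ha b hb).1 h1) ((hX b hb c hc).1 h2)
        ((hX c hc e he).1 h3) h4 h5
    · rcases hgap b hb with h6 | h6
      · have := h6 a ha; omega
      · have := h6 c hc; omega
    · rcases hgap c hc with h6 | h6
      · have := h6 b hb; omega
      · have := h6 e he; omega
    · exact h'.noncrossing a ha b hb c hc e he ((hY a ha b hb).1 h1) ((hY b hb c hc).1 h2)
        ((hY c hc e he).1 h3) h4 h5
  · rintro (a | a) ha (b | b) hb (c | c) hc h1 h2 <;>
      simp only [Finset.inl_mem_disjSum, Finset.inr_mem_disjSum, rll, rrr, rlr, rrl, Sum.inl.injEq,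
        Sum.inr.injEq] at *
    · exact h.size a ha b hb c hc h1 h2
    · exact h'.size a ha b hb c hc h1 h2
  · rintro (a | a) ha (b | b) hb hab h1 <;>
      simp only [Finset.inl_mem_disjSum, Finset.inr_mem_disjSum, rll, rrr, rlr, rrl, Sum.inl.injEq,
        Sum.inr.injEq, ne_eq, Sum.elim_inl, Sum.elim_inr] at *
    · rw [hl a ha b hb]
      exact h.levels a ha b hb hab h1
    · obtain ⟨t, ht⟩ := hl' a ha
      obtain ⟨s, hs⟩ := hl' b hb
      have := h'.levels a ha b hb hab h1
      rw [ht, hs]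
      unfold LevelCondition at *
      obtain ⟨v, hv⟩ := this
      exact ⟨v + t - s, by linear_combination hv⟩
  · rintro hbi (a | a) ha (b | b) hb hab h1 <;>
      simp only [Finset.inl_mem_disjSum, Finset.inr_mem_disjSum, rll, rrr, rlr, rrl, Sum.inl.injEq,
        Sum.inr.injEq, ne_eq, Sum.elim_inl, Sum.elim_inr] at *
    · exact h.bicolored hbi a ha b hb hab h1
    · exact h'.bicolored hbi a ha b hb hab h1

/-- The equivalence relation in which the blocks of the points `x` and `y` are joined. -/
def joinBlocks (R : Setoid X) (x y : X) : Setoid X where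
  r a b := R a b ∨ (R a x ∧ R y b) ∨ (R a y ∧ R x b)
  iseqv := by
    refine ⟨fun a => Or.inl (R.refl a), ?_, ?_⟩
    · rintro a b (h | ⟨h, h'⟩ | ⟨h, h'⟩)
      · exact Or.inl (R.symm h)
      · exact Or.inr (Or.inr ⟨R.symm h', R.symm h⟩)
      · exact Or.inr (Or.inl ⟨R.symm h', R.symm h⟩)
    · rintro a b c (h | ⟨h, h'⟩ | ⟨h, h'⟩) (g | ⟨g, g'⟩ | ⟨g, g'⟩)
      · exact Or.inl (R.trans h g)
      · exact Or.inr (Or.inl ⟨R.trans h g, g'⟩)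
      · exact Or.inr (Or.inr ⟨R.trans h g, g'⟩)
      · exact Or.inr (Or.inl ⟨h, R.trans h' g⟩)
      · exact Or.inr (Or.inl ⟨h, g'⟩)
      · exact Or.inl (R.trans h g')
      · exact Or.inr (Or.inr ⟨h, R.trans h' g⟩)
      · exact Or.inl (R.trans h g')
      · exact Or.inr (Or.inr ⟨h, g'⟩)

theorem joinBlocks_iff (R : Setoid X) (x y a b : X) :
    joinBlocks R x y a b ↔ R a b ∨ (R a x ∧ R y b) ∨ (R a y ∧ R x b) := Iff.rfl

open Classical in
/-- Two neighboring points of different colors are removed, and their blocks are joined. The levels of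
the two points agree, and the levels of the other points do not change. -/
theorem WellLevelled.contraction (hdr : (d : ℤ) ∣ 2 * r)
    {S : Finset X} {pos : X → ℕ} {col : X → Color} {R : Setoid X}
    (h : WellLevelled d r bi S pos col R) {x y : X} (hx : x ∈ S) (hy : y ∈ S) (hxy : pos x < pos y)
    (hadj : ∀ z ∈ S, z ≠ x → z ≠ y → pos z < pos x ∨ pos y < pos z) (hcol : col y = (col x).inv) :
    WellLevelled d r bi ((S.erase x).erase y) pos col (joinBlocks R x y) := by
  have hne : y ≠ x := by rintro rfl; omega
  have hyx : y ∈ S.erase x := Finset.mem_erase.2 ⟨hne, hy⟩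
  have hsum : ∀ f : X → ℤ, ∑ w ∈ S, f w = f x + f y + ∑ w ∈ (S.erase x).erase y, f w := by
    intro f
    rw [← Finset.add_sum_erase S f hx, ← Finset.add_sum_erase _ f hyx, add_assoc]
  have hmem : ∀ z, z ∈ (S.erase x).erase y ↔ z ≠ x ∧ z ≠ y ∧ z ∈ S := by
    intro z; simp only [Finset.mem_erase]; tauto
  have hs : (col y).sign = -(col x).sign := by rw [hcol, Color.sign_inv]
  have hl : ∀ a ∈ (S.erase x).erase y,
      level ((S.erase x).erase y) pos col a = level S pos col a := by
    intro a ha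
    obtain ⟨h1, h2, h3⟩ := (hmem a).1 ha
    unfold level height
    rw [hsum fun w => if pos w < pos a then (col w).sign else 0]
    rcases hadj a h3 h1 h2 with h4 | h4
    · rw [if_neg h4.asymm, if_neg (by omega)]; ring
    · rw [if_pos (by omega), if_pos h4, hs]; ring
  have hlxy : level S pos col x = level S pos col y := by
    unfold level height
    rw [hsum fun w => if pos w < pos y then (col w).sign else 0,
      hsum fun w => if pos w < pos x then (col w).sign else 0]
    have : (∑ w ∈ (S.erase x).erase y, if pos w < pos y then (col w).sign else 0) =
        ∑ w ∈ (S.erase x).erase y, if pos w < pos x then (col w).sign else 0 := by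
      refine Finset.sum_congr rfl fun w hw => ?_
      obtain ⟨h1, h2, h3⟩ := (hmem w).1 hw
      rcases hadj w h3 h1 h2 with h4 | h4
      · rw [if_pos h4, if_pos (by omega)]
      · rw [if_neg h4.asymm, if_neg (by omega)]
    rw [this, if_neg (lt_irrefl _), if_neg (lt_irrefl _), if_pos hxy, if_neg hxy.asymm, hcol]
    cases col x <;> simp [Color.sign, Color.whiteness, Color.inv] <;> ring
  -- the two ways of passing through the removed points
  have hlev : ∀ a ∈ S, ∀ b ∈ S, ∀ u ∈ S, ∀ v ∈ S, a ≠ u → b ≠ v → R a u → R v b →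
      col v = (col u).inv → level S pos col u = level S pos col v →
      LevelCondition d r (col a) (col b) (level S pos col a - level S pos col b) := by
    intro a ha b hb u hu v hv hau hbv h1 h2 h3 h4
    have e1 := h.levels a ha u hu hau h1
    have e2 := h.levels b hb v hv hbv (R.symm h2)
    unfold LevelCondition at *
    rw [h3] at e2
    obtain ⟨s, hs⟩ := e1
    obtain ⟨t, ht⟩ := e2
    obtain ⟨w, hw⟩ := hdr
    generalize level S pos col a = la at *
    generalize level S pos col b = lb at *
    generalize level S pos col u = lu at *
    generalize level S pos col v = lv at *
    revert hs ht
    cases col a <;> cases col b <;> cases col u <;> simp only [Color.same, Color.inv]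
    all_goals intro hs ht
    all_goals first
      | exact ⟨s - t, by linear_combination hs - ht + h4⟩
      | exact ⟨s - t - w, by linear_combination hs - ht + h4 - hw⟩
  have hbic : bi → ∀ a ∈ S, ∀ b ∈ S, ∀ u ∈ S, ∀ v ∈ S, a ≠ u → b ≠ v → R a u → R v b →
      col v = (col u).inv → col a ≠ col b := by
    intro hbi a ha b hb u hu v hv hau hbv h1 h2 h3
    have e1 := h.bicolored hbi a ha u hu hau h1
    have e2 := h.bicolored hbi b hb v hv hbv (R.symm h2)
    rw [h3] at e2
    revert e1 e2
    cases col a <;> cases col b <;> cases col u <;> simp [Color.inv]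
  have hcol' : col x = (col y).inv := by rw [hcol, Color.inv_inv]
  refine ⟨?_, ?_, ?_, ?_⟩
  · intro a ha b hb c hc e he h1 h2 h3 h4 h5
    obtain ⟨ax, ay, ha⟩ := (hmem a).1 ha
    obtain ⟨bx, bY, hb⟩ := (hmem b).1 hb
    obtain ⟨cx, cy, hc⟩ := (hmem c).1 hc
    obtain ⟨ex, ey, he⟩ := (hmem e).1 he
    have ba := hadj a ha ax ay
    have bb := hadj b hb bx bY
    have bc := hadj c hc cx cy
    have be := hadj e he ex ey
    have nc := h.noncrossing
    simp only [joinBlocks_iff] at *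
    -- here `u`, `v` are the removed points in some order, and one of the two blocks passes through them
    have key : ∀ u ∈ S, ∀ v ∈ S, (pos u < pos b ∧ pos v < pos b ∨ pos b < pos u ∧ pos b < pos v) →
      (pos u < pos a ∧ pos v < pos a ∨ pos a < pos u ∧ pos a < pos v) →
      (pos u < pos c ∧ pos v < pos c ∨ pos c < pos u ∧ pos c < pos v) →
      (pos u < pos e ∧ pos v < pos e ∨ pos e < pos u ∧ pos e < pos v) →
      (R a c → R b u → R v e → R a b ∨ R a u ∨ R a v) ∧
      (R a u → R v c → R b e → R a b ∨ R b u ∨ R b v) := by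
      intro u hu v hv b1 b2 b3 b4
      refine ⟨fun g1 g2 g3 => ?_, fun g1 g2 g3 => ?_⟩
      · -- the segment from `b` to `u` crosses that from `a` to `c`, or that from `v` to `e` does
        by_cases q1 : pos u < pos a
        · have := nc u hu a ha b hb c hc q1 h1 h2 (R.symm g2) g1
          exact Or.inr (Or.inl (R.symm this))
        · by_cases q2 : pos c < pos u
          · exact Or.inl (nc a ha b hb c hc u hu h1 h2 q2 g1 g2)
          · have := nc a ha v hv c hc e he (by omega) (by omega) h3 g1 g3
            exact Or.inr (Or.inr this)
      · by_cases q1 : pos b < pos v ∧ pos v < pos e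
        · by_cases q2 : pos u < pos e
          · exact Or.inl (nc a ha b hb u hu e he h1 (by omega) q2 g1 g3)
          · omega
        · by_cases q2 : pos v < pos b
          · have := nc v hv b hb c hc e he q2 h2 h3 g2 g3
            exact Or.inr (Or.inr (R.symm this))
          · have := nc b hb c hc e he v hv h2 h3 (by omega) g3 (R.symm g2)
            exact Or.inr (Or.inr (R.trans this (R.symm g2)))
    have k1 := key x hx y hy (by omega) (by omega) (by omega) (by omega)
    have k2 := key y hy x hx (by omega) (by omega) (by omega) (by omega)
    have sy : ∀ {u v}, R u v → R v u := fun h => R.symm h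
    have tr : ∀ {u v w}, R u v → R v w → R u w := fun h h' => R.trans h h'
    rcases h4 with h4 | ⟨h4, h4'⟩ | ⟨h4, h4'⟩ <;> rcases h5 with h5 | ⟨h5, h5'⟩ | ⟨h5, h5'⟩
    · exact Or.inl (nc a ha b hb c hc e he h1 h2 h3 h4 h5)
    · rcases k1.1 h4 h5 h5' with g | g | g
      · exact Or.inl g
      · exact Or.inl (tr g (sy h5))
      · exact Or.inr (Or.inr ⟨g, sy h5⟩)
    · rcases k2.1 h4 h5 h5' with g | g | g
      · exact Or.inl g
      · exact Or.inl (tr g (sy h5))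
      · exact Or.inr (Or.inl ⟨g, sy h5⟩)
    · rcases k1.2 h4 h4' h5 with g | g | g
      · exact Or.inl g
      · exact Or.inl (tr h4 (sy g))
      · exact Or.inr (Or.inl ⟨h4, sy g⟩)
    · exact Or.inl (tr h4 (sy h5))
    · exact Or.inr (Or.inl ⟨h4, sy h5⟩)
    · rcases k2.2 h4 h4' h5 with g | g | g
      · exact Or.inl g
      · exact Or.inl (tr h4 (sy g))
      · exact Or.inr (Or.inr ⟨h4, sy g⟩)
    · exact Or.inr (Or.inr ⟨h4, sy h5⟩)
    · exact Or.inl (tr h4 (sy h5))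
  · intro a ha b hb c hc h1 h2
    obtain ⟨ax, ay, ha⟩ := (hmem a).1 ha
    obtain ⟨bx, bY, hb⟩ := (hmem b).1 hb
    obtain ⟨cx, cy, hc⟩ := (hmem c).1 hc
    have sz := h.size
    have sy : ∀ {u v}, R u v → R v u := fun h => R.symm h
    rcases h1 with h1 | ⟨h1, h1'⟩ | ⟨h1, h1'⟩ <;> rcases h2 with h2 | ⟨h2, h2'⟩ | ⟨h2, h2'⟩
    · exact sz a ha b hb c hc h1 h2
    · have := sz a ha b hb x hx h1 h2; tauto
    · have := sz a ha b hb y hy h1 h2; tauto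
    · have := sz a ha c hc x hx h2 h1; tauto
    · have := sz y hy b hb c hc h1' h2'; tauto
    · have := sz a ha x hx y hy h1 h2; tauto
    · have := sz a ha c hc y hy h2 h1; tauto
    · have := sz a ha y hy x hx h1 h2; tauto
    · have := sz x hx b hb c hc h1' h2'; tauto
  · intro a ha b hb hab h1
    rw [hl a ha, hl b hb]
    obtain ⟨ax, ay, ha⟩ := (hmem a).1 ha
    obtain ⟨bx, bY, hb⟩ := (hmem b).1 hb
    rcases h1 with h1 | ⟨h1, h1'⟩ | ⟨h1, h1'⟩
    · exact h.levels a ha b hb hab h1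
    · exact hlev a ha b hb x hx y hy ax bY h1 h1' hcol hlxy
    · exact hlev a ha b hb y hy x hx ay bx h1 h1' hcol' hlxy.symm
  · intro hbi a ha b hb hab h1
    obtain ⟨ax, ay, ha⟩ := (hmem a).1 ha
    obtain ⟨bx, bY, hb⟩ := (hmem b).1 hb
    rcases h1 with h1 | ⟨h1, h1'⟩ | ⟨h1, h1'⟩
    · exact h.bicolored hbi a ha b hb hab h1
    · exact hbic hbi a ha b hb x hx y hy ax bY h1 h1' hcol
    · exact hbic hbi a ha b hb y hy x hx ay bx h1 h1' hcol'

/-- Reflection: the order is reversed, and the colors are inverted. All levels decrease by the sum of the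
signs of all points. -/
theorem WellLevelled.reversal {S : Finset X} {pos : X → ℕ} {col : X → Color} {R : Setoid X}
    (h : WellLevelled d r bi S pos col R) {pos' : X → ℕ} {col' : X → Color}
    (hinj : ∀ a ∈ S, ∀ b ∈ S, pos a = pos b → a = b)
    (hpos : ∀ a ∈ S, ∀ b ∈ S, pos' a < pos' b ↔ pos b < pos a) (hcol : ∀ a, col' a = (col a).inv) :
    WellLevelled d r bi S pos' col' R := by
  classical
  have hl : ∀ a ∈ S, level S pos' col' a = level S pos col a - ∑ w ∈ S, (col w).sign := by
    intro a ha
    unfold level height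
    rw [← Finset.add_sum_erase S _ ha, ← Finset.add_sum_erase S (fun w => (col w).sign) ha,
      ← Finset.add_sum_erase S (fun w => if pos w < pos a then (col w).sign else 0) ha]
    have : (∑ w ∈ S.erase a, if pos' w < pos' a then (col' w).sign else 0) =
        (∑ w ∈ S.erase a, if pos w < pos a then (col w).sign else 0) -
          ∑ w ∈ S.erase a, (col w).sign := by
      rw [← Finset.sum_sub_distrib]
      refine Finset.sum_congr rfl fun w hw => ?_
      obtain ⟨h1, h2⟩ := Finset.mem_erase.1 hw
      have h3 : pos w ≠ pos a := fun e => h1 (hinj w h2 a ha e)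
      simp only [hpos w h2 a ha, hcol, Color.sign_inv]
      rcases lt_or_gt_of_ne h3 with h4 | h4
      · rw [if_neg h4.asymm, if_pos h4]; ring
      · rw [if_pos h4, if_neg h4.asymm]; ring
    rw [this, if_neg (lt_irrefl _), if_neg (lt_irrefl _), hcol]
    cases col a <;> simp [Color.sign, Color.whiteness, Color.inv] <;> ring
  refine ⟨?_, h.size, ?_, ?_⟩
  · intro a ha b hb c hc e he h1 h2 h3 h4 h5
    rw [hpos _ ‹_› _ ‹_›] at h1 h2 h3
    have := h.noncrossing e he c hc b hb a ha h3 h2 h1 (R.symm h5) (R.symm h4)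
    exact R.trans h4 (R.trans (R.symm this) (R.symm h5))
  · intro a ha b hb hab h1
    have := h.levels a ha b hb hab h1
    rw [hl a ha, hl b hb, hcol, hcol]
    unfold LevelCondition at *
    have e : Color.same (col a).inv (col b).inv = Color.same (col a) (col b) := by
      cases col a <;> cases col b <;> rfl
    rw [e, sub_sub_sub_cancel_right]
    exact this
  · intro hbi a ha b hb hab h1
    have := h.bicolored hbi a ha b hb hab h1
    rw [hcol, hcol]
    intro e
    exact this (by rw [← Color.inv_inv (col a), e, Color.inv_inv])

/-- The first point is moved to the end of the line. All levels change by the same number modulo the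
sum of the signs of all points. -/
theorem WellLevelled.first_to_last {S : Finset X} {pos : X → ℕ} {col : X → Color} {R : Setoid X}
    (h : WellLevelled d r bi S pos col R) {pos' : X → ℕ} {z : X} (hz : z ∈ S)
    (hfirst : ∀ a ∈ S, a ≠ z → pos z < pos a) (hlast : ∀ a ∈ S, a ≠ z → pos' a < pos' z)
    (hpos : ∀ a ∈ S, ∀ b ∈ S, a ≠ z → b ≠ z → (pos' a < pos' b ↔ pos a < pos b))
    (hsum : (d : ℤ) ∣ ∑ a ∈ S, (col a).sign) :
    WellLevelled d r bi S pos' col R := by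
  classical
  obtain ⟨t, ht⟩ := hsum
  have hl : ∀ a ∈ S, ∃ s : ℤ, level S pos' col a = level S pos col a - (col z).sign + d * s := by
    intro a ha
    unfold level height
    rw [← Finset.add_sum_erase S _ hz] at ht
    rw [← Finset.add_sum_erase S _ hz,
      ← Finset.add_sum_erase S (fun w => if pos w < pos a then (col w).sign else 0) hz]
    by_cases haz : a = z
    · subst haz
      refine ⟨t, ?_⟩
      rw [Finset.sum_congr rfl fun w hw => if_pos (hlast w (Finset.mem_erase.1 hw).2
          (Finset.mem_erase.1 hw).1), if_neg (lt_irrefl _), if_neg (lt_irrefl _),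
        Finset.sum_congr rfl fun w hw => if_neg (hfirst w (Finset.mem_erase.1 hw).2
          (Finset.mem_erase.1 hw).1).asymm]
      rw [Finset.sum_const_zero]
      linear_combination ht
    · refine ⟨0, ?_⟩
      rw [if_neg (hlast a ha haz).asymm, if_pos (hfirst a ha haz),
        Finset.sum_congr (g := fun w => if pos w < pos a then (col w).sign else 0) rfl
          fun w hw => by
            simp only [hpos w (Finset.mem_erase.1 hw).2 a ha (Finset.mem_erase.1 hw).1 haz]]
      ring
  refine ⟨?_, h.size, ?_, h.bicolored⟩
  · intro a ha b hb c hc e he h1 h2 h3 h4 h5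
    have nz : ∀ u ∈ S, ∀ v ∈ S, pos' u < pos' v → u ≠ z := by
      rintro u hu v hv h6 rfl
      by_cases h7 : v = u
      · subst h7; omega
      · have := hlast v hv h7; omega
    have az := nz a ha b hb h1
    have bz := nz b hb c hc h2
    have cz := nz c hc e he h3
    rw [hpos a ha b hb az bz] at h1
    rw [hpos b hb c hc bz cz] at h2
    by_cases ez : e = z
    · subst ez
      have := h.noncrossing e he a ha b hb c hc (hfirst a ha az) h1 h2 (R.symm h5) h4
      exact R.trans (R.symm this) (R.symm h5)
    · rw [hpos c hc e he cz ez] at h3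
      exact h.noncrossing a ha b hb c hc e he h1 h2 h3 h4 h5
  · intro a ha b hb hab h1
    obtain ⟨s, hs⟩ := hl a ha
    obtain ⟨u, hu⟩ := hl b hb
    obtain ⟨v, hv⟩ := h.levels a ha b hb hab h1
    rw [hs, hu]
    exact ⟨v + s - u, by linear_combination hv⟩

/-- The last point is moved to the front of the line. This is `WellLevelled.first_to_last` for the
reflected points. -/
theorem WellLevelled.last_to_first {S : Finset X} {pos : X → ℕ} {col : X → Color} {R : Setoid X}
    (h : WellLevelled d r bi S pos col R) {pos' : X → ℕ} {z : X} (hz : z ∈ S)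
    (hinj : ∀ a ∈ S, ∀ b ∈ S, pos a = pos b → a = b)
    (hfirst : ∀ a ∈ S, a ≠ z → pos' z < pos' a) (hlast : ∀ a ∈ S, a ≠ z → pos a < pos z)
    (hpos : ∀ a ∈ S, ∀ b ∈ S, a ≠ z → b ≠ z → (pos' a < pos' b ↔ pos a < pos b))
    (hsum : (d : ℤ) ∣ ∑ a ∈ S, (col a).sign) :
    WellLevelled d r bi S pos' col R := by
  -- positions are reversed by subtracting them from their sum
  have le : ∀ (f : X → ℕ), ∀ a ∈ S, f a ≤ ∑ b ∈ S, f b := fun f a ha =>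
    Finset.single_le_sum (fun _ _ => Nat.zero_le _) ha
  have rev : ∀ (f : X → ℕ), ∀ a ∈ S, ∀ b ∈ S,
      ((∑ c ∈ S, f c) - f a < (∑ c ∈ S, f c) - f b ↔ f b < f a) := by
    intro f a ha b hb
    have := le f a ha
    have := le f b hb
    omega
  have hinj' : ∀ a ∈ S, ∀ b ∈ S, pos' a = pos' b → a = b := by
    intro a ha b hb hab
    by_contra hne
    by_cases h1 : a = z
    · subst h1; have := hfirst b hb (Ne.symm hne); omega
    by_cases h2 : b = z
    · subst h2; have := hfirst a ha hne; omega
    have h3 := hpos a ha b hb h1 h2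
    have h4 := hpos b hb a ha h2 h1
    exact hne (hinj a ha b hb (by omega))
  have h1 := h.reversal (pos' := fun a => (∑ c ∈ S, pos c) - pos a) (col' := fun a => (col a).inv)
    hinj (rev pos) (fun _ => rfl)
  have h2 := h1.first_to_last (pos' := fun a => (∑ c ∈ S, pos' c) - pos' a) hz
    (fun a ha hne => (rev pos z hz a ha).2 (hlast a ha hne))
    (fun a ha hne => (rev pos' a ha z hz).2 (hfirst a ha hne))
    (fun a ha b hb h3 h4 => by rw [rev pos' a ha b hb, rev pos a ha b hb, hpos b hb a ha h4 h3])
    (by simp only [Color.sign_inv, Finset.sum_neg_distrib]; exact (dvd_neg).2 hsum)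
  refine h2.reversal ?_ ?_ (fun a => (Color.inv_inv _).symm)
  · intro a ha b hb hab
    have := le pos' a ha
    have := le pos' b hb
    exact hinj' a ha b hb (by omega)
  · intro a ha b hb
    rw [rev pos' b hb a ha]

end TwoColored

namespace TwoColored

namespace ColoredPartition

/-! ### Well levelled partitions form a category -/

/-- The colors of the points after all upper points have been rotated to the lower row. -/
def boundaryColor {k l : ℕ} (p : ColoredPartition k l) : Fin k ⊕ Fin l → Color :=
  Sum.elim (fun i => (p.up i).inv) p.lo

/-- The boundary of the partition, read along one line, is well levelled. -/
def IsLevelled (d r : ℕ) (bi : Prop) {k l : ℕ} (p : ColoredPartition k l) : Prop :=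
  WellLevelled d r bi Finset.univ place p.boundaryColor p.rel

theorem place_inl {k l : ℕ} (i : Fin k) : place (Sum.inl i : Fin k ⊕ Fin l) = k - 1 - (i : ℕ) := rfl

theorem place_inr {k l : ℕ} (j : Fin l) : place (Sum.inr j : Fin k ⊕ Fin l) = k + (j : ℕ) := rfl

theorem place_injective {k l : ℕ} : Function.Injective (place : Fin k ⊕ Fin l → ℕ) := by
  rintro (⟨i, hi⟩ | ⟨i, hi⟩) (⟨j, hj⟩ | ⟨j, hj⟩) h <;> simp [place] at h ⊢ <;> omega

theorem place_lt {k l : ℕ} (a : Fin k ⊕ Fin l) : place a < k + l := by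
  rcases a with ⟨i, hi⟩ | ⟨i, hi⟩ <;> simp [place] <;> omega

theorem sum_boundaryColor {k l : ℕ} (p : ColoredPartition k l) :
    ∑ a, (p.boundaryColor a).sign = p.c := by
  simp [boundaryColor, c, Color.sign_inv]; ring

variable {d r : ℕ} {bi : Prop} {k l m k' l' : ℕ}

theorem c_rotLeftDown (p : ColoredPartition (k + 1) l) : p.rotLeftDown.c = p.c := by
  simp [c, rotLeftDown, Fin.sum_univ_succ, Color.sign_inv]; ring

theorem c_rotLeftUp (p : ColoredPartition k (l + 1)) : p.rotLeftUp.c = p.c := by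
  simp [c, rotLeftUp, Fin.sum_univ_succ, Color.sign_inv]; ring

theorem c_rotRightDown (p : ColoredPartition (k + 1) l) : p.rotRightDown.c = p.c := by
  simp [c, rotRightDown, Fin.sum_univ_castSucc, Color.sign_inv]; ring

theorem c_rotRightUp (p : ColoredPartition k (l + 1)) : p.rotRightUp.c = p.c := by
  simp [c, rotRightUp, Fin.sum_univ_castSucc, Color.sign_inv]; ring

theorem IsLevelled.rotLeftDown {p : ColoredPartition (k + 1) l} (h : p.IsLevelled d r bi) :
    p.rotLeftDown.IsLevelled d r bi := by
  have hp : ∀ a : Fin k ⊕ Fin (l + 1), place (Sum.elim (fun i => Sum.inl i.succ)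
      (Fin.cases (Sum.inl 0) (fun j => Sum.inr j)) a : Fin (k + 1) ⊕ Fin l) = place a := by
    rintro (i | j)
    · simp only [Sum.elim_inl, place, Fin.val_succ]; omega
    · refine Fin.cases ?_ (fun j => ?_) j <;> simp [place]; omega
  refine h.transfer _ ?_ ?_ (fun a _ b _ => by rw [hp, hp]) ?_ (fun a _ b _ => Iff.rfl)
  · intro a b hab
    exact place_injective (by rw [← hp, ← hp, hab])
  · rintro (i | j)
    · refine Fin.cases ?_ (fun i => ?_) i
      · exact iff_of_true (Finset.mem_univ _) ⟨Sum.inr 0, Finset.mem_univ _, rfl⟩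
      · exact iff_of_true (Finset.mem_univ _) ⟨Sum.inl i, Finset.mem_univ _, rfl⟩
    · exact iff_of_true (Finset.mem_univ _) ⟨Sum.inr j.succ, Finset.mem_univ _, rfl⟩
  · rintro (i | j) -
    · rfl
    · refine Fin.cases ?_ (fun j => ?_) j <;> rfl

theorem IsLevelled.rotLeftUp {p : ColoredPartition k (l + 1)} (h : p.IsLevelled d r bi) :
    p.rotLeftUp.IsLevelled d r bi := by
  have hp : ∀ a : Fin (k + 1) ⊕ Fin l, place (Sum.elim (Fin.cases (Sum.inr 0) (fun i => Sum.inl i))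
      (fun j => Sum.inr j.succ) a : Fin k ⊕ Fin (l + 1)) = place a := by
    rintro (i | j)
    · refine Fin.cases ?_ (fun j => ?_) i <;> simp [place]; omega
    · simp only [Sum.elim_inr, place, Fin.val_succ]; omega
  refine h.transfer _ ?_ ?_ (fun a _ b _ => by rw [hp, hp]) ?_ (fun a _ b _ => Iff.rfl)
  · intro a b hab
    exact place_injective (by rw [← hp, ← hp, hab])
  · rintro (i | j)
    · exact iff_of_true (Finset.mem_univ _) ⟨Sum.inl i.succ, Finset.mem_univ _, rfl⟩
    · refine Fin.cases ?_ (fun i => ?_) j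
      · exact iff_of_true (Finset.mem_univ _) ⟨Sum.inl 0, Finset.mem_univ _, rfl⟩
      · exact iff_of_true (Finset.mem_univ _) ⟨Sum.inr i, Finset.mem_univ _, rfl⟩
  · rintro (i | j) -
    · refine Fin.cases ?_ (fun j => ?_) i
      · simp [boundaryColor, ColoredPartition.rotLeftUp, Color.inv_inv]
      · rfl
    · rfl

theorem IsLevelled.rotRightDown {p : ColoredPartition (k + 1) l} (h : p.IsLevelled d r bi)
    (hc : (d : ℤ) ∣ p.c) : p.rotRightDown.IsLevelled d r bi := by
  rw [← sum_boundaryColor] at hc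
  -- the rightmost upper point is the first point of the boundary; it is given a place after all others
  have h1 := WellLevelled.first_to_last h (z := Sum.inl (Fin.last k))
    (pos' := fun a => if a = Sum.inl (Fin.last k) then k + l + 1 else place a) (Finset.mem_univ _)
    (fun a _ ha => by
      have : place a ≠ place (Sum.inl (Fin.last k) : Fin (k + 1) ⊕ Fin l) :=
        fun e => ha (place_injective e)
      simp only [place_inl, Fin.val_last] at this ⊢; omega)
    (fun a _ ha => by have := place_lt a; simp only [if_neg ha, if_true]; omega)
    (fun a _ b _ ha hb => by simp only [if_neg ha, if_neg hb]) hc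
  have hp : ∀ a : Fin k ⊕ Fin (l + 1), (fun a : Fin (k + 1) ⊕ Fin l =>
      if a = Sum.inl (Fin.last k) then k + l + 1 else place a) (Sum.elim (fun i => Sum.inl i.castSucc)
      (Fin.lastCases (Sum.inl (Fin.last k)) (fun j => Sum.inr j)) a) = place a + 1 := by
    rintro (i | j)
    · have : i.castSucc ≠ Fin.last k := (Fin.castSucc_lt_last i).ne
      simp [place, this]; omega
    · refine Fin.lastCases ?_ (fun j => ?_) j <;> simp [place]; omega
  refine h1.transfer _ ?_ ?_ (fun a _ b _ =>
    (iff_of_eq (congrArg₂ (fun x y : ℕ => x < y) (hp a) (hp b))).trans (by simp)) ?_ (fun a _ b _ => Iff.rfl)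
  · intro a b hab
    have := hp a
    rw [hab, hp] at this
    exact place_injective (by omega)
  · rintro (i | j)
    · refine Fin.lastCases ?_ (fun i => ?_) i
      · exact iff_of_true (Finset.mem_univ _) ⟨Sum.inr (Fin.last _), Finset.mem_univ _, by simp⟩
      · exact iff_of_true (Finset.mem_univ _) ⟨Sum.inl i, Finset.mem_univ _, rfl⟩
    · exact iff_of_true (Finset.mem_univ _) ⟨Sum.inr j.castSucc, Finset.mem_univ _, by simp⟩
  · rintro (i | j) -
    · rfl
    · refine Fin.lastCases ?_ (fun j => ?_) j <;> simp [boundaryColor, ColoredPartition.rotRightDown]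

theorem IsLevelled.rotRightUp {p : ColoredPartition k (l + 1)} (h : p.IsLevelled d r bi)
    (hc : (d : ℤ) ∣ p.c) : p.rotRightUp.IsLevelled d r bi := by
  rw [← sum_boundaryColor] at hc
  -- the rightmost lower point is the last point of the boundary; it is given a place before all others
  have h1 := WellLevelled.last_to_first h (z := Sum.inr (Fin.last l))
    (pos' := fun a => if a = Sum.inr (Fin.last l) then 0 else place a + 1) (Finset.mem_univ _)
    (fun a _ b _ e => place_injective e)
    (fun a _ ha => by simp only [if_neg ha, if_true]; omega)
    (fun a _ ha => by
      have h2 : place a ≠ place (Sum.inr (Fin.last l) : Fin k ⊕ Fin (l + 1)) :=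
        fun e => ha (place_injective e)
      have := place_lt a
      simp only [place_inr, Fin.val_last] at h2 ⊢; omega)
    (fun a _ b _ ha hb => by simp only [if_neg ha, if_neg hb]; omega) hc
  have hp : ∀ a : Fin (k + 1) ⊕ Fin l, (fun a : Fin k ⊕ Fin (l + 1) =>
      if a = Sum.inr (Fin.last l) then 0 else place a + 1)
      (Sum.elim (Fin.lastCases (Sum.inr (Fin.last l)) (fun i => Sum.inl i))
      (fun j => Sum.inr j.castSucc) a) = place a := by
    rintro (i | j)
    · refine Fin.lastCases ?_ (fun j => ?_) i <;> simp [place]; omega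
    · have : j.castSucc ≠ Fin.last l := (Fin.castSucc_lt_last j).ne
      simp [place, this]; omega
  refine h1.transfer _ ?_ ?_ (fun a _ b _ =>
    iff_of_eq (congrArg₂ (fun x y : ℕ => x < y) (hp a) (hp b))) ?_ (fun a _ b _ => Iff.rfl)
  · intro a b hab
    have := hp a
    rw [hab, hp] at this
    exact place_injective this.symm
  · rintro (i | j)
    · exact iff_of_true (Finset.mem_univ _) ⟨Sum.inl i.castSucc, Finset.mem_univ _, by simp⟩
    · refine Fin.lastCases ?_ (fun i => ?_) j
      · exact iff_of_true (Finset.mem_univ _) ⟨Sum.inl (Fin.last _), Finset.mem_univ _, by simp⟩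
      · exact iff_of_true (Finset.mem_univ _) ⟨Sum.inr i, Finset.mem_univ _, rfl⟩
  · rintro (i | j) -
    · refine Fin.lastCases ?_ (fun j => ?_) i <;>
        simp [boundaryColor, ColoredPartition.rotRightUp, Color.inv_inv]
    · rfl

theorem IsLevelled.rotated {p : ColoredPartition k l} (h : p.IsLevelled d r bi) (hc : (d : ℤ) ∣ p.c)
    {q : ColoredPartition k' l'} (hq : Rotated p q) : q.IsLevelled d r bi ∧ q.c = p.c := by
  induction hq with
  | refl => exact ⟨h, rfl⟩
  | leftDown _ ih => exact ⟨ih.1.rotLeftDown, by rw [c_rotLeftDown, ih.2]⟩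
  | leftUp _ ih => exact ⟨ih.1.rotLeftUp, by rw [c_rotLeftUp, ih.2]⟩
  | rightDown _ ih => exact ⟨ih.1.rotRightDown (by rwa [ih.2]), by rw [c_rotRightDown, ih.2]⟩
  | rightUp _ ih => exact ⟨ih.1.rotRightUp (by rwa [ih.2]), by rw [c_rotRightUp, ih.2]⟩

theorem c_involution (p : ColoredPartition k l) : p.involution.c = -p.c := by
  simp [c, involution]

theorem IsLevelled.involution {p : ColoredPartition k l} (h : p.IsLevelled d r bi) :
    p.involution.IsLevelled d r bi := by
  have h1 := WellLevelled.reversal h (pos' := fun a => k + l - 1 - place a)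
    (col' := fun a => (p.boundaryColor a).inv) (fun a _ b _ e => place_injective e)
    (fun a _ b _ => by have := place_lt a; have := place_lt b; omega) (fun _ => rfl)
  have hp : ∀ a : Fin l ⊕ Fin k, k + l - 1 - place (Sum.swap a) = place a := by
    rintro (⟨i, hi⟩ | ⟨i, hi⟩) <;> simp [place] <;> omega
  refine h1.transfer Sum.swap Sum.swap_leftInverse.injective ?_ (fun a _ b _ => by rw [hp, hp]) ?_
    (fun a _ b _ => Iff.rfl)
  · intro z
    exact iff_of_true (Finset.mem_univ _) ⟨z.swap, Finset.mem_univ _, Sum.swap_swap z⟩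
  · rintro (i | j) - <;>
      simp [boundaryColor, ColoredPartition.involution, Color.inv_inv]

theorem c_tensor (p : ColoredPartition k l) (q : ColoredPartition k' l') :
    (p.tensor q).c = p.c + q.c := by
  simp [c, tensor, Fin.sum_univ_add]; ring

theorem IsLevelled.tensor {p : ColoredPartition k l} {q : ColoredPartition k' l'}
    (hp : p.IsLevelled d r bi) (hq : q.IsLevelled d r bi) (hc : (d : ℤ) ∣ p.c) :
    (p.tensor q).IsLevelled d r bi := by
  rw [← sum_boundaryColor] at hc
  -- along the boundary, `p` lies between the upper and the lower points of `q`
  have h1 := WellLevelled.insertion hp hq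
    (Sum.elim (fun a => k' + place a) (Sum.elim (fun i => place (Sum.inl i : Fin k' ⊕ Fin l'))
      (fun j => k + l + place (Sum.inr j : Fin k' ⊕ Fin l'))))
    (fun a _ b _ => by simp)
    (by
      rintro (⟨i, hi⟩ | ⟨i, hi⟩) - (⟨j, hj⟩ | ⟨j, hj⟩) - <;> simp [place] <;> omega)
    (by
      rintro (⟨i, hi⟩ | ⟨i, hi⟩) -
      · exact Or.inl fun a _ => by simp [place]; omega
      · exact Or.inr fun a _ => by
          have := place_lt a; simp only [place_inr, Sum.elim_inl, Sum.elim_inr]; omega) hc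
  have hpl : ∀ a : Fin (k + k') ⊕ Fin (l + l'), (Sum.elim (fun a : Fin k ⊕ Fin l => k' + place a)
      (Sum.elim (fun i => place (Sum.inl i : Fin k' ⊕ Fin l'))
      (fun j => k + l + place (Sum.inr j : Fin k' ⊕ Fin l')))) (tensorPoints k l k' l' a) = place a := by
    rintro (i | j)
    · refine Fin.addCases (fun i => ?_) (fun i => ?_) i <;> simp [place, tensorPoints] <;> omega
    · refine Fin.addCases (fun i => ?_) (fun i => ?_) j <;> simp [place, tensorPoints] <;> omega
  refine h1.transfer (tensorPoints k l k' l') ?_ ?_ (fun a _ b _ => by rw [hpl, hpl]) ?_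
    (fun a _ b _ => Iff.rfl)
  · intro a b hab
    exact place_injective (by rw [← hpl, ← hpl, hab])
  · rintro ((i | i) | (i | i))
    · exact iff_of_true (Finset.mem_univ _) ⟨Sum.inl (Fin.castAdd _ i), Finset.mem_univ _, by simp [tensorPoints]⟩
    · exact iff_of_true (Finset.mem_univ _) ⟨Sum.inr (Fin.castAdd _ i), Finset.mem_univ _, by simp [tensorPoints]⟩
    · exact iff_of_true (Finset.mem_univ _) ⟨Sum.inl (Fin.natAdd _ i), Finset.mem_univ _, by simp [tensorPoints]⟩
    · exact iff_of_true (Finset.mem_univ _) ⟨Sum.inr (Fin.natAdd _ i), Finset.mem_univ _, by simp [tensorPoints]⟩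
  · rintro (i | j) -
    · refine Fin.addCases (fun i => ?_) (fun i => ?_) i <;>
        simp [tensorPoints, boundaryColor, ColoredPartition.tensor]
    · refine Fin.addCases (fun i => ?_) (fun i => ?_) j <;>
        simp [tensorPoints, boundaryColor, ColoredPartition.tensor]

theorem c_comp {p : ColoredPartition l m} {q : ColoredPartition k l} (h : q.lo = p.up) :
    (p.comp q).c = p.c + q.c := by
  simp [c, comp, h]

/-- The points of the boundaries of `q` and `p`, when the middle points are glued. -/
def gluing (k l m : ℕ) : (Fin k ⊕ Fin l) ⊕ (Fin l ⊕ Fin m) → Fin k ⊕ Fin l ⊕ Fin m :=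
  Sum.elim (Sum.map id Sum.inl) Sum.inr

/-- The boundary of `p q` arises from the boundaries of `q` and `p`, put side by side, by successively
contracting the two copies of a middle point, from right to left. -/
theorem IsLevelled.comp (hdr : (d : ℤ) ∣ 2 * r) {p : ColoredPartition l m} {q : ColoredPartition k l}
    (hp : p.IsLevelled d r bi) (hq : q.IsLevelled d r bi) (hc : (d : ℤ) ∣ q.c) (h : q.lo = p.up) :
    (p.comp q).IsLevelled d r bi := by
  classical
  rw [← sum_boundaryColor] at hc
  have h1 := WellLevelled.insertion hq hp
    (Sum.elim place (fun b => k + l + place b))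
    (fun a _ b _ => Iff.rfl) (fun a _ b _ => by simp)
    (fun b _ => Or.inr fun a _ => by have := place_lt a; simp; omega) hc
  set P : (Fin k ⊕ Fin l) ⊕ (Fin l ⊕ Fin m) → ℕ := Sum.elim place (fun b => k + l + place b) with hP
  set col := Sum.elim q.boundaryColor p.boundaryColor
  let T : Setoid ((Fin k ⊕ Fin l) ⊕ (Fin l ⊕ Fin m)) :=
    Setoid.comap (gluing k l m) (Relation.EqvGen.setoid (CompStep p q))
  -- the points that remain when the middle points have been contracted from right to left down to `n`
  let alive : ℕ → (Fin k ⊕ Fin l) ⊕ (Fin l ⊕ Fin m) → Prop := fun n z =>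
    ∀ j : Fin l, z = .inl (.inr j) ∨ z = .inr (.inl j) → (j : ℕ) < n
  -- the relation reached then lies between the disjoint union and the gluing of `q` and `p`
  have key : ∀ t n : ℕ, n + t = l → ∃ R : Setoid _, (∀ a b, sumSetoid q.rel p.rel a b → R a b) ∧
      (∀ a b, R a b → T a b) ∧ (∀ j : Fin l, n ≤ (j : ℕ) → R (.inl (.inr j)) (.inr (.inl j))) ∧
      WellLevelled d r bi (Finset.univ.filter (alive n)) P col R := by
    intro t
    induction t with
    | zero =>
      intro n hn
      refine ⟨_, fun a b hab => hab, ?_, fun j hj => by omega, ?_⟩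
      · rintro _ _ (hab | hab)
        · exact Relation.EqvGen.rel _ _ (CompStep.above _ _ hab)
        · exact Relation.EqvGen.rel _ _ (CompStep.below _ _ hab)
      · convert h1 using 1
        ext z
        simp only [Finset.mem_filter, Finset.mem_univ, true_and, alive]
        refine ⟨fun _ => ?_, fun _ j _ => by omega⟩
        rcases z with z | z <;> simp
    | succ t ih =>
      intro n hn
      obtain ⟨R, hR1, hR2, hR3, hR4⟩ := ih (n + 1) (by omega)
      let j : Fin l := ⟨n, by omega⟩
      have h2 := hR4.contraction hdr (x := .inl (.inr j)) (y := .inr (.inl j))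
        (by
          simp only [Finset.mem_filter, Finset.mem_univ, true_and, alive]
          rintro i (hi | hi)
          · obtain rfl : j = i := by simpa using hi
            exact Nat.lt_succ_self n
          · simp at hi)
        (by
          simp only [Finset.mem_filter, Finset.mem_univ, true_and, alive]
          rintro i (hi | hi)
          · simp at hi
          · obtain rfl : j = i := by simpa using hi
            exact Nat.lt_succ_self n)
        (by simp [hP, place]; omega)
        (by
          intro z hz hz1 hz2
          simp only [Finset.mem_filter, Finset.mem_univ, true_and, alive] at hz
          rcases z with (⟨i, hi⟩ | ⟨i, hi⟩) | (⟨i, hi⟩ | ⟨i, hi⟩)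
          · left; simp [hP, place]; omega
          · have h3 := hz _ (Or.inl rfl)
            have h4 : i ≠ n := fun e => hz1 (by simp [j, e])
            left; simp [hP, place, j] at h3 ⊢; omega
          · have h3 := hz _ (Or.inr rfl)
            have h4 : i ≠ n := fun e => hz2 (by simp [j, e])
            right; simp [hP, place, j] at h3 ⊢; omega
          · right; simp [hP, place]; omega)
        (by simp [col, boundaryColor, h])
      refine ⟨joinBlocks R (.inl (.inr j)) (.inr (.inl j)),
        fun a b hab => Or.inl (hR1 _ _ hab), ?_, ?_, ?_⟩
      · rintro a b (hab | ⟨ha, hb⟩ | ⟨ha, hb⟩)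
        · exact hR2 _ _ hab
        · exact T.trans (hR2 _ _ ha) (T.trans (T.refl (.inr (.inl j))) (hR2 _ _ hb))
        · exact T.trans (hR2 _ _ ha) (T.trans (T.refl (.inl (.inr j))) (hR2 _ _ hb))
      · intro i hi
        by_cases hin : (i : ℕ) = n
        · obtain rfl : i = j := Fin.ext hin
          exact Or.inr (Or.inl ⟨R.refl _, R.refl _⟩)
        · exact Or.inl (hR3 i (by omega))
      · convert h2 using 1
        ext z
        simp only [Finset.mem_filter, Finset.mem_univ, true_and, alive, Finset.mem_erase]
        constructor
        · intro hz
          refine ⟨?_, ?_, fun i hi => by have := hz i hi; omega⟩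
          · rintro rfl; exact absurd (hz j (Or.inr rfl)) (lt_irrefl _)
          · rintro rfl; exact absurd (hz j (Or.inl rfl)) (lt_irrefl _)
        · rintro ⟨hz1, hz2, hz3⟩ i hi
          have h3 := hz3 i hi
          have h4 : (i : ℕ) ≠ n := by
            intro e
            obtain rfl : i = j := Fin.ext e
            tauto
          omega
  obtain ⟨R, hR1, hR2, hR3, hR4⟩ := key l 0 (by omega)
  -- the chosen copies of the glued points are all related as in the composition
  have hT : ∀ a b, Relation.EqvGen (CompStep p q) a b →
      R (Sum.elim (fun i => .inl (.inl i)) (Sum.elim (fun i => .inl (.inr i)) fun i => .inr (.inr i)) a)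
        (Sum.elim (fun i => .inl (.inl i)) (Sum.elim (fun i => .inl (.inr i)) fun i => .inr (.inr i)) b) := by
    intro a b hab
    induction hab with
    | rel a b hab =>
      rcases hab with ⟨a, b, hab⟩ | ⟨a, b, hab⟩
      · have := hR1 (.inl a) (.inl b) (Sum.LiftRel.inl hab)
        rcases a with a | a <;> rcases b with b | b <;> exact this
      · have := hR1 (.inr a) (.inr b) (Sum.LiftRel.inr hab)
        rcases a with a | a <;> rcases b with b | b
        · exact R.trans (hR3 a (Nat.zero_le _)) (R.trans this (R.symm (hR3 b (Nat.zero_le _))))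
        · exact R.trans (hR3 a (Nat.zero_le _)) this
        · exact R.trans this (R.symm (hR3 b (Nat.zero_le _)))
        · exact this
    | refl a => exact R.refl _
    | symm a b _ ih => exact R.symm ih
    | trans a b c _ _ ih1 ih2 => exact R.trans ih1 ih2
  refine hR4.transfer (Sum.map Sum.inl Sum.inr) ?_ ?_ ?_ ?_ ?_
  · exact Sum.map_injective.2 ⟨Sum.inl_injective, Sum.inr_injective⟩
  · intro z
    simp only [Finset.mem_filter, Finset.mem_univ, true_and, alive]
    constructor
    · intro hz
      rcases z with (i | i) | (i | i)
      · exact ⟨.inl i, rfl⟩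
      · exact absurd (hz i (Or.inl rfl)) (by omega)
      · exact absurd (hz i (Or.inr rfl)) (by omega)
      · exact ⟨.inr i, rfl⟩
    · rintro ⟨i | i, rfl⟩ j hj <;> simp at hj
  · rintro (⟨i, hi⟩ | ⟨i, hi⟩) - (⟨j, hj⟩ | ⟨j, hj⟩) - <;> simp [hP, place] <;> omega
  · rintro (i | i) - <;> rfl
  · rintro a - b -
    constructor
    · intro hab
      have := hR2 _ _ hab
      rcases a with a | a <;> rcases b with b | b <;> exact this
    · intro hab
      have := hT _ _ hab
      rcases a with a | a <;> rcases b with b | b <;> exact this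

end ColoredPartition

end TwoColored

namespace TwoColored

namespace ColoredPartition

variable {d r : ℕ} {bi : Prop} {k l m n k' l' : ℕ}

/-! ### The generators are well levelled -/

theorem isLevelled_of_discrete {p : ColoredPartition k l} (h : ∀ a b, p.rel a b → a = b) :
    p.IsLevelled d r bi := by
  refine ⟨?_, ?_, ?_, ?_⟩
  · intro a _ b _ c _ e _ h1 h2 h3 h4 h5
    rw [h a c h4] at h1; omega
  · intro a _ b _ c _ h1 h2
    exact Or.inl (h a b h1)
  · intro a _ b _ h1 h2
    exact absurd (h a b h2) h1
  · intro _ a _ b _ h1 h2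
    exact absurd (h a b h2) h1

theorem singletons_isLevelled (s : ℤ) : (singletons s).IsLevelled d r bi :=
  isLevelled_of_discrete fun _ _ h => h

theorem signColor_sign (s : ℤ) : (s.natAbs : ℤ) * (signColor s).sign = s := by
  unfold signColor
  split <;> simp only [Color.sign] <;> omega

theorem c_singletons (s : ℤ) : (singletons s).c = s := by
  have := signColor_sign s
  simpa [c, singletons] using this

theorem tensor_rel_lower (p : ColoredPartition 0 l) (q : ColoredPartition 0 l') (a b : Fin (l + l')) :
    (show ColoredPartition 0 (l + l') from p.tensor q).rel (.inr a) (.inr b) ↔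
      sumSetoid p.rel q.rel (tensorPoints 0 l 0 l' (.inr a)) (tensorPoints 0 l 0 l' (.inr b)) := Iff.rfl

theorem sumSetoid_inl_inl {α β : Type} {r : Setoid α} {s : Setoid β} {a b : α} :
    sumSetoid r s (.inl a) (.inl b) ↔ r a b := Sum.liftRel_inl_inl

theorem sumSetoid_inr_inr {α β : Type} {r : Setoid α} {s : Setoid β} {a b : β} :
    sumSetoid r s (.inr a) (.inr b) ↔ s a b := Sum.liftRel_inr_inr

theorem not_sumSetoid_inl_inr {α β : Type} {r : Setoid α} {s : Setoid β} {a : α} {b : β} :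
    ¬ sumSetoid r s (.inl a) (.inr b) := Sum.not_liftRel_inl_inr

theorem not_sumSetoid_inr_inl {α β : Type} {r : Setoid α} {s : Setoid β} {a : β} {b : α} :
    ¬ sumSetoid r s (.inr a) (.inl b) := Sum.not_liftRel_inr_inl

theorem singletons_rel {s : ℤ} (a b : Fin 0 ⊕ Fin s.natAbs) : (singletons s).rel a b ↔ a = b := Iff.rfl

theorem around_rel {n : ℕ} {p : ColoredPartition 0 n} {a b : Color} (x y : Fin 0 ⊕ Fin (n + 1 + 1)) :
    (around a p b).rel x y ↔ sumSetoid (⊤ : Setoid Unit) p.rel ((Sum.elim (fun i : Fin 0 => Sum.inl i.elim0)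
      (Fin.cases (motive := fun _ => Unit ⊕ (Fin 0 ⊕ Fin n)) (Sum.inl ())
        (Fin.lastCases (motive := fun _ => Unit ⊕ (Fin 0 ⊕ Fin n)) (Sum.inl ())
          (fun j => Sum.inr (Sum.inr j))))) x) ((Sum.elim (fun i : Fin 0 => Sum.inl i.elim0)
      (Fin.cases (motive := fun _ => Unit ⊕ (Fin 0 ⊕ Fin n)) (Sum.inl ())
        (Fin.lastCases (motive := fun _ => Unit ⊕ (Fin 0 ⊕ Fin n)) (Sum.inl ())
          (fun j => Sum.inr (Sum.inr j))))) y) := Iff.rfl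

/-- Singletons, followed by a pair with singletons between its legs. -/
abbrev singletonsAround (s : ℤ) (a : Color) (t : ℤ) (b : Color) :
    ColoredPartition 0 (s.natAbs + (t.natAbs + 1 + 1)) :=
  (singletons s).tensor (around a (singletons t) b)

theorem singletonsAround_rel_iff (s : ℤ) (a : Color) (t : ℤ) (b : Color)
    (i j : Fin (s.natAbs + (t.natAbs + 1 + 1))) :
    (singletonsAround s a t b).rel (.inr i) (.inr j) ↔ i = j ∨
      (i = Fin.natAdd _ 0 ∧ j = Fin.natAdd _ (Fin.last _)) ∨
      (j = Fin.natAdd _ 0 ∧ i = Fin.natAdd _ (Fin.last _)) := by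
  have key : ∀ x y : Fin (t.natAbs + 1 + 1), (around a (singletons t) b).rel (.inr x) (.inr y) ↔
      x = y ∨ (x = 0 ∧ y = Fin.last _) ∨ (y = 0 ∧ x = Fin.last _) := by
    intro x y
    refine Fin.cases ?_ (fun x => Fin.lastCases ?_ (fun x => ?_) x) x <;>
      refine Fin.cases ?_ (fun y => Fin.lastCases ?_ (fun y => ?_) y) y <;>
      simp only [around_rel, sumSetoid_inl_inl, sumSetoid_inr_inr, not_sumSetoid_inl_inr,
        not_sumSetoid_inr_inl, singletons_rel, Sum.elim_inr, Fin.cases_zero, Fin.cases_succ,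
        Fin.lastCases_last, Fin.lastCases_castSucc, Fin.ext_iff, Fin.val_succ, Fin.val_last,
        Fin.val_castSucc, Fin.val_zero, Setoid.top_def, Sum.inr.injEq, false_iff] <;>
      first
        | omega
        | exact iff_of_true trivial (by simp)
  refine Fin.addCases (fun i => ?_) (fun i => ?_) i <;>
    refine Fin.addCases (fun j => ?_) (fun j => ?_) j <;>
    simp only [tensor_rel_lower, tensorPoints, sumSetoid_inl_inl, sumSetoid_inr_inr, not_sumSetoid_inl_inr,
        not_sumSetoid_inr_inl, singletons_rel, Sum.elim_inr, Fin.addCases_left, Fin.addCases_right,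
        key, Fin.ext_iff, Fin.val_castAdd, Fin.val_natAdd, Fin.val_last, Fin.val_zero, Sum.inr.injEq,
        false_iff] <;>
    omega

theorem c_around {n : ℕ} (a : Color) (p : ColoredPartition 0 n) (b : Color) :
    (around a p b).c = a.sign + p.c + b.sign := by
  have : ∀ f : Fin (n + 1) → Color, ∑ j, (f j).sign = ∑ j : Fin n, (f j.castSucc).sign + (f (Fin.last n)).sign :=
    fun f => Fin.sum_univ_castSucc _
  simp [c, around, Fin.sum_univ_succ (n := n + 1), this]
  ring

theorem height_tensor_first (p : ColoredPartition 0 m) (q : ColoredPartition 0 (n + 1)) :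
    height Finset.univ place (p.tensor q).boundaryColor (.inr (Fin.natAdd m 0)) = p.c := by
  unfold height
  rw [Fintype.sum_sum_type, Fin.sum_univ_add (a := m) (b := n + 1)]
  simp [place, c, boundaryColor, tensor]

theorem height_last (p : ColoredPartition 0 (n + 1)) :
    height Finset.univ place p.boundaryColor (.inr (Fin.last n)) = p.c - (p.lo (Fin.last n)).sign := by
  unfold height
  rw [Fintype.sum_sum_type, Fin.sum_univ_castSucc]
  simp [place, c, boundaryColor, Fin.sum_univ_castSucc]

/-- The difference of the levels of the two legs of the last block. -/
theorem level_tensor_sub (p : ColoredPartition 0 m) (q : ColoredPartition 0 (n + 2)) :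
    level Finset.univ place (p.tensor q).boundaryColor (.inr (Fin.natAdd m (Fin.last (n + 1)))) -
      level Finset.univ place (p.tensor q).boundaryColor (.inr (Fin.natAdd m 0)) =
    q.c - (q.lo (Fin.last (n + 1))).sign + (q.lo (Fin.last (n + 1))).whiteness -
      (q.lo 0).whiteness := by
  unfold level
  have h1 : (p.tensor q).boundaryColor (.inr (Fin.natAdd m (Fin.last (n + 1)))) =
      q.lo (Fin.last (n + 1)) := Fin.append_right p.lo q.lo _
  have h2 : (p.tensor q).boundaryColor (.inr (Fin.natAdd m 0)) = q.lo 0 :=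
    Fin.append_right p.lo q.lo 0
  have h3 := height_last (n := m + (n + 1)) (p.tensor q)
  have h4 : (p.tensor q).lo (Fin.last (m + (n + 1))) = q.lo (Fin.last (n + 1)) := h1
  rw [h4, c_tensor] at h3
  have h5 : height Finset.univ place (p.tensor q).boundaryColor
    (.inr (Fin.natAdd m (Fin.last (n + 1)))) = p.c + q.c - (q.lo (Fin.last (n + 1))).sign := h3
  rw [h1, h2, h5, height_tensor_first]
  ring

/-- The two points of a block can be interchanged because of `2 r ≡ 0` modulo `d`. -/
theorem LevelCondition.symm (hdr : (d : ℤ) ∣ 2 * r) {a b : Color} {t : ℤ}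
    (h : LevelCondition d r a b t) : LevelCondition d r b a (-t) := by
  obtain ⟨u, hu⟩ := h
  obtain ⟨v, hv⟩ := hdr
  revert hu
  cases a <;> cases b <;> simp only [Color.same, LevelCondition] <;> intro hu
  · exact ⟨-u - v, by linear_combination -hu - hv⟩
  · exact ⟨-u, by linear_combination -hu⟩
  · exact ⟨-u, by linear_combination -hu⟩
  · exact ⟨-u - v, by linear_combination -hu - hv⟩

/-- The level condition concerns the two legs of the only pair. -/
theorem singletonsAround_isLevelled (hdr : (d : ℤ) ∣ 2 * r) {s : ℤ} {a : Color} {t : ℤ} {b : Color}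
    (h : LevelCondition d r b a (t + a.sign + b.whiteness - a.whiteness)) (hbi : bi → a ≠ b) :
    (singletonsAround s a t b).IsLevelled d r bi := by
  have hrel := singletonsAround_rel_iff s a t b
  have hlev := level_tensor_sub (singletons s) (around a (singletons t) b)
  rw [c_around, c_singletons] at hlev
  have hb : (around a (singletons t) b).lo (Fin.last (t.natAbs + 1)) = b := by
    simp [around, ← Fin.succ_last]
  have ha : (around a (singletons t) b).lo 0 = a := rfl
  have hb' : (singletonsAround s a t b).boundaryColor (.inr (Fin.natAdd _ (Fin.last _))) = b :=
    (Fin.append_right _ _ _).trans hb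
  have ha' : (singletonsAround s a t b).boundaryColor (.inr (Fin.natAdd _ 0)) = a :=
    (Fin.append_right _ _ _).trans ha
  rw [hb, ha] at hlev
  refine ⟨?_, ?_, ?_, ?_⟩
  · rintro (⟨i, hi⟩ | a) - (⟨i, hi⟩ | b) - (⟨i, hi⟩ | c) - (⟨i, hi⟩ | e) - h1 h2 h3 h4 h5 <;> try omega
    rw [hrel] at *
    simp only [place, Fin.ext_iff, Fin.val_natAdd, Fin.val_last, Fin.val_zero] at *
    omega
  · rintro (⟨i, hi⟩ | a) - (⟨i, hi⟩ | b) - (⟨i, hi⟩ | c) - h1 h2 <;> try omega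
    rw [hrel] at *
    simp only [Fin.ext_iff, Fin.val_natAdd, Fin.val_last, Fin.val_zero, Sum.inr.injEq] at *
    omega
  · rintro (⟨i, hi⟩ | x) - (⟨i, hi⟩ | y) - hne h1 <;> try omega
    rcases (hrel _ _).1 h1 with rfl | ⟨rfl, rfl⟩ | ⟨rfl, rfl⟩
    · exact absurd rfl hne
    · rw [hb', ha', ← neg_sub, hlev]
      convert LevelCondition.symm hdr h using 1; ring
    · rw [hb', ha', hlev]
      convert h using 1; ring
  · rintro hbi' (⟨i, hi⟩ | x) - (⟨i, hi⟩ | y) - hne h1 <;> try omega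
    rcases (hrel _ _).1 h1 with rfl | ⟨rfl, rfl⟩ | ⟨rfl, rfl⟩
    · exact absurd rfl hne
    · rw [hb', ha']; exact hbi hbi'
    · rw [hb', ha']; exact (hbi hbi').symm

theorem pair_isLevelled {a b : Color} (hab : a ≠ b) : (pair a b).IsLevelled d r bi := by
  refine ⟨?_, ?_, ?_, ?_⟩
  · intro a _ b _ c _ e _ h1 h2 h3
    have := place_lt e
    omega
  · rintro (⟨i, hi⟩ | a) - (⟨i, hi⟩ | b) - (⟨i, hi⟩ | c) - - - <;> try omega
    simp only [Fin.ext_iff, Sum.inr.injEq] at *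
    omega
  · rintro (⟨i, hi⟩ | x) - (⟨i, hi⟩ | y) - hne - <;> try omega
    fin_cases x <;> fin_cases y <;> revert hab <;> cases a <;> cases b <;>
      simp_all [level, height, boundaryColor, pair, LevelCondition, Color.same, place,
        Color.whiteness, Color.sign]
  · rintro - (⟨i, hi⟩ | x) - (⟨i, hi⟩ | y) - hne - <;> try omega
    fin_cases x <;> fin_cases y <;> simp_all [boundaryColor, pair, hab.symm]

theorem rotLeftUp_pair (a : Color) : (pair a.inv a).rotLeftUp = identity a := by
  ext i
  · obtain rfl : i = 0 := Fin.fin_one_eq_zero i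
    exact Color.inv_inv a
  · simp [rotLeftUp, pair, identity]
  · exact iff_of_true trivial trivial

end ColoredPartition

open ColoredPartition

/-- The partitions with well levelled boundary and total color sum divisible by `k`. -/
def levelled (k d r : ℕ) (bi : Prop) : Family := fun _ _ => {p | p.IsLevelled d r bi ∧ (k : ℤ) ∣ p.c}

theorem Admissible.dvd_two_mul {k d r : ℕ} (h : Admissible k d r) : (d : ℤ) ∣ 2 * r := by
  rcases h.2.1 with rfl | rfl <;> simp

theorem Admissible.dvd_of_dvd {k d r : ℕ} (h : Admissible k d r) {s : ℤ} (hs : (k : ℤ) ∣ s) :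
    (d : ℤ) ∣ s := by
  by_cases hk : k = 0
  · subst hk
    rw [Nat.cast_zero, zero_dvd_iff] at hs
    simp [hs]
  · exact (Int.natCast_dvd_natCast.2 (h.1 hk)).trans hs

theorem isCategory_levelled {k d r : ℕ} (h : Admissible k d r) (bi : Prop) :
    IsCategory (levelled k d r bi) where
  tensor hp hq := ⟨hp.1.tensor hq.1 (h.dvd_of_dvd hp.2), by rw [c_tensor]; exact dvd_add hp.2 hq.2⟩
  comp hp hq e := ⟨IsLevelled.comp h.dvd_two_mul hp.1 hq.1 (h.dvd_of_dvd hq.2) e, by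
    rw [c_comp e]; exact dvd_add hp.2 hq.2⟩
  involution hp := ⟨hp.1.involution, by rw [c_involution]; exact (dvd_neg).2 hp.2⟩
  pair_wb := ⟨pair_isLevelled (by simp), by simp [c, pair, Color.sign]⟩
  pair_bw := ⟨pair_isLevelled (by simp), by simp [c, pair, Color.sign]⟩
  identity_w := ⟨by
    rw [← rotLeftUp_pair]
    exact IsLevelled.rotLeftUp (k := 0) (l := 1) (pair_isLevelled (by simp [Color.inv])), by
      simp [c, identity]⟩
  identity_b := ⟨by
    rw [← rotLeftUp_pair]
    exact IsLevelled.rotLeftUp (k := 0) (l := 1) (pair_isLevelled (by simp [Color.inv])), by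
      simp [c, identity]⟩

theorem singletons_mem_levelled (k d r : ℕ) (bi : Prop) : singletons k ∈ levelled k d r bi 0 _ :=
  ⟨singletons_isLevelled _, by rw [c_singletons]⟩

theorem singletonWB_discrete (a b : Fin 0 ⊕ Fin ((1 : ℤ).natAbs + (-1 : ℤ).natAbs)) :
    singletonWB.rel a b → a = b := by
  rcases a with ⟨i, hi⟩ | i <;> rcases b with ⟨j, hj⟩ | j <;> try omega
  rw [singletonWB, tensor_rel_lower]
  refine Fin.addCases (fun i => ?_) (fun i => ?_) i <;>
    refine Fin.addCases (fun j => ?_) (fun j => ?_) j <;>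
    simp only [tensorPoints, sumSetoid_inl_inl, sumSetoid_inr_inr, not_sumSetoid_inl_inr,
        not_sumSetoid_inr_inl, singletons_rel, Sum.elim_inr, Fin.addCases_left, Fin.addCases_right,
        Sum.inr.injEq, false_implies]
  · rintro rfl; rfl
  · rintro rfl; rfl

theorem singletonWB_mem_levelled {k d r : ℕ} (bi : Prop) :
    singletonWB ∈ levelled k d r bi 0 _ := by
  have h : singletonWB.c = 0 := by rw [singletonWB, c_tensor, c_singletons, c_singletons]; norm_num
  exact ⟨isLevelled_of_discrete singletonWB_discrete, by simp [h]⟩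

theorem positioner_mem_levelled {k d r : ℕ} (hdr : (d : ℤ) ∣ 2 * r) (bi : Prop) :
    positioner d ∈ levelled k d r bi 0 _ := by
  refine ⟨singletonsAround_isLevelled hdr ?_ (by simp), ?_⟩
  · simp [LevelCondition, Color.same, Color.sign, Color.whiteness]
  · rw [positioner, c_tensor, c_around, c_singletons, c_singletons]
    simp [Color.sign]

theorem blackPositioner_mem_levelled {k d r : ℕ} (hdr : (d : ℤ) ∣ 2 * r) :
    blackPositioner r ∈ levelled k d r False 0 _ := by
  refine ⟨singletonsAround_isLevelled hdr ?_ (by simp), ?_⟩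
  · obtain ⟨u, hu⟩ := hdr
    refine ⟨-u, ?_⟩
    simp only [Color.same, Color.sign, Color.whiteness]
    linear_combination -hu
  · rw [blackPositioner, c_tensor, c_around, c_singletons, c_singletons]
    simp only [Color.sign]
    ring_nf
    simp

/-- The generated category consists of well levelled partitions, because these form a category. -/
theorem generated_subset_levelled {k d r : ℕ} (h : Admissible k d r) (k' l' : ℕ) :
    generated (gensB' k d r) k' l' ⊆ levelled k d r False k' l' := by
  intro p hp
  refine hp _ (isCategory_levelled h False) ?_
  rintro x (rfl | rfl | rfl | rfl)
  · exact singletons_mem_levelled _ _ _ _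
  · exact positioner_mem_levelled h.dvd_two_mul _
  · exact blackPositioner_mem_levelled h.dvd_two_mul
  · exact singletonWB_mem_levelled _

theorem generated_subset_levelled_bicolored {k d r : ℕ} (h : Admissible k d r) (k' l' : ℕ) :
    generated (gensB k d) k' l' ⊆ levelled k d r True k' l' := by
  intro p hp
  refine hp _ (isCategory_levelled h True) ?_
  rintro x (rfl | rfl | rfl)
  · exact singletons_mem_levelled _ _ _ _
  · exact positioner_mem_levelled h.dvd_two_mul _
  · exact singletonWB_mem_levelled _

/-- If `p₁`, `p₂` have color sums `s`, `t`, and `p₂` starts in color `a` and ends in color `b`, then the level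
condition for the two ends of `p₂` is the nest condition for `s`. -/
theorem nestCondition_of_levelCondition {d r : ℕ} (hdr : (d : ℤ) ∣ 2 * r) {a b : Color} {s t : ℤ}
    (hst : (d : ℤ) ∣ s + t) (h : LevelCondition d r b a (t - b.sign + b.whiteness - a.whiteness)) :
    NestCondition d r a b s := by
  obtain ⟨u, hu⟩ := hdr
  obtain ⟨v, hv⟩ := hst
  obtain ⟨w, hw⟩ := h
  revert hw
  cases a <;> cases b <;> simp only [Color.same, Color.whiteness, Color.sign, NestCondition] <;>
    intro hw
  · exact ⟨w - v, by linear_combination hw - hv⟩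
  · exact ⟨v - w, by linear_combination hv - hw⟩
  · exact ⟨v - w, by linear_combination hv - hw⟩
  · exact ⟨v - w - u, by linear_combination hv - hw - hu⟩

/-- The levels of the legs of the last block of a rotated version yield the nest condition. -/
theorem levelled_subset_locB' {k d r : ℕ} (h : Admissible k d r) {bi : Prop} (k' l' : ℕ) :
    levelled k d r bi k' l' ⊆ locB' k d r k' l' := by
  rintro p ⟨hp, hc⟩
  refine ⟨?_, ?_, hc, ?_⟩
  · intro a b c e
    exact hp.noncrossing _ (Finset.mem_univ _) _ (Finset.mem_univ _) _ (Finset.mem_univ _) _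
      (Finset.mem_univ _)
  · rintro B ⟨y, rfl⟩
    by_cases hy : ∃ z, z ≠ y ∧ p.rel z y
    · obtain ⟨z, hz, hzy⟩ := hy
      right
      rw [Set.ncard_eq_two]
      refine ⟨y, z, hz.symm, ?_⟩
      ext x
      simp only [Set.mem_ofPred_eq, Set.mem_insert_iff, Set.mem_singleton_iff]
      constructor
      · intro hx
        have := hp.size y (Finset.mem_univ _) z (Finset.mem_univ _) x (Finset.mem_univ _)
          (p.rel.symm hzy) (p.rel.symm hx)
        tauto
      · rintro (rfl | rfl)
        · exact p.rel.refl _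
        · exact hzy
    · left
      rw [Set.ncard_eq_one]
      refine ⟨y, ?_⟩
      ext x
      simp only [Set.mem_ofPred_eq, Set.mem_singleton_iff]
      constructor
      · intro hx
        by_contra hne
        exact hy ⟨x, hne, hx⟩
      · rintro rfl; exact p.rel.refl _
  · intro m n p₁ p₂ hrot hends
    obtain ⟨h1, h2⟩ := hp.rotated (h.dvd_of_dvd hc) hrot
    rw [c_tensor] at h2
    have h3 := h1.levels (.inr (Fin.natAdd m (Fin.last (n + 1)))) (Finset.mem_univ _)
      (.inr (Fin.natAdd m 0)) (Finset.mem_univ _) (by simp [Fin.ext_iff])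
      (by
        rw [tensor_rel_lower]
        simp only [tensorPoints, Sum.elim_inr, Fin.addCases_right, sumSetoid_inr_inr]
        exact p₂.rel.symm hends)
    rw [level_tensor_sub] at h3
    refine nestCondition_of_levelCondition h.dvd_two_mul (t := p₂.c) ?_ ?_
    · rw [h2]; exact h.dvd_of_dvd hc
    · have hb : (p₁.tensor p₂).boundaryColor (.inr (Fin.natAdd m (Fin.last (n + 1)))) =
          p₂.lo (Fin.last (n + 1)) := Fin.append_right p₁.lo p₂.lo _
      have ha : (p₁.tensor p₂).boundaryColor (.inr (Fin.natAdd m 0)) = p₂.lo 0 :=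
        Fin.append_right p₁.lo p₂.lo 0
      rwa [hb, ha] at h3

theorem levelled_subset_locB {k d r : ℕ} (h : Admissible k d r) (k' l' : ℕ) :
    levelled k d r True k' l' ⊆ locB k d r k' l' := by
  intro p hp
  refine ⟨levelled_subset_locB' h _ _ hp, ?_⟩
  rintro n q hq B ⟨y, rfl⟩ - i j hi hj hij
  obtain ⟨h1, -⟩ := hp.1.rotated (h.dvd_of_dvd hp.2) hq
  exact h1.bicolored trivial (.inr i) (Finset.mem_univ _) (.inr j) (Finset.mem_univ _)
    (by simpa using hij) (q.rel.trans hi (q.rel.symm hj))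

/-! ### Partitions given by labelled words -/

/-- A row of colored points with labels; the label `none` is reserved for singletons. -/
abbrev Word := List (Color × Option ℕ)

/-- Two points are related if they are equal or carry the same label; the value `none` is no label. -/
def labelSetoid {X : Type} (f : X → Option ℕ) : Setoid X where
  r a b := a = b ∨ (f a = f b ∧ f a ≠ none)
  iseqv := by
    refine ⟨fun a => Or.inl rfl, ?_, ?_⟩
    · rintro a b (rfl | ⟨h, h'⟩)
      · exact Or.inl rfl
      · exact Or.inr ⟨h.symm, h ▸ h'⟩
    · rintro a b c (rfl | ⟨h, h'⟩) (rfl | ⟨g, g'⟩)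
      · exact Or.inl rfl
      · exact Or.inr ⟨g, g'⟩
      · exact Or.inr ⟨h, h'⟩
      · exact Or.inr ⟨h.trans g, h'⟩

theorem labelSetoid_iff {X : Type} (f : X → Option ℕ) (a b : X) :
    labelSetoid f a b ↔ a = b ∨ (f a = f b ∧ f a ≠ none) := Iff.rfl

/-- The labels of the points of two rows. -/
def rowLabels (U D : Word) : Fin U.length ⊕ Fin D.length → Option ℕ :=
  Sum.elim (fun i => (U.get i).2) (fun j => (D.get j).2)

/-- The partition with the upper row `U` and the lower row `D`: points with the same label form a block,
and points without a label are singletons. -/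
def wordPartition (U D : Word) : ColoredPartition U.length D.length where
  up i := (U.get i).1
  lo j := (D.get j).1
  rel := labelSetoid (rowLabels U D)

/-- The label `z` occurs in the word `w`. -/
def Occurs (z : ℕ) (w : Word) : Prop := some z ∈ w.map Prod.snd

@[simp] theorem occurs_nil (z : ℕ) : ¬ Occurs z [] := by simp [Occurs]

@[simp] theorem occurs_cons (z : ℕ) (x : Color × Option ℕ) (w : Word) :
    Occurs z (x :: w) ↔ x.2 = some z ∨ Occurs z w := by
  simp only [Occurs, List.map_cons, List.mem_cons, eq_comm]

@[simp] theorem occurs_append (z : ℕ) (v w : Word) : Occurs z (v ++ w) ↔ Occurs z v ∨ Occurs z w := by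
  simp only [Occurs, List.map_append, List.mem_append]

theorem occurs_of_get {z : ℕ} {w : Word} (i : Fin w.length) (h : (w.get i).2 = some z) :
    Occurs z w := by
  unfold Occurs
  rw [← h]
  exact List.mem_map_of_mem (List.get_mem w i)

theorem exists_not_occurs (w : Word) : ∃ z, ¬ Occurs z w := by
  obtain ⟨z, hz⟩ := Infinite.exists_notMem_finset (w.map Prod.snd).reduceOption.toFinset
  refine ⟨z, fun h => hz ?_⟩
  rw [List.mem_toFinset, List.reduceOption_mem_iff]
  exact h

/-- Membership in a family does not change when the numbers of points are replaced by equal ones. -/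
theorem Family.mem_congr_iff (C : Family) {k l k' l' : ℕ} {p : ColoredPartition k l}
    {q : ColoredPartition k' l'} (hk : k = k') (hl : l = l')
    (hup : ∀ i, p.up i = q.up (Fin.cast hk i)) (hlo : ∀ i, p.lo i = q.lo (Fin.cast hl i))
    (hrel : ∀ a b, p.rel a b ↔ q.rel (Sum.map (Fin.cast hk) (Fin.cast hl) a)
      (Sum.map (Fin.cast hk) (Fin.cast hl) b)) : p ∈ C k l ↔ q ∈ C k' l' := by
  subst hk hl
  have : p = q := by
    refine ColoredPartition.ext (funext hup) (funext hlo) (Setoid.ext fun a b => ?_)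
    rw [hrel]
    rcases a with a | a <;> rcases b with b | b <;> rfl
  rw [this]

theorem Family.mem_congr (C : Family) {k l k' l' : ℕ} {p : ColoredPartition k l}
    {q : ColoredPartition k' l'} (hk : k = k') (hl : l = l')
    (hup : ∀ i, p.up i = q.up (Fin.cast hk i)) (hlo : ∀ i, p.lo i = q.lo (Fin.cast hl i))
    (hrel : ∀ a b, p.rel a b ↔ q.rel (Sum.map (Fin.cast hk) (Fin.cast hl) a)
      (Sum.map (Fin.cast hk) (Fin.cast hl) b)) (hp : p ∈ C k l) : q ∈ C k' l' :=
  (Family.mem_congr_iff C hk hl hup hlo hrel).1 hp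

/-- The partition given by two words belongs to the family. -/
def Family.Contains (C : Family) (U D : Word) : Prop := wordPartition U D ∈ C U.length D.length

theorem Family.mem_iff_contains (C : Family) {k l : ℕ} {p : ColoredPartition k l}
    {U D : Word} (hk : k = U.length) (hl : l = D.length)
    (hup : ∀ i, p.up i = (U.get (Fin.cast hk i)).1) (hlo : ∀ i, p.lo i = (D.get (Fin.cast hl i)).1)
    (hrel : ∀ a b, p.rel a b ↔ a = b ∨
      (rowLabels U D (Sum.map (Fin.cast hk) (Fin.cast hl) a) =
        rowLabels U D (Sum.map (Fin.cast hk) (Fin.cast hl) b) ∧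
      rowLabels U D (Sum.map (Fin.cast hk) (Fin.cast hl) a) ≠ none)) :
    p ∈ C k l ↔ C.Contains U D := by
  refine Family.mem_congr_iff C hk hl hup hlo fun a b => ?_
  rw [hrel]
  refine or_congr ?_ Iff.rfl
  subst hk hl
  rcases a with a | a <;> rcases b with b | b <;> simp

theorem Family.contains_of_mem {C : Family} {k l : ℕ} {p : ColoredPartition k l} (hp : p ∈ C k l)
    {U D : Word} (hk : k = U.length) (hl : l = D.length)
    (hup : ∀ i, p.up i = (U.get (Fin.cast hk i)).1) (hlo : ∀ i, p.lo i = (D.get (Fin.cast hl i)).1)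
    (hrel : ∀ a b, p.rel a b ↔ a = b ∨
      (rowLabels U D (Sum.map (Fin.cast hk) (Fin.cast hl) a) =
        rowLabels U D (Sum.map (Fin.cast hk) (Fin.cast hl) b) ∧
      rowLabels U D (Sum.map (Fin.cast hk) (Fin.cast hl) a) ≠ none)) :
    C.Contains U D :=
  (Family.mem_iff_contains C hk hl hup hlo hrel).1 hp

theorem tensorPoints_injective (k l k' l' : ℕ) : Function.Injective (tensorPoints k l k' l') := by
  have h : ∀ x, Sum.elim (Sum.elim (fun i => Sum.inl (Fin.castAdd k' i)) fun i => Sum.inr (Fin.castAdd l' i))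
      (Sum.elim (fun i => Sum.inl (Fin.natAdd k i)) fun i => Sum.inr (Fin.natAdd l i))
      (tensorPoints k l k' l' x) = x := by
    rintro (i | i) <;> refine Fin.addCases (fun i => ?_) (fun i => ?_) i <;> simp [tensorPoints]
  exact Function.LeftInverse.injective h

section

variable {C : Family}

/-- The tensor product of partitions given by words without common labels is the partition given by the
concatenated words. -/
theorem Family.tensor_mem_iff_contains (C : Family) {U D U' D' : Word}
    (hdis : ∀ z, Occurs z (U ++ D) → ¬ Occurs z (U' ++ D')) :
    (wordPartition U D).tensor (wordPartition U' D') ∈ C _ _ ↔ C.Contains (U ++ U') (D ++ D') := by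
  have hget : ∀ (V V' : Word) (i : Fin V.length) (e : V.length + V'.length = (V ++ V').length),
      (V ++ V').get (Fin.cast e (Fin.castAdd _ i)) = V.get i := by
    intro V V' i e
    simp [List.getElem_append_left]
  have hget' : ∀ (V V' : Word) (i : Fin V'.length) (e : V.length + V'.length = (V ++ V').length),
      (V ++ V').get (Fin.cast e (Fin.natAdd _ i)) = V'.get i := by
    intro V V' i e
    simp [List.getElem_append_right]
  have eU : U.length + U'.length = (U ++ U').length := List.length_append.symm
  have eD : D.length + D'.length = (D ++ D').length := List.length_append.symm
  have hlab : ∀ a, rowLabels (U ++ U') (D ++ D') (Sum.map (Fin.cast eU) (Fin.cast eD) a) =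
      Sum.elim (rowLabels U D) (rowLabels U' D') (tensorPoints _ _ _ _ a) := by
    rintro (i | i) <;> refine Fin.addCases (fun i => ?_) (fun i => ?_) i <;>
      simp only [tensorPoints, rowLabels, Sum.elim_inl, Sum.elim_inr, Sum.map_inl, Sum.map_inr,
        Fin.addCases_left, Fin.addCases_right, hget, hget']
  have hocc : ∀ (V W : Word) (x) (z), rowLabels V W x = some z → Occurs z (V ++ W) := by
    rintro V W (x | x) z hz
    · exact (occurs_append _ _ _).2 (Or.inl (occurs_of_get x hz))
    · exact (occurs_append _ _ _).2 (Or.inr (occurs_of_get x hz))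
  have hne : ∀ x y, rowLabels U D x = rowLabels U' D' y → rowLabels U D x = none := by
    intro x y e
    cases hx : rowLabels U D x with
    | none => rfl
    | some z => exact absurd (hocc _ _ y z (e ▸ hx)) (hdis z (hocc _ _ x z hx))
  refine Family.mem_iff_contains C eU eD ?_ ?_ ?_
  · intro i
    refine Fin.addCases (fun i => ?_) (fun i => ?_) i
    · rw [hget]; exact Fin.append_left _ _ _
    · rw [hget']; exact Fin.append_right _ _ _
  · intro i
    refine Fin.addCases (fun i => ?_) (fun i => ?_) i
    · rw [hget]; exact Fin.append_left _ _ _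
    · rw [hget']; exact Fin.append_right _ _ _
  · intro a b
    rw [hlab, hlab, ← (tensorPoints_injective _ _ _ _).eq_iff]
    change sumSetoid (labelSetoid (rowLabels U D)) (labelSetoid (rowLabels U' D'))
      (tensorPoints _ _ _ _ a) (tensorPoints _ _ _ _ b) ↔ _
    generalize tensorPoints _ _ _ _ a = x
    generalize tensorPoints _ _ _ _ b = y
    rcases x with x | x <;> rcases y with y | y <;>
      simp only [sumSetoid_inl_inl, sumSetoid_inr_inr, not_sumSetoid_inl_inr, not_sumSetoid_inr_inl,
        labelSetoid_iff, Sum.elim_inl, Sum.elim_inr, Sum.inl.injEq, Sum.inr.injEq, reduceCtorEq,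
        false_or, false_iff, not_and, not_not]
    · exact hne x y
    · intro e
      rw [e]; exact hne y x e.symm

theorem IsCategory.contains_tensor (hC : IsCategory C) {U D U' D' : Word} (h : C.Contains U D)
    (h' : C.Contains U' D') (hdis : ∀ z, Occurs z (U ++ D) → ¬ Occurs z (U' ++ D')) :
    C.Contains (U ++ U') (D ++ D') :=
  (Family.tensor_mem_iff_contains C hdis).1 (hC.tensor h h')

theorem IsCategory.contains_swap (hC : IsCategory C) {U D : Word} (h : C.Contains U D) :
    C.Contains D U := by
  refine Family.contains_of_mem (hC.involution h) rfl rfl (fun _ => rfl) (fun _ => rfl) ?_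
  rintro (a | a) (b | b) <;>
    refine (labelSetoid_iff (rowLabels U D) (Sum.swap _) (Sum.swap _)).trans ?_ <;> simp [rowLabels]

theorem IsCategory.contains_nil (hC : IsCategory C) : C.Contains [] [] := by
  have := hC.comp (hC.involution hC.pair_wb) hC.pair_wb rfl
  refine Family.contains_of_mem this rfl rfl (fun i => i.elim0) (fun i => i.elim0) ?_
  rintro (a | a) <;> exact a.elim0

theorem IsCategory.identity_mem (hC : IsCategory C) (a : Color) : identity a ∈ C 1 1 := by
  cases a
  exacts [hC.identity_w, hC.identity_b]

theorem IsCategory.pair_mem (hC : IsCategory C) (a : Color) : pair a a.inv ∈ C 0 2 := by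
  cases a
  exacts [hC.pair_wb, hC.pair_bw]

theorem IsCategory.contains_identity (hC : IsCategory C) (a : Color) (z : ℕ) :
    C.Contains [(a, some z)] [(a, some z)] := by
  refine Family.contains_of_mem (hC.identity_mem a) rfl rfl (fun i => ?_) (fun i => ?_) ?_
  · obtain rfl := Fin.fin_one_eq_zero i; rfl
  · obtain rfl := Fin.fin_one_eq_zero i; rfl
  · rintro (a | a) (b | b) <;> obtain rfl := Fin.fin_one_eq_zero a <;>
      obtain rfl := Fin.fin_one_eq_zero b <;>
      exact iff_of_true trivial (Or.inr ⟨rfl, by simp [rowLabels]⟩)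

theorem IsCategory.contains_pair (hC : IsCategory C) (a : Color) (z : ℕ) :
    C.Contains [] [(a, some z), (a.inv, some z)] := by
  refine Family.contains_of_mem (hC.pair_mem a) rfl rfl (fun i => i.elim0) (fun i => ?_) ?_
  · fin_cases i <;> rfl
  · rintro (a | a) (b | b)
    · exact a.elim0
    · exact a.elim0
    · exact b.elim0
    · refine iff_of_true trivial (Or.inr ⟨?_, ?_⟩) <;> fin_cases a <;> fin_cases b <;> simp [rowLabels]

/-- The identity partition on a row of points: points with the same number form a block. -/
def identityRow {n : ℕ} (f : Fin n → Color) : ColoredPartition n n where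
  up := f
  lo := f
  rel := Setoid.ker (Sum.elim (fun i : Fin n => (i : ℕ)) (fun i : Fin n => (i : ℕ)))

theorem identityRow_rel {n : ℕ} (f : Fin n → Color) (x y : Fin n ⊕ Fin n) : (identityRow f).rel x y ↔
    Sum.elim (fun i : Fin n => (i : ℕ)) (fun i : Fin n => (i : ℕ)) x =
      Sum.elim (fun i : Fin n => (i : ℕ)) (fun i : Fin n => (i : ℕ)) y := Iff.rfl

theorem IsCategory.identityRow_mem (hC : IsCategory C) {n : ℕ} (f : Fin n → Color) :
    identityRow f ∈ C n n := by
  induction n with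
  | zero =>
    refine Family.mem_congr C rfl rfl (fun i => i.elim0) (fun i => i.elim0) ?_ hC.contains_nil
    rintro (a | a) <;> exact a.elim0
  | succ n ih =>
    have h := hC.tensor (ih fun i => f i.castSucc) (hC.identity_mem (f (Fin.last n)))
    refine Family.mem_congr C rfl rfl ?_ ?_ ?_ h
    · intro i
      refine Fin.addCases (fun i => ?_) (fun i => ?_) i
      · exact Fin.append_left _ _ _
      · obtain rfl := Fin.fin_one_eq_zero i
        exact Fin.append_right _ _ _
    · intro i
      refine Fin.addCases (fun i => ?_) (fun i => ?_) i
      · exact Fin.append_left _ _ _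
      · obtain rfl := Fin.fin_one_eq_zero i
        exact Fin.append_right _ _ _
    · have key : ∀ x y : (Fin n ⊕ Fin n) ⊕ (Fin 1 ⊕ Fin 1),
          sumSetoid (identityRow fun i => f i.castSucc).rel (identity (f (Fin.last n))).rel x y ↔
          (Sum.elim (Sum.elim (fun i : Fin n => (i : ℕ)) (fun i : Fin n => (i : ℕ))) (fun _ => n) x =
          Sum.elim (Sum.elim (fun i : Fin n => (i : ℕ)) (fun i : Fin n => (i : ℕ))) (fun _ => n) y) := by
        rintro ((x | x) | x) ((y | y) | y) <;>
          simp only [sumSetoid_inl_inl, sumSetoid_inr_inr, not_sumSetoid_inl_inr,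
            not_sumSetoid_inr_inl, identityRow_rel, Sum.elim_inl, Sum.elim_inr,
            false_iff] <;> first | omega | exact iff_of_true trivial trivial
      have hmap : ∀ a : Fin (n + 1) ⊕ Fin (n + 1), Sum.elim (Sum.elim (fun i : Fin n => (i : ℕ)) (fun i : Fin n => (i : ℕ)))
          (fun _ => n) (tensorPoints n n 1 1 a) =
          Sum.elim (fun i : Fin (n + 1) => (i : ℕ)) (fun i : Fin (n + 1) => (i : ℕ)) a := by
        rintro (i | i) <;> refine Fin.addCases (fun i => ?_) (fun i => ?_) i <;> simp [tensorPoints]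
      intro a b
      refine (key _ _).trans ?_
      rw [hmap, hmap]
      rcases a with a | a <;> rcases b with b | b <;> rfl

/-- A pair of upper points, followed by the identity on a row of points. Points with the same number form
a block; by the truncated subtraction the first two upper points both have the number `0`. -/
def capRow {n : ℕ} (a : Color) (f : Fin n → Color) : ColoredPartition (n + 2) n where
  up := Fin.cons a (Fin.cons a.inv f)
  lo := f
  rel := Setoid.ker (Sum.elim (fun i : Fin (n + 2) => (i : ℕ) - 1) (fun i : Fin n => (i : ℕ) + 1))

theorem IsCategory.capRow_mem (hC : IsCategory C) {n : ℕ} (a : Color) (f : Fin n → Color) :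
    capRow a f ∈ C (n + 2) n := by
  have h := hC.tensor (hC.involution (hC.pair_mem a)) (hC.identityRow_mem f)
  refine Family.mem_congr C (Nat.add_comm _ _) (Nat.zero_add _) ?_ ?_ ?_ h
  · intro i
    refine Fin.addCases (fun i => ?_) (fun i => ?_) i
    · refine (Fin.append_left _ _ _).trans ?_
      fin_cases i <;> rfl
    · refine (Fin.append_right _ _ _).trans ?_
      have : Fin.cast (Nat.add_comm 2 n) (Fin.natAdd 2 i) = i.succ.succ := by
        ext; simp
      rw [this]; rfl
  · intro i
    refine Fin.addCases (fun i => ?_) (fun i => ?_) i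
    · exact i.elim0
    · refine (Fin.append_right (pair a a.inv).up f i).trans ?_
      have : Fin.cast (Nat.zero_add n) (Fin.natAdd 0 i) = i := by
        ext; simp
      rw [this]; rfl
  · have key : ∀ x y : (Fin 2 ⊕ Fin 0) ⊕ (Fin n ⊕ Fin n),
        sumSetoid (pair a a.inv).involution.rel (identityRow f).rel x y ↔
        (Sum.elim (fun _ => 0) (Sum.elim (fun i : Fin n => (i : ℕ) + 1) (fun i : Fin n => (i : ℕ) + 1)) x =
        Sum.elim (fun _ => 0) (Sum.elim (fun i : Fin n => (i : ℕ) + 1) (fun i : Fin n => (i : ℕ) + 1)) y) := by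
      rintro (x | (x | x)) (y | (y | y)) <;>
        simp only [sumSetoid_inl_inl, sumSetoid_inr_inr, not_sumSetoid_inl_inr,
          not_sumSetoid_inr_inl, identityRow_rel, Sum.elim_inl, Sum.elim_inr,
          false_iff] <;> first | omega | exact iff_of_true trivial trivial
    have hmap : ∀ a : Fin (2 + n) ⊕ Fin (0 + n), Sum.elim (fun _ => 0)
        (Sum.elim (fun i : Fin n => (i : ℕ) + 1) (fun i : Fin n => (i : ℕ) + 1)) (tensorPoints 2 0 n n a) =
        Sum.elim (fun i : Fin (n + 2) => (i : ℕ) - 1) (fun i : Fin n => (i : ℕ) + 1)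
          (Sum.map (Fin.cast (Nat.add_comm _ _)) (Fin.cast (Nat.zero_add _)) a) := by
      rintro (i | i) <;> refine Fin.addCases (fun i => ?_) (fun i => ?_) i
      · simp [tensorPoints]; omega
      · simp [tensorPoints]
      · exact i.elim0
      · simp only [tensorPoints, Sum.elim_inr, Fin.addCases_right, Sum.map_inr]
        simp
    intro x y
    refine (key _ _).trans ?_
    rw [hmap, hmap]
    rfl

/-- Composition with `capRow` contracts the first two lower points. -/
theorem capRow_comp_rel {k n : ℕ} (a : Color) (f : Fin n → Color) (q : ColoredPartition k (n + 2))
    (x y : Fin k ⊕ Fin n) : ((capRow a f).comp q).rel x y ↔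
      joinBlocks q.rel (.inr 0) (.inr 1) (Sum.map id (fun j => j.succ.succ) x)
        (Sum.map id (fun j => j.succ.succ) y) := by
  have cap : ∀ u v, (capRow a f).rel u v ↔
      Sum.elim (fun i : Fin (n + 2) => (i : ℕ) - 1) (fun i : Fin n => (i : ℕ) + 1) u =
      Sum.elim (fun i : Fin (n + 2) => (i : ℕ) - 1) (fun i : Fin n => (i : ℕ) + 1) v := fun _ _ => Iff.rfl
  have h1 : ∀ u v, Relation.EqvGen (CompStep (capRow a f) q) u v →
      joinBlocks q.rel (.inr 0) (.inr 1)
        (Sum.elim Sum.inl (Sum.elim Sum.inr fun j => Sum.inr j.succ.succ) u)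
        (Sum.elim Sum.inl (Sum.elim Sum.inr fun j => Sum.inr j.succ.succ) v) := by
    intro u v huv
    induction huv with
    | rel u v huv =>
      rcases huv with ⟨u, v, huv⟩ | ⟨u, v, huv⟩
      · rcases u with u | u <;> rcases v with v | v <;> exact Or.inl huv
      · rw [cap] at huv
        -- the point of the lower row of `q` that lies above `u`
        have low : ∀ u : Fin (n + 2) ⊕ Fin n, ∃ j : Fin (n + 2),
            Sum.elim Sum.inl (Sum.elim Sum.inr fun j => Sum.inr j.succ.succ)
              (Sum.inr u : Fin k ⊕ Fin (n + 2) ⊕ Fin n) = (Sum.inr j : Fin k ⊕ Fin (n + 2)) ∧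
            Sum.elim (fun i : Fin (n + 2) => (i : ℕ) - 1) (fun i : Fin n => (i : ℕ) + 1) u = (j : ℕ) - 1 := by
          rintro (u | u)
          · exact ⟨u, rfl, rfl⟩
          · exact ⟨u.succ.succ, rfl, by simp⟩
        obtain ⟨i, hi, hi'⟩ := low u
        obtain ⟨j, hj, hj'⟩ := low v
        rw [hi, hj]
        rw [hi', hj'] at huv
        by_cases hij : i = j
        · subst hij; exact Or.inl (q.rel.refl _)
        · have : (i : ℕ) ≠ j := fun e => hij (Fin.ext e)
          by_cases h0 : (i : ℕ) = 0
          · have h1 : (j : ℕ) = 1 := by omega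
            obtain rfl : i = 0 := Fin.ext h0
            obtain rfl : j = 1 := Fin.ext (by simpa using h1)
            exact Or.inr (Or.inl ⟨q.rel.refl _, q.rel.refl _⟩)
          · have h1 : (i : ℕ) = 1 := by omega
            have h2 : (j : ℕ) = 0 := by omega
            obtain rfl : j = 0 := Fin.ext h2
            obtain rfl : i = 1 := Fin.ext (by simpa using h1)
            exact Or.inr (Or.inr ⟨q.rel.refl _, q.rel.refl _⟩)
    | refl u => exact Setoid.refl' _ _
    | symm u v _ ih => exact Setoid.symm' _ ih
    | trans u v w _ _ ih1 ih2 => exact Setoid.trans' _ ih1 ih2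
  have E := (Relation.EqvGen.setoid (CompStep (capRow a f) q))
  have above : ∀ u v, q.rel u v → Relation.EqvGen (CompStep (capRow a f) q)
      (Sum.map id Sum.inl u) (Sum.map id Sum.inl v) := fun u v h => .rel _ _ (.above _ _ h)
  have mid : Relation.EqvGen (CompStep (capRow a f) q) (.inr (.inl 0)) (.inr (.inl 1)) :=
    .rel _ _ (.below (.inl 0) (.inl 1) ((cap _ _).2 (by simp)))
  have out : ∀ x : Fin k ⊕ Fin n, Relation.EqvGen (CompStep (capRow a f) q) (Sum.map id Sum.inr x)
      (Sum.map id Sum.inl (Sum.map id (fun j : Fin n => j.succ.succ) x)) := by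
    rintro (x | x)
    · exact .refl _
    · exact .rel _ _ (.below (.inr x) (.inl x.succ.succ) ((cap _ _).2 (by simp)))
  constructor
  · intro h
    have := h1 _ _ h
    rcases x with x | x <;> rcases y with y | y <;> exact this
  · intro h
    refine .trans _ _ _ (out x) (.trans _ _ _ ?_ (.symm _ _ (out y)))
    rcases h with h | ⟨h, h'⟩ | ⟨h, h'⟩
    · exact above _ _ h
    · exact .trans _ _ _ (above _ _ h) (.trans _ _ _ mid (above _ _ h'))
    · exact .trans _ _ _ (above _ _ h) (.trans _ _ _ (.symm _ _ mid) (above _ _ h'))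

theorem joinBlocks_labelSetoid {X : Type} (f : X → Option ℕ) {p q x y : X} (hxy : x ≠ y) (hxp : x ≠ p)
    (hxq : x ≠ q) (hyp : y ≠ p) (hyq : y ≠ q) : joinBlocks (labelSetoid f) p q x y ↔
      (f x = f y ∧ f x ≠ none) ∨ (f x = f p ∧ f p ≠ none ∧ f y = f q ∧ f q ≠ none) ∨
      (f x = f q ∧ f q ≠ none ∧ f y = f p ∧ f p ≠ none) := by
  simp only [joinBlocks_iff, labelSetoid_iff, hxy, hxp, hxq, hyp.symm, hyq.symm, false_or]
  grind

/-- The contraction of the first two lower points, for general labels. -/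
theorem IsCategory.contains_of_contraction (hC : IsCategory C) {a : Color} {P Q : Option ℕ}
    {U D U' D' : Word} (h : C.Contains U ((a, P) :: (a.inv, Q) :: D))
    (hU : U'.map Prod.fst = U.map Prod.fst) (hD : D'.map Prod.fst = D.map Prod.fst)
    (eU : U.length = U'.length) (eD : D.length = D'.length)
    (hrel : ∀ x y, x ≠ y →
      ((rowLabels U' D' (Sum.map (Fin.cast eU) (Fin.cast eD) x) =
        rowLabels U' D' (Sum.map (Fin.cast eU) (Fin.cast eD) y) ∧
        rowLabels U' D' (Sum.map (Fin.cast eU) (Fin.cast eD) x) ≠ none) ↔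
      ((rowLabels U D x = rowLabels U D y ∧ rowLabels U D x ≠ none) ∨
      (rowLabels U D x = P ∧ P ≠ none ∧ rowLabels U D y = Q ∧ Q ≠ none) ∨
      (rowLabels U D x = Q ∧ Q ≠ none ∧ rowLabels U D y = P ∧ P ≠ none)))) :
    C.Contains U' D' := by
  have h1 := hC.comp (hC.capRow_mem a fun i : Fin D.length => (D.get i).1) h (by
    funext i
    refine Fin.cases ?_ (fun i => Fin.cases ?_ (fun i => ?_) i) i <;> rfl)
  have hcol : ∀ (V V' : Word) (e : V.length = V'.length), V'.map Prod.fst = V.map Prod.fst →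
      ∀ i : Fin V.length, (V.get i).1 = (V'.get (Fin.cast e i)).1 := by
    intro V V' e hV i
    have h2 : (V.map Prod.fst)[(i : ℕ)]? = (V'.map Prod.fst)[(i : ℕ)]? := by rw [hV]
    have h3 : (i : ℕ) < V'.length := e ▸ i.isLt
    simpa [h3] using h2
  refine Family.contains_of_mem h1 eU eD (hcol U U' eU hU) (hcol D D' eD hD) ?_
  intro x y
  rw [capRow_comp_rel]
  by_cases hxy : x = y
  · subst hxy
    exact iff_of_true (Setoid.refl' _ _) (Or.inl rfl)
  · rw [hrel x y hxy, or_iff_right hxy]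
    have hlab : ∀ x, rowLabels U ((a, P) :: (a.inv, Q) :: D) (Sum.map id (fun j => j.succ.succ) x) =
        rowLabels U D x := by
      rintro (x | x) <;> rfl
    have hinj : Function.Injective (Sum.map id (fun j => j.succ.succ) :
        Fin U.length ⊕ Fin D.length → Fin U.length ⊕ Fin (D.length + 2)) :=
      Sum.map_injective.2 ⟨Function.injective_id, fun i j h => by simpa using h⟩
    have h0 : ∀ x : Fin U.length ⊕ Fin D.length, (Sum.map id (fun j => j.succ.succ) x :
        Fin U.length ⊕ Fin (D.length + 2)) ≠ .inr 0 := by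
      rintro (x | x) <;> simp
    have h1 : ∀ x : Fin U.length ⊕ Fin D.length, (Sum.map id (fun j => j.succ.succ) x :
        Fin U.length ⊕ Fin (D.length + 2)) ≠ .inr 1 := by
      rintro (x | x) <;> simp [Fin.ext_iff]
    refine (joinBlocks_labelSetoid _ (fun e => hxy (hinj e)) (h0 x) (h1 x) (h0 y) (h1 y)).trans ?_
    rw [hlab, hlab]
    rfl

end

/-! ### Operations on words in a category -/

/-- The label `z` is replaced by `X`. -/
def relabel (z : ℕ) (X : Option ℕ) (w : Word) : Word :=
  w.map fun x => (x.1, if x.2 = some z then X else x.2)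

@[simp] theorem relabel_nil (z : ℕ) (X : Option ℕ) : relabel z X [] = [] := rfl

@[simp] theorem relabel_cons (z : ℕ) (X : Option ℕ) (x : Color × Option ℕ) (w : Word) :
    relabel z X (x :: w) = (x.1, if x.2 = some z then X else x.2) :: relabel z X w := rfl

@[simp] theorem relabel_append (z : ℕ) (X : Option ℕ) (v w : Word) :
    relabel z X (v ++ w) = relabel z X v ++ relabel z X w := List.map_append

theorem relabel_of_not_occurs {z : ℕ} {w : Word} (X : Option ℕ) (h : ¬ Occurs z w) :
    relabel z X w = w := by
  induction w with
  | nil => rfl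
  | cons x w ih =>
    rw [occurs_cons, not_or] at h
    rw [relabel_cons, if_neg h.1, ih h.2]

theorem two_le_count {α : Type} [BEq α] [LawfulBEq α] {l : List α} {a : α} {i j : ℕ} (hij : i ≠ j)
    (hi : l[i]? = some a) (hj : l[j]? = some a) : 2 ≤ l.count a := by
  induction l generalizing i j with
  | nil => simp at hi
  | cons b l ih =>
    rw [List.count_cons]
    rcases i with _ | i <;> rcases j with _ | j
    · exact absurd rfl hij
    · simp only [List.getElem?_cons_zero, Option.some.injEq, List.getElem?_cons_succ] at hi hj
      have := List.count_pos_iff.2 (List.mem_of_getElem? hj)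
      simp only [hi, beq_self_eq_true, if_true]; omega
    · simp only [List.getElem?_cons_zero, Option.some.injEq, List.getElem?_cons_succ] at hi hj
      have := List.count_pos_iff.2 (List.mem_of_getElem? hi)
      simp only [hj, beq_self_eq_true, if_true]; omega
    · have := ih (fun e => hij (by rw [e])) hi hj
      omega

theorem rowLabels_eq_getElem? (U D : Word) (x : Fin U.length ⊕ Fin D.length) :
    ((U ++ D).map Prod.snd)[Sum.elim (fun i : Fin U.length => (i : ℕ))
      (fun j : Fin D.length => U.length + (j : ℕ)) x]? = some (rowLabels U D x) := by
  rcases x with x | x <;> simp [rowLabels, List.getElem?_append]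

theorem eq_of_count_le_one {U D : Word} {z : ℕ}
    (hcount : ((U ++ D).map Prod.snd).count (some z) ≤ 1) {x y : Fin U.length ⊕ Fin D.length}
    (hx : rowLabels U D x = some z) (hy : rowLabels U D y = some z) : x = y := by
  by_contra hxy
  have := two_le_count ?_ (hx ▸ rowLabels_eq_getElem? U D x) (hy ▸ rowLabels_eq_getElem? U D y)
  · omega
  · rcases x with ⟨x, hx⟩ | ⟨x, hx⟩ <;> rcases y with ⟨y, hy⟩ | ⟨y, hy⟩ <;> simp at hxy ⊢ <;> omega

theorem count_eq_zero_of_not_occurs {z : ℕ} {w : Word} (h : ¬ Occurs z w) :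
    (w.map Prod.snd).count (some z) = 0 := List.count_eq_zero.2 h

theorem rowLabels_relabel (z : ℕ) (X : Option ℕ) (U D : Word)
    (eU : U.length = (relabel z X U).length) (eD : D.length = (relabel z X D).length)
    (x : Fin U.length ⊕ Fin D.length) :
    rowLabels (relabel z X U) (relabel z X D) (Sum.map (Fin.cast eU) (Fin.cast eD) x) =
      if rowLabels U D x = some z then X else rowLabels U D x := by
  rcases x with x | x <;> simp [rowLabels, relabel] <;> rfl

theorem map_fst_relabel (z : ℕ) (X : Option ℕ) (w : Word) :
    (relabel z X w).map Prod.fst = w.map Prod.fst := by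
  simp [relabel]

section

variable {C : Family}

/-- The first two lower points are contracted, where `z` is the label of one of them and occurs at most
once elsewhere. The point labelled by `z`, if any, receives the label of the other contracted point. -/
theorem IsCategory.contains_contract (hC : IsCategory C) {a : Color} {P Q X : Option ℕ} {z : ℕ}
    {U D : Word} (hPQ : P = X ∧ Q = some z ∨ P = some z ∧ Q = X) (hX : X ≠ some z)
    (hcount : ((U ++ D).map Prod.snd).count (some z) ≤ 1)
    (h : C.Contains U ((a, P) :: (a.inv, Q) :: D)) :
    C.Contains (relabel z X U) (relabel z X D) := by
  refine hC.contains_of_contraction h (map_fst_relabel _ _ _) (map_fst_relabel _ _ _)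
    (by simp [relabel]) (by simp [relabel]) fun x y hxy => ?_
  rw [rowLabels_relabel, rowLabels_relabel]
  have huniq : ¬ (rowLabels U D x = some z ∧ rowLabels U D y = some z) :=
    fun e => hxy (eq_of_count_le_one hcount e.1 e.2)
  generalize rowLabels U D x = lx at *
  generalize rowLabels U D y = ly at *
  rcases hPQ with ⟨rfl, rfl⟩ | ⟨rfl, rfl⟩ <;> split_ifs <;> grind

theorem IsCategory.contains_contract_none (hC : IsCategory C) {a : Color}
    {U D : Word} (h : C.Contains U ((a, none) :: (a.inv, none) :: D)) : C.Contains U D := by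
  refine hC.contains_of_contraction h rfl rfl rfl rfl fun x y hxy => ?_
  simp

/-- The leftmost lower point is rotated to the upper row. -/
theorem IsCategory.contains_leftUp (hC : IsCategory C) {x : Color × Option ℕ} {U D : Word}
    (h : C.Contains U (x :: D)) : C.Contains ((x.1.inv, x.2) :: U) D := by
  obtain ⟨z, hz⟩ := exists_not_occurs (U ++ x :: D)
  have h1 := hC.contains_tensor (hC.contains_identity x.1.inv z) h (by
    simp only [occurs_append, occurs_cons, occurs_nil, or_false, or_self, Option.some.injEq] at hz ⊢
    rintro _ rfl; exact hz)
  simp only [occurs_append, occurs_cons, not_or] at hz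
  have h2 := hC.contains_contract (X := x.2) (z := z) (a := x.1.inv) (P := some z) (Q := x.2)
    (U := (x.1.inv, some z) :: U) (D := D) (Or.inr ⟨rfl, rfl⟩) hz.2.1 (by
      have e1 := count_eq_zero_of_not_occurs hz.1
      have e2 := count_eq_zero_of_not_occurs hz.2.2
      simp [List.count_append] at e1 e2 ⊢
      omega) (by rw [Color.inv_inv]; exact h1)
  simpa [relabel_of_not_occurs, hz.1, hz.2.2] using h2

theorem IsCategory.contains_leftDown (hC : IsCategory C) {x : Color × Option ℕ} {U D : Word}
    (h : C.Contains (x :: U) D) : C.Contains U ((x.1.inv, x.2) :: D) :=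
  hC.contains_swap (hC.contains_leftUp (hC.contains_swap h))

/-- The reflected word with inverted colors. -/
def invWord (w : Word) : Word := (w.map fun x => (x.1.inv, x.2)).reverse

@[simp] theorem invWord_nil : invWord [] = [] := rfl

@[simp] theorem invWord_cons (x : Color × Option ℕ) (w : Word) :
    invWord (x :: w) = invWord w ++ [(x.1.inv, x.2)] := by simp [invWord]

@[simp] theorem invWord_append (v w : Word) : invWord (v ++ w) = invWord w ++ invWord v := by
  simp [invWord]

/-- The upper points are rotated to the lower row. -/
theorem Family.line_of_contains {F : Family}
    (hF : ∀ x U D, F.Contains (x :: U) D → F.Contains U ((x.1.inv, x.2) :: D)) {U D : Word}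
    (h : F.Contains U D) : F.Contains [] (invWord U ++ D) := by
  induction U generalizing D with
  | nil => exact h
  | cons x U ih => simpa using ih (hF x U D h)

theorem Family.line_rotate {F : Family} (hF : ∀ x w, F.Contains [] (x :: w) → F.Contains [] (w ++ [x]))
    {u v : Word} (h : F.Contains [] (u ++ v)) : F.Contains [] (v ++ u) := by
  induction u generalizing v with
  | nil => simpa using h
  | cons x u ih =>
    have := ih (v := v ++ [x]) (by simpa using hF x (u ++ v) h)
    simpa using this

theorem IsCategory.contains_of_line (hC : IsCategory C) {U D : Word}
    (h : C.Contains [] (invWord U ++ D)) : C.Contains U D := by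
  induction U generalizing D with
  | nil => exact h
  | cons x U ih =>
    have := hC.contains_leftUp (ih (D := (x.1.inv, x.2) :: D) (by simpa using h))
    simpa [Color.inv_inv] using this

theorem IsCategory.line_invWord (hC : IsCategory C) {w : Word} (h : C.Contains [] w) :
    C.Contains [] (invWord w) := by
  simpa using Family.line_of_contains (fun _ _ _ => hC.contains_leftDown) (hC.contains_swap h)

/-- The first point is rotated to the upper row, and contracted with the upper point of an identity
partition that has been added on the right. -/
theorem IsCategory.line_rotate_one (hC : IsCategory C) {x : Color × Option ℕ} {w : Word}
    (h : C.Contains [] (x :: w)) : C.Contains [] (w ++ [x]) := by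
  obtain ⟨z, hz⟩ := exists_not_occurs (x :: w)
  have h1 := hC.contains_tensor (hC.contains_leftUp h) (hC.contains_identity x.1 z) (by
    simp only [occurs_append, occurs_cons, occurs_nil, or_false, or_self, Option.some.injEq] at hz ⊢
    rintro _ h rfl; exact hz h)
  simp only [occurs_cons, not_or] at hz
  have h2 := hC.contains_contract (X := x.2) (z := z) (a := x.1.inv) (P := x.2) (Q := some z)
    (U := w ++ [(x.1, some z)]) (D := []) (Or.inl ⟨rfl, rfl⟩) hz.1 (by
      have e2 := count_eq_zero_of_not_occurs hz.2
      simp [List.count_append] at e2 ⊢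
      omega) (by rw [Color.inv_inv]; exact hC.contains_swap h1)
  simpa [relabel_of_not_occurs, hz.2] using hC.contains_swap h2

theorem IsCategory.line_rotate (hC : IsCategory C) {u v : Word} (h : C.Contains [] (u ++ v)) :
    C.Contains [] (v ++ u) :=
  Family.line_rotate (fun _ _ => hC.line_rotate_one) h

theorem IsCategory.line_insert (hC : IsCategory C) {u v w : Word} (h : C.Contains [] (u ++ v))
    (hw : C.Contains [] w) (hdis : ∀ z, Occurs z w → ¬ Occurs z (u ++ v)) :
    C.Contains [] (u ++ (w ++ v)) := by
  have h1 := hC.contains_tensor (hC.line_rotate h) hw (by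
    intro z hz hz'
    simp only [occurs_append, List.nil_append] at hz hz' hdis
    exact hdis z hz' hz.symm)
  have h2 := hC.line_rotate (u := v) (v := u ++ w) (by simpa using h1)
  simpa using h2

theorem IsCategory.line_contract_none (hC : IsCategory C) {a : Color} {u v : Word}
    (h : C.Contains [] (u ++ (a, none) :: (a.inv, none) :: v)) : C.Contains [] (u ++ v) :=
  hC.line_rotate (hC.contains_contract_none (D := v ++ u) (by simpa using hC.line_rotate h))

/-! ### Words of singletons -/

/-- The word consisting of `s` white, or of `-s` black singletons. -/
def singles (s : ℤ) : Word := List.replicate s.natAbs (signColor s, none)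

/-- The sum of the signs of the letters. -/
def colorSum (w : Word) : ℤ := (w.map fun x => x.1.sign).sum

@[simp] theorem colorSum_nil : colorSum [] = 0 := rfl

@[simp] theorem colorSum_cons (x : Color × Option ℕ) (w : Word) :
    colorSum (x :: w) = x.1.sign + colorSum w := by simp [colorSum]

@[simp] theorem colorSum_append (v w : Word) : colorSum (v ++ w) = colorSum v + colorSum w := by
  simp [colorSum]

@[simp] theorem colorSum_singles (s : ℤ) : colorSum (singles s) = s := by
  have := signColor_sign s
  simpa [colorSum, singles] using this

theorem colorSum_invWord (w : Word) : colorSum (invWord w) = -colorSum w := by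
  induction w with
  | nil => rfl
  | cons x w ih =>
    rw [invWord_cons, colorSum_append, ih]
    simp [Color.sign_inv]

theorem colorSum_relabel (z : ℕ) (X : Option ℕ) (w : Word) : colorSum (relabel z X w) = colorSum w := by
  induction w with
  | nil => rfl
  | cons x w ih => simp [ih]

theorem singles_add_one {m : ℤ} (hm : 0 ≤ m) : singles (m + 1) = (.white, none) :: singles m := by
  obtain ⟨n, rfl⟩ := Int.eq_ofNat_of_zero_le hm
  have e : ((n : ℤ) + 1).natAbs = n + 1 := by omega
  have e' : signColor ((n : ℤ) + 1) = .white := if_pos (by omega)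
  have e'' : signColor (n : ℤ) = .white := if_pos (by omega)
  rw [singles, singles, e, e', e'', Int.natAbs_natCast, List.replicate_succ]

theorem singles_sub_one {m : ℤ} (hm : m ≤ 0) : singles (m - 1) = (.black, none) :: singles m := by
  have e : (m - 1).natAbs = m.natAbs + 1 := by omega
  have e' : signColor (m - 1) = .black := if_neg (by omega)
  rw [singles, singles, e, e', List.replicate_succ]
  congr 1
  by_cases h0 : m = 0
  · subst h0; rfl
  · have e'' : signColor m = .black := if_neg (by omega)
    rw [e'']

theorem label_of_mem_singles {s : ℤ} {x : Color × Option ℕ} (hx : x ∈ singles s) : x.2 = none := by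
  rw [List.eq_of_mem_replicate hx]

theorem label_of_mem_invWord {s : Word} (h : ∀ x ∈ s, x.2 = none) : ∀ x ∈ invWord s, x.2 = none := by
  intro x hx
  obtain ⟨y, hy, rfl⟩ := List.mem_map.1 (List.mem_reverse.1 hx)
  exact h y hy

theorem label_of_mem_append {s t : Word} (h : ∀ x ∈ s, x.2 = none) (h' : ∀ x ∈ t, x.2 = none) :
    ∀ x ∈ s ++ t, x.2 = none := by
  intro x hx
  rcases List.mem_append.1 hx with hx | hx
  exacts [h x hx, h' x hx]

theorem not_occurs_of_labels {w : Word} (h : ∀ x ∈ w, x.2 = none) (z : ℕ) : ¬ Occurs z w := by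
  intro hz
  obtain ⟨x, hx, hxz⟩ := List.mem_map.1 hz
  rw [h x hx] at hxz
  exact absurd hxz (by simp)

@[simp] theorem not_occurs_singles (z : ℕ) (s : ℤ) : ¬ Occurs z (singles s) :=
  not_occurs_of_labels (fun _ => label_of_mem_singles) z

/-- The family contains the two words of two singletons of different colors. -/
def HasSinglePairs (C : Family) : Prop := ∀ a : Color, C.Contains [] [(a, none), (a.inv, none)]

theorem IsCategory.line_cons_singles (hC : IsCategory C) (hs : HasSinglePairs C) (a : Color) (m : ℤ)
    (u v : Word) : C.Contains [] (u ++ (a, none) :: (singles m ++ v)) ↔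
      C.Contains [] (u ++ (singles (m + a.sign) ++ v)) := by
  have ins : ∀ (a : Color) (u v : Word), C.Contains [] (u ++ v) ↔
      C.Contains [] (u ++ (a, none) :: (a.inv, none) :: v) := fun a u v =>
    ⟨fun h => hC.line_insert h (hs a) (by simp), hC.line_contract_none⟩
  cases a
  · change _ ↔ C.Contains [] (u ++ (singles (m + 1) ++ v))
    by_cases hm : 0 ≤ m
    · rw [singles_add_one hm]; rfl
    · have e : singles m = (.black, none) :: singles (m + 1) := by
        rw [← singles_sub_one (by omega)]; congr 1; ring
      rw [e]; exact (ins .white u _).symm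
  · change _ ↔ C.Contains [] (u ++ (singles (m - 1) ++ v))
    by_cases hm : m ≤ 0
    · rw [singles_sub_one hm]; rfl
    · have e : singles m = (.white, none) :: singles (m - 1) := by
        rw [← singles_add_one (by omega)]; congr 1; ring
      rw [e]; exact (ins .black u _).symm

theorem IsCategory.line_singles_iff (hC : IsCategory C) (hs : HasSinglePairs C) (s : Word)
    (h : ∀ x ∈ s, x.2 = none) (u v : Word) : C.Contains [] (u ++ (s ++ v)) ↔
      C.Contains [] (u ++ (singles (colorSum s) ++ v)) := by
  induction s generalizing u with
  | nil => exact Iff.rfl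
  | cons x s ih =>
    have h1 := ih (fun y hy => h y (List.mem_cons_of_mem _ hy)) (u ++ [x])
    obtain ⟨a, X⟩ := x
    obtain rfl : X = none := h (a, X) List.mem_cons_self
    simp only [List.append_assoc, List.cons_append, List.nil_append] at h1 ⊢
    rw [h1, hC.line_cons_singles hs, colorSum_cons, add_comm]

/-- Within a word of the category, a word of singletons may be exchanged for another one with the same
color sum. -/
theorem IsCategory.line_exchange (hC : IsCategory C) (hs : HasSinglePairs C) {s t : Word}
    (hsn : ∀ x ∈ s, x.2 = none) (htn : ∀ x ∈ t, x.2 = none) (hst : colorSum s = colorSum t) {u v : Word}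
    (h : C.Contains [] (u ++ (s ++ v))) : C.Contains [] (u ++ (t ++ v)) := by
  rw [hC.line_singles_iff hs t htn, ← hst]
  exact (hC.line_singles_iff hs s hsn u v).1 h

/-! ### Positioners -/

/-- The family contains the positioner that consists of `n` singletons, followed by a pair of colors
`a`, `b` around so many singletons that the color sum is zero. -/
def HasPositioner (C : Family) (a b : Color) (n : ℤ) : Prop := ∀ z : ℕ,
  C.Contains [] (singles n ++ (a, some z) :: (singles (-n - a.sign - b.sign) ++ [(b, some z)]))

/-- Conjugation of a point by singletons. -/
theorem IsCategory.line_conjugate (hC : IsCategory C) {a : Color} {X : Option ℕ} {n : ℤ}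
    (hp : HasPositioner C a a.inv n) {u v : Word} (h : C.Contains [] (u ++ (a, X) :: v)) :
    C.Contains [] (u ++ (singles n ++ (a, X) :: (singles (-n) ++ v))) := by
  obtain ⟨z, hz⟩ := exists_not_occurs (u ++ (a, X) :: v)
  have e : -n - a.sign - a.inv.sign = -n := by rw [Color.sign_inv]; ring
  have h1 := hC.line_insert h (hp z) (by
    simp only [occurs_append, occurs_cons, not_occurs_singles, occurs_nil, or_false, or_self,
      Option.some.injEq, false_or] at hz ⊢
    rintro _ rfl; exact hz)
  rw [e] at h1
  simp only [occurs_append, occurs_cons, not_or] at hz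
  have h2 := hC.line_rotate (u := u ++ (singles n ++ (a, some z) :: singles (-n)))
    (v := (a.inv, some z) :: (a, X) :: v) (by simpa using h1)
  have h3 := hC.contains_contract (X := X) (z := z) (a := a.inv) (P := some z) (Q := X)
    (U := []) (D := v ++ (u ++ (singles n ++ (a, some z) :: singles (-n)))) (Or.inr ⟨rfl, rfl⟩)
    hz.2.1 (by
      have e1 := count_eq_zero_of_not_occurs hz.1
      have e2 := count_eq_zero_of_not_occurs hz.2.2
      have e3 := count_eq_zero_of_not_occurs (not_occurs_singles z n)
      have e4 := count_eq_zero_of_not_occurs (not_occurs_singles z (-n))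
      simp only [List.nil_append, List.map_append, List.map_cons, List.count_append,
        List.count_cons, e1, e2, e3, e4]
      simp) (by simpa [Color.inv_inv] using h2)
  have h4 := hC.line_rotate (u := v) (v := u ++ (singles n ++ (a, X) :: singles (-n))) (by
    simpa [relabel_of_not_occurs, hz.1, hz.2.2] using h3)
  simpa using h4

/-- The left leg of a positioner is conjugated by singletons. -/
theorem HasPositioner.add (hC : IsCategory C) (hs : HasSinglePairs C) {a b : Color} {m n : ℤ}
    (hm : HasPositioner C a a.inv m) (hn : HasPositioner C a b n) : HasPositioner C a b (n + m) := by
  intro z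
  have h1 := hC.line_conjugate hm (hn z)
  have h2 := hC.line_exchange hs (s := singles n ++ singles m) (t := singles (n + m)) (u := [])
    (v := (a, some z) :: (singles (-m) ++ (singles (-n - a.sign - b.sign) ++ [(b, some z)])))
    (label_of_mem_append (fun _ => label_of_mem_singles) fun _ => label_of_mem_singles)
    (fun _ => label_of_mem_singles) (by simp) (by simpa using h1)
  have h3 := hC.line_exchange hs (s := singles (-m) ++ singles (-n - a.sign - b.sign))
    (t := singles (-(n + m) - a.sign - b.sign)) (u := singles (n + m) ++ [(a, some z)])
    (v := [(b, some z)])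
    (label_of_mem_append (fun _ => label_of_mem_singles) fun _ => label_of_mem_singles)
    (fun _ => label_of_mem_singles) (by simp; ring) (by simpa using h2)
  simpa using h3

/-- The reflected positioner. -/
theorem HasPositioner.neg (hC : IsCategory C) (hs : HasSinglePairs C) {a b : Color} {n : ℤ}
    (hn : HasPositioner C a b n) : HasPositioner C b.inv a.inv (-n) := by
  intro z
  have h1 := hC.line_rotate (u := (b.inv, some z) :: (invWord (singles (-n - a.sign - b.sign)) ++
    [(a.inv, some z)])) (v := invWord (singles n)) (by simpa using hC.line_invWord (hn z))
  have h2 := hC.line_exchange hs (s := invWord (singles n)) (t := singles (-n)) (u := [])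
    (label_of_mem_invWord fun _ => label_of_mem_singles) (fun _ => label_of_mem_singles)
    (by simp [colorSum_invWord]) h1
  have h3 := hC.line_exchange hs (s := invWord (singles (-n - a.sign - b.sign)))
    (t := singles (- -n - b.inv.sign - a.inv.sign)) (u := singles (-n) ++ [(b.inv, some z)])
    (v := [(a.inv, some z)])
    (label_of_mem_invWord fun _ => label_of_mem_singles) (fun _ => label_of_mem_singles)
    (by simp [colorSum_invWord, Color.sign_inv]; ring) (by simpa using h2)
  simpa using h3

/-- The rotated positioner. -/
theorem HasPositioner.rotate (hC : IsCategory C) {a b : Color} {n : ℤ} (hn : HasPositioner C a b n) :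
    HasPositioner C b a (-n - a.sign - b.sign) := by
  intro z
  have h1 := hC.line_rotate (u := singles n ++ [(a, some z)])
    (v := singles (-n - a.sign - b.sign) ++ [(b, some z)]) (by simpa using hn z)
  have e : -(-n - a.sign - b.sign) - b.sign - a.sign = n := by ring
  rw [e]
  simpa using h1

end

/-! ### The generators as words -/

section

variable {C : Family}

theorem IsCategory.hasPositioner_zero (hC : IsCategory C) (a : Color) : HasPositioner C a a.inv 0 := by
  intro z
  have e : -0 - a.sign - a.inv.sign = 0 := by rw [Color.sign_inv]; ring
  rw [e]
  exact hC.contains_pair a z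

/-- The basic positioner generates those for all multiples of `d`; rotation interchanges the colors. -/
theorem HasPositioner.mul (hC : IsCategory C) (hs : HasSinglePairs C) {d : ℤ}
    (h : HasPositioner C .white .black d) (a : Color) (t : ℤ) : HasPositioner C a a.inv (d * t) := by
  have hwb : ∀ t : ℤ, HasPositioner C .white .black (d * t) := by
    have hnat : ∀ t : ℕ, HasPositioner C .white .black (d * t) := by
      intro t
      induction t with
      | zero => simpa [Color.inv] using hC.hasPositioner_zero .white
      | succ t ih =>
        have := HasPositioner.add hC hs (a := .white) (b := .black) h ih
        have e : d * (t : ℤ) + d = d * ((t + 1 : ℕ) : ℤ) := by push_cast; ring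
        rwa [e] at this
    intro t
    rcases Int.eq_nat_or_neg t with ⟨n, rfl | rfl⟩
    · exact hnat n
    · have := HasPositioner.neg hC hs (hnat n)
      rw [mul_neg]
      exact this
  cases a
  · exact hwb t
  · have := HasPositioner.rotate hC (hwb (-t))
    have e : -(d * -t) - Color.white.sign - Color.black.sign = d * t := by
      simp only [Color.sign]; ring
    rwa [e] at this

theorem signColor_get {s : ℤ} (i : Fin (singles s).length) : (singles s).get i = (signColor s, none) :=
  List.eq_of_mem_replicate (List.get_mem _ _)

theorem contains_singletons {s : ℤ} (h : singletons s ∈ C 0 s.natAbs) : C.Contains [] (singles s) := by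
  refine Family.contains_of_mem h rfl (by simp [singles]) (fun i => i.elim0) (fun i => ?_) ?_
  · rw [signColor_get]; rfl
  · rintro (a | a) (b | b)
    · exact a.elim0
    · exact a.elim0
    · exact b.elim0
    · rw [singletons_rel]
      simp [rowLabels, singles]

theorem contains_singletonWB (hC : IsCategory C) (h : singletonWB ∈ C 0 2) : HasSinglePairs C := by
  have hwb : C.Contains [] [(.white, none), (.black, none)] := by
    refine Family.contains_of_mem h rfl rfl (fun i => i.elim0) (fun i => ?_) ?_
    · fin_cases i <;> rfl
    · rintro (a | a) (b | b)
      · exact a.elim0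
      · exact a.elim0
      · exact b.elim0
      · refine ⟨fun h => Or.inl (singletonWB_discrete _ _ h), ?_⟩
        rintro (h | ⟨-, h⟩)
        · rw [h]
        · exfalso
          revert h
          fin_cases a <;> simp [rowLabels]
  rintro (_ | _)
  · exact hwb
  · exact hC.line_rotate_one hwb

theorem contains_singletonsAround {s t : ℤ} {a b : Color}
    (h : singletonsAround s a t b ∈ C 0 (s.natAbs + (t.natAbs + 1 + 1))) (z : ℕ) :
    C.Contains [] (singles s ++ (a, some z) :: (singles t ++ [(b, some z)])) := by
  have hlen : s.natAbs + (t.natAbs + 1 + 1) =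
      (singles s ++ (a, some z) :: (singles t ++ [(b, some z)])).length := by
    simp [singles]
  have hget : ∀ i : Fin (s.natAbs + (t.natAbs + 1 + 1)),
      (singles s ++ (a, some z) :: (singles t ++ [(b, some z)])).get (Fin.cast hlen i) =
      ((singletonsAround s a t b).lo i,
        if i = Fin.natAdd _ 0 ∨ i = Fin.natAdd _ (Fin.last _) then some z else none) := by
    have h1 : ∀ i, (singletonsAround s a t b).lo (Fin.castAdd _ i) = signColor s :=
      fun i => Fin.append_left _ _ _
    have h2 : ∀ i, (singletonsAround s a t b).lo (Fin.natAdd _ i) = (around a (singletons t) b).lo i :=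
      fun i => Fin.append_right _ _ _
    have h3 : (around a (singletons t) b).lo (Fin.succ (Fin.last _)) = b := by simp [around]
    have h4 : ∀ i : Fin t.natAbs, (around a (singletons t) b).lo i.castSucc.succ = signColor t := by
      intro i; simp [around, singletons]
    have h5 : ∀ (u : ℤ) (i : ℕ) (h : i < (singles u).length), (singles u)[i] = (signColor u, none) :=
      fun u i h => List.eq_of_mem_replicate (List.getElem_mem _)
    have h6 : ∀ u : ℤ, (singles u).length = u.natAbs := fun u => List.length_replicate
    refine Fin.addCases (fun i => ?_) (Fin.cases ?_ (Fin.lastCases ?_ fun i => ?_))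
    · have e := i.isLt
      rw [h1, if_neg (by simp only [Fin.ext_iff, Fin.val_castAdd, Fin.val_natAdd]; simp; omega)]
      simp only [List.get_eq_getElem, Fin.val_cast, Fin.val_castAdd]
      rw [List.getElem_append_left (by rw [h6]; exact e), h5]
    · rw [h2, if_pos (Or.inl rfl)]
      simp [List.getElem_append_right, h6, around]
    · rw [h2, if_pos (Or.inr (by rw [Fin.succ_last])), h3]
      simp [List.getElem_append_right, h6]
    · have e := i.isLt
      rw [h2, h4, if_neg (by simp only [Fin.ext_iff, Fin.val_natAdd]; simp; omega)]
      simp only [List.get_eq_getElem, Fin.val_cast, Fin.val_natAdd]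
      rw [List.getElem_append_right (by rw [h6]; omega)]
      simp [h6, h5, List.getElem_append_left]
  refine Family.contains_of_mem h rfl hlen (fun i => i.elim0) (fun i => ?_) ?_
  · rw [hget]
  · rintro (x | x) (y | y)
    · exact x.elim0
    · exact x.elim0
    · exact y.elim0
    · rw [singletonsAround_rel_iff]
      simp only [rowLabels, Sum.map_inr, Sum.elim_inr, hget, Sum.inr.injEq]
      split_ifs with h1 h2 h2
      · refine iff_of_true ?_ (Or.inr (by simp))
        rcases h1 with rfl | rfl <;> rcases h2 with rfl | rfl <;> simp
      all_goals
        simp only [reduceCtorEq, ne_eq, not_true_eq_false, and_false, false_and, or_false]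
        tauto

end

/-! ### Words that satisfy the nest condition -/

/-- The words that describe noncrossing partitions with blocks of size one or two, in which singletons
have no label, the total color sum is divisible by `k`, and the colors `a`, `b` of each pair and the
color sum of the points outside of the pair satisfy `cond`. -/
structure NestedWord (k : ℕ) (cond : Color → Color → ℤ → Prop) (w : Word) : Prop where
  total : (k : ℤ) ∣ colorSum w
  cond : ∀ A s B a b x, w = A ++ (a, some x) :: (s ++ (b, some x) :: B) → cond a b (colorSum (B ++ A))
  pair : ∀ A s B a b x, w = A ++ (a, some x) :: (s ++ (b, some x) :: B) →
    ¬ Occurs x A ∧ ¬ Occurs x s ∧ ¬ Occurs x B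
  noncrossing : ∀ A s B a b x, w = A ++ (a, some x) :: (s ++ (b, some x) :: B) →
    ∀ y, Occurs y s → ¬ Occurs y A ∧ ¬ Occurs y B
  twice : ∀ A B a x, w = A ++ (a, some x) :: B → Occurs x A ∨ Occurs x B

theorem Occurs.exists_append {x : ℕ} {w : Word} (h : Occurs x w) :
    ∃ A a B, w = A ++ (a, some x) :: B := by
  obtain ⟨⟨a, l⟩, hp, hl⟩ := List.mem_map.1 h
  obtain rfl : l = some x := hl
  obtain ⟨A, B, e⟩ := List.append_of_mem hp
  exact ⟨A, a, B, e⟩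

theorem occurs_relabel_none {x y : ℕ} {w : Word} :
    Occurs y (relabel x none w) ↔ Occurs y w ∧ y ≠ x := by
  induction w with
  | nil => simp
  | cons p w ih =>
    rw [relabel_cons, occurs_cons, occurs_cons, ih]
    by_cases h : p.2 = some x
    · simp only [h, if_true, reduceCtorEq, false_or, Option.some.injEq]
      grind
    · simp only [h, if_false]
      grind

theorem relabel_none_eq_append {x y : ℕ} {w A B : Word} {a : Color}
    (h : relabel x none w = A ++ (a, some y) :: B) : y ≠ x ∧ ∃ A' B', w = A' ++ (a, some y) :: B' ∧
      A = relabel x none A' ∧ B = relabel x none B' := by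
  obtain ⟨A', w', rfl, hA, hw⟩ := List.map_eq_append_iff.1 h
  obtain ⟨p, B', rfl, hp, hB⟩ := List.map_eq_cons_iff.1 hw
  obtain ⟨c, l⟩ := p
  simp only [Prod.mk.injEq] at hp
  obtain ⟨rfl, hl⟩ := hp
  split_ifs at hl with hx
  subst hl
  exact ⟨fun e => hx (by rw [e]), A', B', rfl, hA.symm, hB.symm⟩

variable {k : ℕ} {cond : Color → Color → ℤ → Prop}

/-- A pair may be cut into two singletons. -/
theorem NestedWord.cut {w : Word} (h : NestedWord k cond w) (x : ℕ) :
    NestedWord k cond (relabel x none w) := by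
  have lift : ∀ {A s B a b y}, relabel x none w = A ++ (a, some y) :: (s ++ (b, some y) :: B) →
      y ≠ x ∧ ∃ A' s' B', w = A' ++ (a, some y) :: (s' ++ (b, some y) :: B') ∧
        A = relabel x none A' ∧ s = relabel x none s' ∧ B = relabel x none B' := by
    intro A s B a b y e
    obtain ⟨hy, A', t, rfl, rfl, e'⟩ := relabel_none_eq_append e
    obtain ⟨-, s', B', rfl, rfl, rfl⟩ := relabel_none_eq_append e'.symm
    exact ⟨hy, A', s', B', rfl, rfl, rfl, rfl⟩
  refine ⟨by rw [colorSum_relabel]; exact h.total, ?_, ?_, ?_, ?_⟩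
  · intro A s B a b y e
    obtain ⟨hy, A', s', B', e', rfl, rfl, rfl⟩ := lift e
    rw [← relabel_append, colorSum_relabel]
    exact h.cond _ _ _ _ _ _ e'
  · intro A s B a b y e
    obtain ⟨hy, A', s', B', e', rfl, rfl, rfl⟩ := lift e
    have := h.pair _ _ _ _ _ _ e'
    simp only [occurs_relabel_none]
    tauto
  · intro A s B a b y e u hu
    obtain ⟨hy, A', s', B', e', rfl, rfl, rfl⟩ := lift e
    simp only [occurs_relabel_none] at hu ⊢
    have := h.noncrossing _ _ _ _ _ _ e' u hu.1
    tauto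
  · intro A B a y e
    obtain ⟨hy, A', B', e', rfl, rfl⟩ := relabel_none_eq_append e
    simp only [occurs_relabel_none]
    have := h.twice _ _ _ _ e'
    tauto

/-- There is an innermost pair inside each pair. -/
theorem NestedWord.exists_innermost {w : Word} (h : NestedWord k cond w) (n : ℕ) :
    ∀ A s B a b x, s.length ≤ n → w = A ++ (a, some x) :: (s ++ (b, some x) :: B) →
      ∃ A s B a b x, w = A ++ (a, some x) :: (s ++ (b, some x) :: B) ∧ ∀ y ∈ s, y.2 = none := by
  induction n with
  | zero =>
    intro A s B a b x hs e
    obtain rfl : s = [] := List.length_eq_zero_iff.1 (Nat.le_zero.1 hs)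
    exact ⟨A, [], B, a, b, x, e, by simp⟩
  | succ n ih =>
    intro A s B a b x hs e
    by_cases hn : ∀ y ∈ s, y.2 = none
    · exact ⟨A, s, B, a, b, x, e, hn⟩
    · push Not at hn
      obtain ⟨⟨c, l⟩, hl, hne⟩ := hn
      obtain ⟨y, rfl⟩ := Option.ne_none_iff_exists'.1 hne
      obtain ⟨s₁, s₂, rfl⟩ := List.append_of_mem hl
      have h1 := h.noncrossing _ _ _ _ _ _ e y (by simp)
      have h2 := h.pair _ _ _ _ _ _ e
      have hyx : y ≠ x := by rintro rfl; simp at h2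
      have h3 := h.twice (A ++ (a, some x) :: s₁) (s₂ ++ (b, some x) :: B) c y (by rw [e]; simp)
      simp only [occurs_append, occurs_cons, Option.some.injEq, hyx.symm, h1.1, h1.2, false_or,
        or_false] at h3
      rcases h3 with h3 | h3
      · obtain ⟨t₁, c', t₂, rfl⟩ := h3.exists_append
        refine ih (A ++ (a, some x) :: t₁) t₂ (s₂ ++ (b, some x) :: B) c' c y ?_ (by rw [e]; simp)
        simp at hs; omega
      · obtain ⟨t₁, c', t₂, rfl⟩ := h3.exists_append
        refine ih (A ++ (a, some x) :: s₁) t₁ (t₂ ++ (b, some x) :: B) c c' y ?_ (by rw [e]; simp)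
        simp at hs; omega

/-- A category that contains the positioners allowed by `cond` contains all nested words: an innermost
pair is cut into two singletons, and it is put back by means of a positioner. -/
theorem NestedWord.contains {C : Family} (hC : IsCategory C) (hs : HasSinglePairs C)
    (hk : C.Contains [] (singles k)) (hpos : ∀ a b n, cond a b n → HasPositioner C a b n) {w : Word}
    (h : NestedWord k cond w) : C.Contains [] w := by
  have hkt : ∀ t : ℤ, C.Contains [] (singles (k * t)) := by
    have hnat : ∀ t : ℕ, C.Contains [] (singles (k * t)) := by
      intro t
      induction t with
      | zero => simpa [singles] using hC.contains_nil
      | succ t ih =>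
        have h1 := hC.contains_tensor ih hk (by simp)
        have h2 := hC.line_exchange hs (s := singles (k * t) ++ singles k)
          (t := singles (k * ((t + 1 : ℕ) : ℤ))) (u := []) (v := [])
          (label_of_mem_append (fun _ => label_of_mem_singles) fun _ => label_of_mem_singles)
          (fun _ => label_of_mem_singles) (by simp; ring) (by simpa using h1)
        simpa using h2
    intro t
    rcases Int.eq_nat_or_neg t with ⟨n, rfl | rfl⟩
    · exact hnat n
    · have h2 := hC.line_exchange hs (s := invWord (singles (k * (n : ℤ))))
        (t := singles (k * -(n : ℤ))) (u := []) (v := [])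
        (label_of_mem_invWord fun _ => label_of_mem_singles)
        (fun _ => label_of_mem_singles) (by simp [colorSum_invWord])
        (by simpa using hC.line_invWord (hnat n))
      simpa using h2
  induction hN : w.countP (fun x => x.2.isSome) using Nat.strong_induction_on generalizing w with
  | _ N ih =>
    by_cases hn : ∀ x ∈ w, x.2 = none
    · obtain ⟨t, ht⟩ := h.total
      have := hC.line_exchange hs (s := singles (k * t)) (t := w) (u := []) (v := [])
        (fun _ => label_of_mem_singles) hn (by simp [ht]) (by simpa using hkt t)
      simpa using this
    · obtain ⟨A, s, B, a, b, x, e, hsn⟩ : ∃ A s B a b x,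
          w = A ++ (a, some x) :: (s ++ (b, some x) :: B) ∧ ∀ y ∈ s, y.2 = none := by
        push Not at hn
        obtain ⟨⟨c, l⟩, hl, hne⟩ := hn
        obtain ⟨y, rfl⟩ := Option.ne_none_iff_exists'.1 hne
        obtain ⟨s₁, s₂, e⟩ := List.append_of_mem hl
        rcases h.twice _ _ _ _ e with h3 | h3
        · obtain ⟨t₁, c', t₂, rfl⟩ := h3.exists_append
          exact h.exists_innermost _ t₁ t₂ s₂ c' c y le_rfl (by rw [e]; simp)
        · obtain ⟨t₁, c', t₂, rfl⟩ := h3.exists_append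
          exact h.exists_innermost _ s₁ t₁ t₂ c c' y le_rfl (by rw [e])
      obtain ⟨hA, hsx, hB⟩ := h.pair _ _ _ _ _ _ e
      have hp := hpos _ _ _ (h.cond _ _ _ _ _ _ e)
      obtain ⟨t, ht⟩ := h.total
      -- the word with the pair cut into two singletons
      have hcut : relabel x none w = A ++ (a, none) :: (s ++ (b, none) :: B) := by
        simp [e, relabel_of_not_occurs, hA, hsx, hB]
      have h0 := ih _ (by
        rw [← hN, hcut, e]
        simp) (h.cut x) rfl
      rw [hcut] at h0
      rw [e] at ht ⊢
      simp only [colorSum_append, colorSum_cons] at ht hp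
      set n := colorSum B + colorSum A with hn
      have h1 := hC.line_exchange hs (s := (a, none) :: (s ++ [(b, none)]))
        (t := singles (a.sign + colorSum s + b.sign)) (u := A) (v := B)
        (by
          intro y hy
          simp only [List.mem_cons, List.mem_append, List.not_mem_nil, or_false] at hy
          rcases hy with rfl | hy | rfl
          exacts [rfl, hsn y hy, rfl])
        (fun _ => label_of_mem_singles) (by simp; ring) (by simpa using h0)
      -- the positioner, completed to a word of the same color sum as the pair that was cut
      have h2 := hC.line_insert (u := singles n ++ [(a, some x)])
        (v := singles (-n - a.sign - b.sign) ++ [(b, some x)]) (by simpa using hp x) (hkt t) (by simp)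
      have h3 := hC.line_exchange hs (s := singles (k * t) ++ singles (-n - a.sign - b.sign)) (t := s)
        (u := singles n ++ [(a, some x)]) (v := [(b, some x)])
        (label_of_mem_append (fun _ => label_of_mem_singles) fun _ => label_of_mem_singles) hsn
        (by simp; linear_combination -ht) (by simpa using h2)
      have h4 := hC.line_insert (u := []) (v := singles (k * -t)) (hkt (-t)) h3 (by simp)
      have h5 := hC.line_insert (u := A ++ singles (a.sign + colorSum s + b.sign)) (v := B)
        (by simpa using h1)
        (hC.line_rotate (u := singles n ++ [(a, some x)] ++ (s ++ [(b, some x)])) h4) (by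
          have hss : ∀ z, ¬ Occurs z s := not_occurs_of_labels hsn
          simp only [occurs_append, occurs_cons, occurs_nil, not_occurs_singles, or_false, false_or,
            Option.some.injEq, hss, or_self]
          rintro z rfl; tauto)
      have h6 := hC.line_exchange hs
        (s := singles (a.sign + colorSum s + b.sign) ++ (singles (k * -t) ++ singles n))
        (t := []) (u := A) (v := (a, some x) :: (s ++ (b, some x) :: B))
        (label_of_mem_append (fun _ => label_of_mem_singles)
          (label_of_mem_append (fun _ => label_of_mem_singles) fun _ => label_of_mem_singles))
        (by simp) (by simp; linear_combination ht) (by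
          simpa using h5)
      simpa using h6

/-! ### The word of a partition -/

theorem c_wordPartition (w : Word) : (wordPartition [] w).c = colorSum w := by
  have h := Fin.sum_univ_fun_getElem w (fun x : Color × Option ℕ => x.1.sign)
  simpa [c, wordPartition, colorSum] using h

theorem ColoredPartition.Rotated.c_eq {k l k' l' : ℕ} {p : ColoredPartition k l} {q : ColoredPartition k' l'}
    (hq : Rotated p q) : q.c = p.c := by
  induction hq with
  | refl => rfl
  | leftDown _ ih => rw [c_rotLeftDown, ih]
  | leftUp _ ih => rw [c_rotLeftUp, ih]
  | rightDown _ ih => rw [c_rotRightDown, ih]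
  | rightUp _ ih => rw [c_rotRightUp, ih]

/-- The rotated versions of a partition. -/
def rotations {k l : ℕ} (p : ColoredPartition k l) : Family := fun _ _ => {q | Rotated p q}

/-- The rotated versions of `p` are closed under rotating an upper point of a word to the lower row. -/
theorem rotations_leftDown {k l : ℕ} {p : ColoredPartition k l} {x : Color × Option ℕ} {U D : Word}
    (h : (rotations p).Contains (x :: U) D) : (rotations p).Contains U ((x.1.inv, x.2) :: D) := by
  refine Family.contains_of_mem (C := rotations p) (Rotated.leftDown h) rfl rfl (fun _ => rfl)
    (fun i => by refine Fin.cases ?_ (fun i => ?_) i <;> rfl) ?_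
  -- the point of the original partition from which a point of the rotated one comes
  let f : Fin U.length ⊕ Fin (D.length + 1) → Fin (U.length + 1) ⊕ Fin D.length :=
    Sum.elim (fun i => .inl i.succ) (Fin.cases (.inl 0) (fun j => .inr j))
  have hf : Function.Injective f := by
    rintro (a | a) (b | b)
    · simp [f]
    · refine Fin.cases ?_ (fun b => ?_) b
      · simp [f]
      · simp [f]
    · refine Fin.cases ?_ (fun a => ?_) a
      · simpa [f] using (Fin.succ_ne_zero b).symm
      · simp [f]
    · refine Fin.cases ?_ (fun a => ?_) a <;> refine Fin.cases ?_ (fun b => ?_) b <;> simp [f]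
  have hl : ∀ a, rowLabels (x :: U) D (f a) = rowLabels U ((x.1.inv, x.2) :: D) a := by
    rintro (a | a)
    · rfl
    · refine Fin.cases ?_ (fun a => ?_) a <;> rfl
  intro a b
  refine (labelSetoid_iff (rowLabels (x :: U) D) (f a) (f b)).trans ?_
  rw [hl, hl, hf.eq_iff]
  rcases a with a | a <;> rcases b with b | b <;> rfl

/-- The rotated versions of `p` are closed under cyclic permutations of a word on one line. -/
theorem rotations_rotate_one {k l : ℕ} {p : ColoredPartition k l} {x : Color × Option ℕ} {w : Word}
    (h : (rotations p).Contains [] (x :: w)) : (rotations p).Contains [] (w ++ [x]) := by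
  have hlen : w.length + 1 = (w ++ [x]).length := by simp
  have h1 : Rotated p (rotRightDown (k := 0) (l := w.length) (rotLeftUp (k := 0) (l := w.length)
    (wordPartition [] (x :: w)))) := Rotated.rightDown (Rotated.leftUp h)
  -- the point of the original row from which a point of the rotated row comes
  let f : Fin (w.length + 1) → Fin (w.length + 1) := Fin.lastCases 0 (fun j => j.succ)
  have hf : Function.Injective f := by
    intro a b
    refine Fin.lastCases ?_ (fun a => ?_) a <;> refine Fin.lastCases ?_ (fun b => ?_) b <;>
      simp [f, Fin.ext_iff]
  have hget : ∀ i, (w ++ [x]).get (Fin.cast hlen i) = (x :: w).get (f i) := by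
    intro i
    refine Fin.lastCases ?_ (fun i => ?_) i <;> simp [f]
  refine Family.contains_of_mem (C := rotations p) h1 rfl hlen (fun i => i.elim0) (fun i => ?_) ?_
  · rw [hget]
    refine Fin.lastCases ?_ (fun i => ?_) i
    · simp [f, rotRightDown, rotLeftUp, wordPartition, Color.inv_inv]
    · simp [f, rotRightDown, rotLeftUp, wordPartition]
  · rintro (a | a) (b | b)
    · exact a.elim0
    · exact a.elim0
    · exact b.elim0
    · -- the same map, computed from the two rotations
      let g : Fin 0 ⊕ Fin (w.length + 1) → Fin 0 ⊕ Fin (w.length + 1) := fun y =>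
        Sum.elim (Fin.cases (motive := fun _ => Fin 0 ⊕ Fin (w.length + 1)) (.inr 0) (fun i => .inl i))
          (fun j : Fin w.length => .inr j.succ)
          (Sum.elim (fun i : Fin 0 => Sum.inl i.castSucc)
            (Fin.lastCases (motive := fun _ => Fin 1 ⊕ Fin w.length) (.inl (Fin.last 0))
              (fun j => .inr j)) y)
      have hg : ∀ i, g (.inr i) = .inr (f i) := by
        intro i
        refine Fin.lastCases ?_ (fun i => ?_) i
        · simp [f, g]
        · simp [f, g]
      have key : (rotRightDown (k := 0) (l := w.length) (rotLeftUp (k := 0) (l := w.length)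
          (wordPartition [] (x :: w)))).rel (.inr a) (.inr b) ↔
          labelSetoid (rowLabels [] (x :: w)) (.inr (f a)) (.inr (f b)) := by
        rw [← hg, ← hg]
        exact Iff.rfl
      rw [key, labelSetoid_iff]
      refine or_congr ?_ ?_
      · simp [hf.eq_iff]
      · simp only [rowLabels, Sum.elim_inr, Sum.map_inr, hget]

/-- A partition on one line can be regarded as one with an equal number of points. -/
theorem exists_cast {n n' : ℕ} (h : n = n') (q : ColoredPartition 0 n) : ∃ q' : ColoredPartition 0 n',
    (∀ i, q'.lo i = q.lo (Fin.cast h.symm i)) ∧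
    (∀ i j, q'.rel (.inr i) (.inr j) ↔ q.rel (.inr (Fin.cast h.symm i)) (.inr (Fin.cast h.symm j))) ∧
    ∀ (F : Family) {m : ℕ} (p₁ : ColoredPartition 0 m), p₁.tensor q ∈ F _ _ → p₁.tensor q' ∈ F _ _ := by
  subst h
  exact ⟨q, fun _ => rfl, fun _ _ => Iff.rfl, fun _ _ _ h => h⟩

/-- If a pair of a rotated version ends the line and encloses only points of blocks that lie between its
legs, then the rotated version has the form `p₁ ⊗ p₂` of the nest condition. -/
theorem exists_rotated_tensor {k l : ℕ} {p : ColoredPartition k l} {A s : Word} {a b : Color} {x : ℕ}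
    (h : (rotations p).Contains [] (A ++ (a, some x) :: (s ++ [(b, some x)]))) (hx : ¬ Occurs x A)
    (hs : ∀ y, Occurs y s → ¬ Occurs y A) :
    ∃ (p₁ : ColoredPartition 0 A.length) (p₂ : ColoredPartition 0 (s.length + 2)),
      Rotated p (p₁.tensor p₂) ∧ EndsConnected p₂ ∧ p₂.lo 0 = a ∧ p₂.lo (Fin.last (s.length + 1)) = b ∧
      p₁.c = colorSum A := by
  have h1 := (Family.tensor_mem_iff_contains (rotations p) (U := []) (U' := []) (D := A)
    (D' := (a, some x) :: (s ++ [(b, some x)])) (by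
      intro z hz hz'
      simp only [List.nil_append, occurs_append, occurs_cons, occurs_nil, Option.some.injEq,
        or_false] at hz hz'
      rcases hz' with rfl | hz' | rfl
      exacts [hx hz, hs z hz' hz, hx hz])).2 h
  have hlen : ((a, some x) :: (s ++ [(b, some x)])).length = s.length + 2 := by simp
  obtain ⟨q, hq1, hq2, hq3⟩ := exists_cast hlen (wordPartition [] ((a, some x) :: (s ++ [(b, some x)])))
  have e1 : ((a, some x) :: (s ++ [(b, some x)])).get (Fin.cast hlen.symm 0) = (a, some x) := rfl
  have e2 : ((a, some x) :: (s ++ [(b, some x)])).get (Fin.cast hlen.symm (Fin.last _)) = (b, some x) := by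
    simp
  refine ⟨_, q, hq3 _ _ h1, ?_, ?_, ?_, c_wordPartition A⟩
  · refine (hq2 _ _).2 (Or.inr ⟨?_, ?_⟩)
    · simp only [rowLabels, Sum.elim_inr, e1, e2]
    · simp only [rowLabels, Sum.elim_inr, e1]; simp
  · rw [hq1]; exact congrArg Prod.fst e1
  · rw [hq1]; exact congrArg Prod.fst e2

open Classical in
/-- Every partition is given by labels, where singletons receive no label. -/
theorem exists_labels {k l : ℕ} (p : ColoredPartition k l) : ∃ lab : Fin k ⊕ Fin l → Option ℕ,
    (∀ a b, p.rel a b ↔ a = b ∨ (lab a = lab b ∧ lab a ≠ none)) ∧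
    (∀ a, lab a ≠ none → ∃ b, b ≠ a ∧ p.rel a b) := by
  obtain ⟨e, he⟩ := Countable.exists_injective_nat (Quotient p.rel)
  refine ⟨fun a => if ∃ b, b ≠ a ∧ p.rel a b then some (e (Quotient.mk _ a)) else none, ?_, ?_⟩
  · intro a b
    constructor
    · intro h
      by_cases hab : a = b
      · exact Or.inl hab
      · have h1 : ∃ c, c ≠ a ∧ p.rel a c := ⟨b, Ne.symm hab, h⟩
        have h2 : ∃ c, c ≠ b ∧ p.rel b c := ⟨a, hab, p.rel.symm h⟩
        right
        beta_reduce
        rw [if_pos h1, if_pos h2]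
        exact ⟨by rw [Quotient.sound h], by simp⟩
    · rintro (rfl | ⟨h, h'⟩)
      · exact p.rel.refl _
      · beta_reduce at h h'
        split_ifs at h h' with h1 h2
        · exact Quotient.exact (he (Option.some.inj h))
        · exact absurd rfl h'
  · intro a h
    by_contra h1
    beta_reduce at h
    rw [if_neg h1] at h
    exact h rfl

section

variable {k l : ℕ} (p : ColoredPartition k l) (lab : Fin k ⊕ Fin l → Option ℕ)

/-- The upper row with labels. -/
def upperWord : Word := List.ofFn fun i => (p.up i, lab (.inl i))

/-- The lower row with labels. -/
def lowerWord : Word := List.ofFn fun j => (p.lo j, lab (.inr j))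

/-- The boundary with labels, read along one line. -/
def boundaryWord : Word := invWord (upperWord p lab) ++ lowerWord p lab

/-- A partition is given by the words of its rows. -/
theorem mem_iff_contains_words (hlab : ∀ a b, p.rel a b ↔ a = b ∨ (lab a = lab b ∧ lab a ≠ none))
    (F : Family) : p ∈ F k l ↔ F.Contains (upperWord p lab) (lowerWord p lab) := by
  have hl : ∀ a, rowLabels (upperWord p lab) (lowerWord p lab)
      (Sum.map (Fin.cast (by simp [upperWord])) (Fin.cast (by simp [lowerWord])) a) = lab a := by
    rintro (a | a) <;> simp [rowLabels, upperWord, lowerWord] <;> rfl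
  refine Family.mem_iff_contains F (by simp [upperWord]) (by simp [lowerWord])
    (fun i => by simp [upperWord]; rfl) (fun i => by simp [lowerWord]; rfl) fun a b => ?_
  rw [hl, hl]
  exact hlab a b

theorem length_boundaryWord : (boundaryWord p lab).length = k + l := by
  simp [boundaryWord, invWord, upperWord, lowerWord]

theorem getElem?_boundaryWord (a : Fin k ⊕ Fin l) :
    (boundaryWord p lab)[place a]? = some (p.boundaryColor a, lab a) := by
  have hlen : (invWord (upperWord p lab)).length = k := by simp [invWord, upperWord]
  rcases a with ⟨i, hi⟩ | ⟨i, hi⟩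
  · rw [place_inl, boundaryWord, List.getElem?_append_left (by rw [hlen]; simp; omega)]
    have e : k - 1 - (k - 1 - i) = i := by omega
    simp only [invWord]
    rw [List.getElem?_reverse (by simp [upperWord]; omega)]
    simp [upperWord, boundaryColor, e, hi]
  · rw [place_inr, boundaryWord, List.getElem?_append_right (by rw [hlen]; simp)]
    simp [hlen, lowerWord, boundaryColor, hi]

theorem exists_place {t : ℕ} (ht : t < k + l) : ∃ a : Fin k ⊕ Fin l, place a = t := by
  by_cases h : t < k
  · exact ⟨.inl ⟨k - 1 - t, by omega⟩, by rw [place_inl]; simp; omega⟩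
  · exact ⟨.inr ⟨t - k, by omega⟩, by rw [place_inr]; simp; omega⟩

theorem exists_of_getElem?_boundaryWord {t : ℕ} {c : Color} {y : Option ℕ}
    (h : (boundaryWord p lab)[t]? = some (c, y)) : ∃ a, place a = t ∧ lab a = y := by
  obtain ⟨a, ha⟩ := exists_place (k := k) (l := l) (t := t) (by
    rw [← length_boundaryWord p lab]
    exact (List.getElem?_eq_some_iff.1 h).1)
  have := getElem?_boundaryWord p lab a
  rw [ha, h] at this
  exact ⟨a, ha, by simpa using (congrArg Prod.snd (Option.some.inj this)).symm⟩

end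

theorem Occurs.exists_getElem? {y : ℕ} {w : Word} (h : Occurs y w) :
    ∃ t c, t < w.length ∧ w[t]? = some (c, some y) := by
  obtain ⟨A, c, B, rfl⟩ := h.exists_append
  exact ⟨A.length, c, by simp, by simp⟩

theorem occurs_of_getElem? {y t : ℕ} {w : Word} {c : Color} (h : w[t]? = some (c, some y)) :
    Occurs y w := List.mem_map.2 ⟨_, List.mem_of_getElem? h, rfl⟩

theorem eq_of_blocksOneOrTwo {k l : ℕ} {p : ColoredPartition k l} (hp : p.BlocksOneOrTwo)
    {a b c : Fin k ⊕ Fin l} (hab : p.rel a b) (hac : p.rel a c) : a = b ∨ a = c ∨ b = c := by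
  by_contra! h
  have h1 : ({a, b, c} : Set (Fin k ⊕ Fin l)).ncard ≤ {x | p.rel x a}.ncard := by
    refine Set.ncard_le_ncard ?_ (Set.toFinite _)
    rintro x (rfl | rfl | rfl)
    exacts [p.rel.refl _, p.rel.symm hab, p.rel.symm hac]
  have h2 : ({a, b, c} : Set (Fin k ⊕ Fin l)).ncard = 3 :=
    Set.ncard_eq_three.2 ⟨a, b, c, h.1, h.2.1, h.2.2, rfl⟩
  have := hp _ ⟨a, rfl⟩
  omega

/-! ### Partitions that satisfy the nest condition -/

section

variable {k l : ℕ} {p : ColoredPartition k l} {lab : Fin k ⊕ Fin l → Option ℕ}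

theorem contains_boundaryWord (hlab : ∀ a b, p.rel a b ↔ a = b ∨ (lab a = lab b ∧ lab a ≠ none)) :
    (rotations p).Contains [] (boundaryWord p lab) :=
  Family.line_of_contains (fun _ _ _ => rotations_leftDown)
    ((mem_iff_contains_words p lab hlab (rotations p)).1 Rotated.refl)

theorem colorSum_eq_of_contains {w : Word} (h : (rotations p).Contains [] w) : colorSum w = p.c := by
  rw [← c_wordPartition]
  exact Rotated.c_eq h

/-- The boundary word is nested if `cond` holds for each pair that is moved to the end of the word by a
rotation. -/
theorem nestedWord_boundaryWord {K : ℕ} {cond : Color → Color → ℤ → Prop} (hnc : p.IsNoncrossing)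
    (hb : p.BlocksOneOrTwo) (hc : (K : ℤ) ∣ p.c)
    (hlab : ∀ a b, p.rel a b ↔ a = b ∨ (lab a = lab b ∧ lab a ≠ none))
    (hlab' : ∀ a, lab a ≠ none → ∃ b, b ≠ a ∧ p.rel a b)
    (hcond : ∀ A s a b x, (rotations p).Contains [] (A ++ (a, some x) :: (s ++ [(b, some x)])) →
      ¬ Occurs x A → ¬ Occurs x s → (∀ y, Occurs y s → ¬ Occurs y A) → cond a b (colorSum A)) :
    NestedWord K cond (boundaryWord p lab) := by
  set W := boundaryWord p lab with hW
  have hrel : ∀ {α β x}, lab α = some x → lab β = some x → p.rel α β := fun h1 h2 =>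
    (hlab _ _).2 (Or.inr ⟨h1.trans h2.symm, by simp [h1]⟩)
  -- no label occurs at three places
  have three : ∀ {t₁ t₂ t₃ : ℕ} {c₁ c₂ c₃ : Color} {x : ℕ}, W[t₁]? = some (c₁, some x) → W[t₂]? = some (c₂, some x) →
      W[t₃]? = some (c₃, some x) → t₁ = t₂ ∨ t₁ = t₃ ∨ t₂ = t₃ := by
    intro t₁ t₂ t₃ c₁ c₂ c₃ x h1 h2 h3
    obtain ⟨α, rfl, hα⟩ := exists_of_getElem?_boundaryWord p lab h1
    obtain ⟨β, rfl, hβ⟩ := exists_of_getElem?_boundaryWord p lab h2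
    obtain ⟨γ, rfl, hγ⟩ := exists_of_getElem?_boundaryWord p lab h3
    rcases eq_of_blocksOneOrTwo hb (hrel hα hβ) (hrel hα hγ) with rfl | rfl | rfl <;> simp
  -- labels do not cross
  have cross : ∀ {t₁ t₂ t₃ t₄ : ℕ} {c₁ c₂ c₃ c₄ : Color} {x y : ℕ}, t₁ < t₂ → t₂ < t₃ → t₃ < t₄ →
      W[t₁]? = some (c₁, some x) → W[t₂]? = some (c₂, some y) →
      W[t₃]? = some (c₃, some x) → W[t₄]? = some (c₄, some y) → x = y := by
    intro t₁ t₂ t₃ t₄ c₁ c₂ c₃ c₄ x y h12 h23 h34 h1 h2 h3 h4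
    obtain ⟨α, rfl, hα⟩ := exists_of_getElem?_boundaryWord p lab h1
    obtain ⟨β, rfl, hβ⟩ := exists_of_getElem?_boundaryWord p lab h2
    obtain ⟨γ, rfl, hγ⟩ := exists_of_getElem?_boundaryWord p lab h3
    obtain ⟨δ, rfl, hδ⟩ := exists_of_getElem?_boundaryWord p lab h4
    rcases (hlab _ _).1 (hnc α β γ δ h12 h23 h34 (hrel hα hγ) (hrel hβ hδ)) with rfl | ⟨h, -⟩
    · exact absurd h12 (lt_irrefl _)
    · rw [hα, hβ] at h
      exact Option.some.inj h
  -- the letters of a word in which a pair has been singled out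
  have at_A : ∀ {A L : Word} {t : ℕ} {z}, A[t]? = some z → (A ++ L)[t]? = some z := by
    intro A L t z h
    rw [List.getElem?_append_left (List.getElem?_eq_some_iff.1 h).1, h]
  have at_L : ∀ (A L : Word) (t : ℕ), (A ++ L)[A.length + t]? = L[t]? := by
    intro A L t
    rw [List.getElem?_append_right (Nat.le_add_right _ _), Nat.add_sub_cancel_left]
  have at_a : ∀ (A L : Word) (z), (A ++ z :: L)[A.length]? = some z := by
    intro A L z; simp
  have at_s : ∀ {A s L : Word} {t : ℕ} {u z}, s[t]? = some z →
      (A ++ u :: (s ++ L))[A.length + (t + 1)]? = some z := by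
    intro A s L t u z h
    rw [at_L, List.getElem?_cons_succ, at_A h]
  have at_b : ∀ (A s L : Word) (u z),
      (A ++ u :: (s ++ z :: L))[A.length + (s.length + 1)]? = some z := by
    intro A s L u z
    rw [at_L, List.getElem?_cons_succ, at_a]
  have at_B : ∀ {A s B : Word} {t : ℕ} {u v z}, B[t]? = some z →
      (A ++ u :: (s ++ v :: B))[A.length + (s.length + (t + 1) + 1)]? = some z := by
    intro A s B t u v z h
    rw [at_L, List.getElem?_cons_succ, at_L, List.getElem?_cons_succ, h]
  have hpair : ∀ A s B a b x, W = A ++ (a, some x) :: (s ++ (b, some x) :: B) →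
      ¬ Occurs x A ∧ ¬ Occurs x s ∧ ¬ Occurs x B := by
    intro A s B a b x e
    have ha := at_a A (s ++ (b, some x) :: B) (a, some x)
    have hb := at_b A s B (a, some x) (b, some x)
    rw [← e] at ha hb
    refine ⟨fun h => ?_, fun h => ?_, fun h => ?_⟩ <;> obtain ⟨t, c, ht, hc⟩ := h.exists_getElem?
    · have h' := at_A (L := (a, some x) :: (s ++ (b, some x) :: B)) hc
      rw [← e] at h'
      rcases three ha hb h' with h | h | h <;> omega
    · have h' := at_s (A := A) (L := (b, some x) :: B) (u := (a, some x)) hc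
      rw [← e] at h'
      rcases three ha hb h' with h | h | h <;> omega
    · have h' := at_B (A := A) (s := s) (u := (a, some x)) (v := (b, some x)) hc
      rw [← e] at h'
      rcases three ha hb h' with h | h | h <;> omega
  have hcross : ∀ A s B a b x, W = A ++ (a, some x) :: (s ++ (b, some x) :: B) →
      ∀ y, Occurs y s → ¬ Occurs y A ∧ ¬ Occurs y B := by
    intro A s B a b x e y hy
    have hx := (hpair A s B a b x e).2.1
    have ha := at_a A (s ++ (b, some x) :: B) (a, some x)
    have hb := at_b A s B (a, some x) (b, some x)
    obtain ⟨t, c, ht, hc⟩ := hy.exists_getElem?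
    have hs := at_s (A := A) (L := (b, some x) :: B) (u := (a, some x)) hc
    rw [← e] at ha hb hs
    refine ⟨fun h => ?_, fun h => ?_⟩ <;> obtain ⟨t', c', ht', hc'⟩ := h.exists_getElem?
    · have h' := at_A (L := (a, some x) :: (s ++ (b, some x) :: B)) hc'
      rw [← e] at h'
      obtain rfl := cross ht' (by omega) (by omega) h' ha hs hb
      exact hx hy
    · have h' := at_B (A := A) (s := s) (u := (a, some x)) (v := (b, some x)) hc'
      rw [← e] at h'
      obtain rfl := cross (by omega) (by omega) (by omega) ha hs hb h'
      exact hx hy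
  refine ⟨?_, ?_, hpair, hcross, ?_⟩
  · rwa [colorSum_eq_of_contains (contains_boundaryWord hlab)]
  · intro A s B a b x e
    obtain ⟨h1, h2, h3⟩ := hpair A s B a b x e
    have h4 := Family.line_rotate (u := A ++ (a, some x) :: (s ++ [(b, some x)])) (v := B)
      (fun _ _ => rotations_rotate_one)
      (by simpa [← hW, e] using contains_boundaryWord (p := p) hlab)
    refine hcond (B ++ A) s a b x (by simpa using h4) ?_ h2 fun y hy => ?_
    · simp [h1, h3]
    · have := hcross A s B a b x e y hy
      simp [this.1, this.2]
  · intro A B a x e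
    have ha := at_a A B (a, some x)
    rw [← e] at ha
    obtain ⟨α, hα, hlα⟩ := exists_of_getElem?_boundaryWord p lab ha
    obtain ⟨β, hβ, hαβ⟩ := hlab' α (by simp [hlα])
    have hlβ : lab β = some x := by
      rcases (hlab α β).1 hαβ with h | h
      · exact absurd h.symm hβ
      · rw [← h.1, hlα]
    have hWβ := getElem?_boundaryWord p lab β
    have hne : place β ≠ A.length := fun h => hβ (place_injective (h.trans hα.symm))
    rw [← hW, hlβ, e] at hWβ
    rcases lt_or_gt_of_ne hne with h | h
    · rw [List.getElem?_append_left h] at hWβ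
      exact Or.inl (occurs_of_getElem? hWβ)
    · obtain ⟨t, ht⟩ := Nat.exists_eq_add_of_lt h
      rw [ht, add_assoc, at_L, List.getElem?_cons_succ] at hWβ
      exact Or.inr (occurs_of_getElem? hWβ)

/-- A partition belongs to a category that contains the positioners which `cond` allows, if `cond` holds
for all its pairs. -/
theorem mem_of_cond {C : Family} (hC : IsCategory C) (hs : HasSinglePairs C) {K : ℕ}
    {cond : Color → Color → ℤ → Prop} (hk : C.Contains [] (singles K))
    (hpos : ∀ a b n, cond a b n → HasPositioner C a b n) (hnc : p.IsNoncrossing)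
    (hb : p.BlocksOneOrTwo) (hc : (K : ℤ) ∣ p.c)
    (hcond : ∀ A s a b x, (rotations p).Contains [] (A ++ (a, some x) :: (s ++ [(b, some x)])) →
      ¬ Occurs x A → ¬ Occurs x s → (∀ y, Occurs y s → ¬ Occurs y A) → cond a b (colorSum A)) :
    p ∈ C k l := by
  obtain ⟨lab, hlab, hlab'⟩ := exists_labels p
  rw [mem_iff_contains_words p lab hlab C]
  exact hC.contains_of_line
    ((nestedWord_boundaryWord hnc hb hc hlab hlab' hcond).contains hC hs hk hpos)

/-- In a partition with bicolored pairs, the legs of a pair that ends a rotated word have different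
colors. -/
theorem ColoredPartition.BicoloredPairs.ne (hp : p.BicoloredPairs) {A s : Word} {a b : Color} {x : ℕ}
    (h : (rotations p).Contains [] (A ++ (a, some x) :: (s ++ [(b, some x)]))) (hA : ¬ Occurs x A)
    (hs : ¬ Occurs x s) : a ≠ b := by
  set w : Word := A ++ (a, some x) :: (s ++ [(b, some x)]) with hw
  have hlen : w.length = A.length + s.length + 2 := by simp [hw]; omega
  let i : Fin w.length := ⟨A.length, by omega⟩
  let j : Fin w.length := ⟨A.length + (s.length + 1), by omega⟩
  have hij : i ≠ j := by simp [i, j, Fin.ext_iff]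
  have hi : w.get i = (a, some x) := by simp [i, hw]
  have hj : w.get j = (b, some x) := by simp [j, hw]
  -- the label occurs at two places only
  have hx : ∀ t : Fin w.length, (w.get t).2 = some x → t = i ∨ t = j := by
    intro t ht
    rcases lt_trichotomy (t : ℕ) A.length with h1 | h1 | h1
    · refine absurd ?_ hA
      refine occurs_of_get ⟨t, h1⟩ ?_
      simpa [hw, List.getElem_append_left h1] using ht
    · exact Or.inl (Fin.ext h1)
    · right
      by_contra h2
      have h3 := t.2
      have h4 : (t : ℕ) - A.length - 1 < s.length := by
        have : (t : ℕ) ≠ A.length + (s.length + 1) := fun h => h2 (Fin.ext h)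
        omega
      refine hs (occurs_of_get ⟨_, h4⟩ ?_)
      obtain ⟨u, hu⟩ := Nat.exists_eq_add_of_lt h1
      have h5 : w[(t : ℕ)]? = some (w.get t) := by simp
      have h6 : (t : ℕ) - A.length - 1 = u := by omega
      generalize w.get t = g at h5 ht
      rw [hu, hw, add_assoc, List.getElem?_append_right (Nat.le_add_right _ _), Nat.add_sub_cancel_left,
        List.getElem?_cons_succ, List.getElem?_append_left (by omega)] at h5
      have h7 := (List.getElem?_eq_some_iff.1 h5).2
      simp only [List.get_eq_getElem, h6]
      rw [h7]
      exact ht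
  let q : ColoredPartition 0 w.length := wordPartition [] w
  have hclass : {y | q.rel y (.inr i)} = {.inr i, .inr j} := by
    ext (y | y)
    · exact y.elim0
    · refine (labelSetoid_iff (rowLabels [] w) (.inr y) (.inr i)).trans ?_
      simp only [rowLabels, Sum.elim_inr, hi, Set.mem_insert_iff, Set.mem_singleton_iff, Sum.inr.injEq]
      constructor
      · rintro (h | ⟨h, -⟩)
        · exact Or.inl h
        · exact hx y h
      · rintro (h | rfl)
        · exact Or.inl h
        · exact Or.inr ⟨by rw [hj], by rw [hj]; simp⟩
  have := hp _ q h {y | q.rel y (.inr i)} ⟨_, rfl⟩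
    (by rw [hclass]; exact Set.ncard_pair (by simpa using hij)) i j (by rw [hclass]; simp)
    (by rw [hclass]; simp) hij
  intro hab
  refine this ?_
  change (w.get i).1 = (w.get j).1
  rw [hi, hj, hab]

end

/-! ### The generated categories -/

/-- The two positioners that are generators generate all positioners allowed by the nest condition. -/
theorem hasPositioner_of_nestCondition {C : Family} (hC : IsCategory C) (hs : HasSinglePairs C)
    {d r : ℕ} (hd : HasPositioner C .white .black d) (hr : HasPositioner C .black .black (r + 1))
    {a b : Color} {n : ℤ} (h : NestCondition d r a b n) : HasPositioner C a b n := by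
  have hbb : ∀ t : ℤ, HasPositioner C .black .black (d * t + r + 1) := fun t => by
    have e : (d : ℤ) * t + r + 1 = r + 1 + d * t := by ring
    rw [e]
    exact HasPositioner.add hC hs (HasPositioner.mul hC hs hd .black t) hr
  cases a <;> cases b <;> obtain ⟨t, ht⟩ := h
  · have := HasPositioner.neg hC hs (hbb t)
    rwa [← ht, neg_neg] at this
  · rw [ht]
    exact HasPositioner.mul hC hs hd .white t
  · rw [ht]
    exact HasPositioner.mul hC hs hd .black t
  · rw [ht]
    exact hbb t

theorem hasPositioner_of_positioner_mem {C : Family} {d : ℕ}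
    (h : positioner d ∈ C 0 ((d : ℤ).natAbs + ((-(d : ℤ)).natAbs + 1 + 1))) :
    HasPositioner C .white .black d := fun z => by
  simpa [Color.sign] using contains_singletonsAround h z

theorem hasPositioner_of_blackPositioner_mem {C : Family} {r : ℕ}
    (h : blackPositioner r ∈ C 0 (((r : ℤ) + 1).natAbs + ((1 - (r : ℤ)).natAbs + 1 + 1))) :
    HasPositioner C .black .black (r + 1) := fun z => by
  have e : -((r : ℤ) + 1) - Color.black.sign - Color.black.sign = 1 - r := by
    simp only [Color.sign]; ring
  rw [e]
  exact contains_singletonsAround h z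

section

variable {k d r k' l' : ℕ} {p : ColoredPartition k' l'}

theorem mem_generated_gensB' (hnc : p.IsNoncrossing)
    (hb : p.BlocksOneOrTwo) (hc : ∃ t : ℤ, p.c = k * t)
    (hcond : ∀ A s a b x, (rotations p).Contains [] (A ++ (a, some x) :: (s ++ [(b, some x)])) →
      ¬ Occurs x A → ¬ Occurs x s → (∀ y, Occurs y s → ¬ Occurs y A) →
      NestCondition d r a b (colorSum A)) :
    p ∈ generated (gensB' k d r) k' l' := by
  have hC := isCategory_generated (gensB' k d r)
  have hs := contains_singletonWB hC fun C _ hG => hG ⟨0, _, singletonWB⟩ (by simp [gensB'])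
  refine mem_of_cond hC hs (contains_singletons fun C _ hG => hG ⟨0, _, singletons k⟩ (by simp [gensB']))
    (fun a b n => hasPositioner_of_nestCondition hC hs ?_ ?_) hnc hb hc hcond
  · exact hasPositioner_of_positioner_mem fun C _ hG => hG ⟨0, _, positioner d⟩ (by simp [gensB'])
  · exact hasPositioner_of_blackPositioner_mem fun C _ hG =>
      hG ⟨0, _, blackPositioner r⟩ (by simp [gensB'])

theorem mem_generated_gensB (hnc : p.IsNoncrossing)
    (hb : p.BlocksOneOrTwo) (hc : ∃ t : ℤ, p.c = k * t) (hbi : p.BicoloredPairs)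
    (hcond : ∀ A s a b x, (rotations p).Contains [] (A ++ (a, some x) :: (s ++ [(b, some x)])) →
      ¬ Occurs x A → ¬ Occurs x s → (∀ y, Occurs y s → ¬ Occurs y A) → a ≠ b →
      NestCondition d r a b (colorSum A)) :
    p ∈ generated (gensB k d) k' l' := by
  have hC := isCategory_generated (gensB k d)
  have hs := contains_singletonWB hC fun C _ hG => hG ⟨0, _, singletonWB⟩ (by simp [gensB])
  have hd : HasPositioner (generated (gensB k d)) .white .black d :=
    hasPositioner_of_positioner_mem fun C _ hG => hG ⟨0, _, positioner d⟩ (by simp [gensB])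
  refine mem_of_cond (cond := fun a b n => a ≠ b ∧ NestCondition d r a b n) hC hs
    (contains_singletons fun C _ hG => hG ⟨0, _, singletons k⟩ (by simp [gensB])) ?_ hnc hb hc
    fun A s a b x h hA hx hAs => ⟨hbi.ne h hA hx, hcond A s a b x h hA hx hAs (hbi.ne h hA hx)⟩
  rintro a b n ⟨hab, h⟩
  cases a <;> cases b <;> obtain ⟨t, ht⟩ := h
  · exact absurd rfl hab
  · exact ht ▸ HasPositioner.mul hC hs hd .white t
  · exact ht ▸ HasPositioner.mul hC hs hd .black t
  · exact absurd rfl hab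

/-- If all points lie between the legs of a pair, then the nest condition can be read off with the legs
interchanged. -/
theorem NestCondition.of_rotated (hdr : (d : ℤ) ∣ 2 * r) {a b : Color} {s : ℤ}
    (hs : (d : ℤ) ∣ a.sign + s + b.sign) (h : NestCondition d r b a s) : NestCondition d r a b 0 := by
  obtain ⟨u, hu⟩ := hdr
  obtain ⟨v, hv⟩ := hs
  cases a <;> cases b <;> obtain ⟨t, ht⟩ := h
  · refine ⟨-u - v - t, ?_⟩
    simp only [Color.sign] at hv
    linear_combination -hu - hv - ht
  · exact ⟨0, by simp⟩
  · exact ⟨0, by simp⟩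
  · refine ⟨-u + v - t, ?_⟩
    simp only [Color.sign] at hv
    linear_combination -hu + hv - ht

/-- The nest condition for nonempty `p₁` implies the nest condition for empty `p₁`, apart from a pair of
two points of the same color in one exceptional case. -/
theorem nestCondition_of_nestDecomposed (h : Admissible k d r) (hc : ∃ t : ℤ, p.c = k * t)
    (hloc : ∀ (m n : ℕ) (p₁ : ColoredPartition 0 m) (p₂ : ColoredPartition 0 (n + 2)),
      Rotated p (p₁.tensor p₂) → NestDecomposed p₁ p₂ →
        NestCondition d r (p₂.lo 0) (p₂.lo (Fin.last (n + 1))) p₁.c)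
    {A s : Word} {a b : Color} {x : ℕ} (hex : a ≠ b ∨ ¬ (k = 2 ∧ d = 2 ∧ r = 0))
    (hw : (rotations p).Contains [] (A ++ (a, some x) :: (s ++ [(b, some x)])))
    (hA : ¬ Occurs x A) (hs : ¬ Occurs x s) (hAs : ∀ y, Occurs y s → ¬ Occurs y A) :
    NestCondition d r a b (colorSum A) := by
  obtain ⟨t, ht⟩ := hc
  have hsum := colorSum_eq_of_contains hw
  simp only [colorSum_append, colorSum_cons, colorSum_nil] at hsum
  by_cases hA0 : A = []
  · subst hA0
    by_cases hs0 : s = []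
    · -- a single pair, where only the color sum gives a condition
      subst hs0
      simp only [colorSum_nil] at hsum ⊢
      by_cases hab : a = b
      · have hk : k ≠ 0 := by
          rintro rfl
          subst hab
          cases a <;> simp [Color.sign] at hsum ht <;> omega
        have hk2 : k ∣ 2 := by
          subst hab
          rw [← Int.natCast_dvd_natCast]
          cases a <;> simp only [Color.sign] at hsum
          · exact ⟨t, by push_cast; linarith⟩
          · exact ⟨-t, by push_cast; linarith⟩
        have hd2 := h.1 hk
        have hk' : k = 1 ∨ k = 2 := (Nat.dvd_prime Nat.prime_two).1 hk2
        have hd' : d = 1 ∨ d = 2 := (Nat.dvd_prime Nat.prime_two).1 (hd2.trans hk2)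
        have hd1 : d = 1 := by
          rcases hd' with rfl | rfl
          · rfl
          · exfalso
            have h2 := h.2.1
            have h3 := h.2.2
            have hk2 : k = 2 := by
              rcases hk' with rfl | rfl
              · omega
              · rfl
            exact hex.elim (fun h => h hab) fun h => h ⟨hk2, rfl, by omega⟩
        subst hd1 hab
        cases a
        · exact ⟨-r - 1, by push_cast; ring⟩
        · exact ⟨-r - 1, by push_cast; ring⟩
      · cases a <;> cases b
        · exact absurd rfl hab
        · exact ⟨0, by simp⟩
        · exact ⟨0, by simp⟩
        · exact absurd rfl hab
    · -- the points between the legs are rotated to the front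
      have hw' := Family.line_rotate (u := [(a, some x)]) (v := s ++ [(b, some x)])
        (fun _ _ => rotations_rotate_one) (by simpa using hw)
      obtain ⟨p₁, p₂, h1, h2, rfl, rfl, h5⟩ :=
        exists_rotated_tensor (A := s) (s := []) (a := b) (b := a) (x := x) (by simpa using hw') hs
          (by simp)
      have h6 := hloc _ _ p₁ p₂ h1 ⟨by simpa using hs0, h2⟩
      rw [h5] at h6
      exact NestCondition.of_rotated h.dvd_two_mul
        (h.dvd_of_dvd ⟨t, by rw [← ht, ← hsum]; simp; ring⟩) h6
  · obtain ⟨p₁, p₂, h1, h2, rfl, rfl, h5⟩ := exists_rotated_tensor hw hA hAs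
    rw [← h5]
    exact hloc _ _ p₁ p₂ h1 ⟨by simpa using hA0, h2⟩

theorem locB'_subset_generated : locB' k d r k' l' ⊆ generated (gensB' k d r) k' l' := by
  rintro p ⟨hnc, hb, hc, hloc⟩
  refine mem_generated_gensB' hnc hb hc fun A s a b x h hA _ hAs => ?_
  obtain ⟨p₁, p₂, h1, h2, rfl, rfl, h5⟩ := exists_rotated_tensor h hA hAs
  rw [← h5]
  exact hloc _ _ p₁ p₂ h1 h2

theorem locB'Nest_subset_generated (h : Admissible k d r) (hex : ¬ (k = 2 ∧ d = 2 ∧ r = 0)) :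
    locB'Nest k d r k' l' ⊆ generated (gensB' k d r) k' l' := by
  rintro p ⟨hnc, hb, hc, hloc⟩
  exact mem_generated_gensB' hnc hb hc fun A s a b x hw hA hs hAs =>
    nestCondition_of_nestDecomposed h hc hloc (Or.inr hex) hw hA hs hAs

theorem locBNest_subset_generated (h : Admissible k d r) :
    locBNest k d r k' l' ⊆ generated (gensB k d) k' l' := by
  rintro p ⟨⟨hnc, hb, hc, hloc⟩, hbi⟩
  exact mem_generated_gensB (r := r) hnc hb hc hbi fun A s a b x hw hA hs hAs hab =>
    nestCondition_of_nestDecomposed h hc hloc (Or.inl hab) hw hA hs hAs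

theorem locB'_subset_locB'Nest : locB' k d r k' l' ⊆ locB'Nest k d r k' l' :=
  fun _ hp => ⟨hp.1, hp.2.1, hp.2.2.1, fun m n p₁ p₂ h1 h2 => hp.2.2.2 m n p₁ p₂ h1 h2.2⟩

end

theorem generated_gensB'_subset_locB' {k d r : ℕ} (h : Admissible k d r) (k' l' : ℕ) :
    generated (gensB' k d r) k' l' ⊆ locB' k d r k' l' :=
  (generated_subset_levelled h k' l').trans (levelled_subset_locB' h k' l')

theorem generated_gensB_subset_locB {k d r : ℕ} (h : Admissible k d r) (k' l' : ℕ) :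
    generated (gensB k d) k' l' ⊆ locB k d r k' l' :=
  (generated_subset_levelled_bicolored h k' l').trans (levelled_subset_locB h k' l')

/-! ### The categories are pairwise different -/

section

variable {k d r k' d' r' : ℕ}

/-- The nest condition for a single pair, preceded by singletons and with singletons between its legs. -/
theorem nestCondition_of_singletonsAround_mem {s t : ℤ} {a b : Color}
    (h : singletonsAround s a t b ∈ locB' k d r 0 _) : NestCondition d r a b s := by
  have hw := contains_singletonsAround (C := rotations (singletonsAround s a t b)) Rotated.refl 0
  obtain ⟨p₁, p₂, h1, h2, rfl, rfl, h5⟩ := exists_rotated_tensor hw (not_occurs_singles _ _) (by simp)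
  have := h.2.2.2 _ _ p₁ p₂ h1 h2
  rwa [h5, colorSum_singles] at this

theorem dvd_of_singletons_mem (h : singletons k ∈ locB' k' d' r' 0 _) : k' ∣ k := by
  obtain ⟨t, ht⟩ := h.2.2.1
  rw [c_singletons] at ht
  exact Int.natCast_dvd_natCast.1 ⟨t, ht⟩

theorem dvd_of_positioner_mem (h : positioner d ∈ locB' k' d' r' 0 _) : d' ∣ d := by
  obtain ⟨t, ht⟩ := nestCondition_of_singletonsAround_mem h
  exact Int.natCast_dvd_natCast.1 ⟨t, ht⟩

/-- The black positioner determines which of the two values the last parameter has. -/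
theorem eq_of_blackPositioner_mem (h : Admissible k d r) (h' : Admissible k' d r')
    (hr : blackPositioner r ∈ locB' k' d r' 0 _) : r = r' := by
  obtain ⟨t, ht⟩ := nestCondition_of_singletonsAround_mem hr
  rcases h.2.1 with h1 | h1 <;> rcases h'.2.1 with h2 | h2
  · omega
  · subst h1 h2
    have : (r' : ℤ) * (2 * t + 1) = 0 := by push_cast at ht; linear_combination -ht
    rcases mul_eq_zero.1 this with h | h <;> omega
  · subst h1 h2
    have : (r : ℤ) * (2 * t - 1) = 0 := by push_cast at ht; linear_combination -ht
    rcases mul_eq_zero.1 this with h | h <;> omega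
  · omega

theorem blackPositioner_not_bicolored : ¬ (blackPositioner r).BicoloredPairs := fun h =>
  h.ne (contains_singletonsAround (C := rotations (blackPositioner r)) Rotated.refl 0)
    (not_occurs_singles _ _) (not_occurs_singles _ _) rfl

theorem singletons_mem_locB (h : Admissible k d r) : singletons k ∈ locB k d r 0 _ :=
  levelled_subset_locB h _ _ (singletons_mem_levelled k d r True)

theorem positioner_mem_locB (h : Admissible k d r) : positioner d ∈ locB k d r 0 _ :=
  levelled_subset_locB h _ _ (positioner_mem_levelled h.dvd_two_mul True)

theorem blackPositioner_mem_locB' (h : Admissible k d r) : blackPositioner r ∈ locB' k d r 0 _ :=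
  levelled_subset_locB' h _ _ (blackPositioner_mem_levelled h.dvd_two_mul)

/-- Two of the parameters are determined by the partitions with bicolored pairs. -/
theorem eq_of_locB_subset (h : Admissible k d r) (h' : Admissible k' d' r')
    (h1 : ∀ l, locB k d r 0 l ⊆ locB' k' d' r' 0 l) (h2 : ∀ l, locB k' d' r' 0 l ⊆ locB' k d r 0 l) :
    k = k' ∧ d = d' :=
  ⟨Nat.dvd_antisymm (dvd_of_singletons_mem (h2 _ (singletons_mem_locB h')))
      (dvd_of_singletons_mem (h1 _ (singletons_mem_locB h))),
    Nat.dvd_antisymm (dvd_of_positioner_mem (h2 _ (positioner_mem_locB h')))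
      (dvd_of_positioner_mem (h1 _ (positioner_mem_locB h)))⟩

end

end TwoColored

theorem mainTheorem4 :
    -- the sets are the categories generated by the stated partitions
    (∀ k d r : ℕ, TwoColored.Admissible k d r →
      TwoColored.locB' k d r = TwoColored.generated (TwoColored.gensB' k d r) ∧
      TwoColored.locB k d r = TwoColored.generated (TwoColored.gensB k d)) ∧
    -- the same with the nest condition for nonempty `p₁` only, apart from one exceptional case
    (∀ k d r : ℕ, TwoColored.Admissible k d r →
      (¬ (k = 2 ∧ d = 2 ∧ r = 0) →
        TwoColored.locB'Nest k d r = TwoColored.generated (TwoColored.gensB' k d r)) ∧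
      TwoColored.locBNest k d r = TwoColored.generated (TwoColored.gensB k d)) ∧
    -- the categories are pairwise different
    (∀ k d r k' d' r' : ℕ, TwoColored.Admissible k d r → TwoColored.Admissible k' d' r' →
      (TwoColored.locB' k d r = TwoColored.locB' k' d' r' → k = k' ∧ d = d' ∧ r = r') ∧
      (TwoColored.locB k d r = TwoColored.locB k' d' r' → k = k' ∧ d = d') ∧
      TwoColored.locB' k d r ≠ TwoColored.locB k' d' r') := by
  open TwoColored in
  refine ⟨fun k d r h => ⟨?_, ?_⟩, fun k d r h => ⟨fun hex => ?_, ?_⟩,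
    fun k d r k' d' r' h h' => ⟨fun e => ?_, fun e => ?_, fun e => ?_⟩⟩
  · funext k' l'
    exact locB'_subset_generated.antisymm (generated_gensB'_subset_locB' h k' l')
  · funext k' l'
    refine Set.Subset.antisymm (fun p hp => ?_) (generated_gensB_subset_locB h k' l')
    exact locBNest_subset_generated h ⟨locB'_subset_locB'Nest hp.1, hp.2⟩
  · funext k' l'
    exact (locB'Nest_subset_generated h hex).antisymm
      ((generated_gensB'_subset_locB' h k' l').trans locB'_subset_locB'Nest)
  · funext k' l'
    refine (locBNest_subset_generated h).antisymm fun p hp => ?_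
    have hp' := generated_gensB_subset_locB h k' l' hp
    exact ⟨locB'_subset_locB'Nest hp'.1, hp'.2⟩
  · obtain ⟨rfl, rfl⟩ := eq_of_locB_subset h h' (fun l p hp => e ▸ hp.1) (fun l p hp => e ▸ hp.1)
    exact ⟨rfl, rfl, eq_of_blackPositioner_mem h h' (e ▸ blackPositioner_mem_locB' h)⟩
  · exact eq_of_locB_subset h h' (fun l p hp => (e ▸ hp : p ∈ locB k' d' r' 0 l).1)
      (fun l p hp => (e ▸ hp : p ∈ locB k d r 0 l).1)
  · have h1 := blackPositioner_mem_locB' h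
    rw [e] at h1
    exact blackPositioner_not_bicolored h1.2
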